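/- **Setting.** Let $A$ be a complete deterministic finite automaton with finite state set $Q$, $|Q|=n$, finite input alphabet $\Sigma$ and state transition graph $\Gamma$ (edges $p\to p\sigma$, $\sigma\in\Sigma$). For states $p,q$ write $p\succeq q$ if $p=q$ or $q$ is reachable from $p$ in $\Gamma$; $p\sim q$ if $p\succeq q$ and $q\succeq p$; $p\succ q$ if $p\succeq q$ and $q\not\succeq p$. The graph $\Gamma^2$ has node set $Q\times Q$ and edges $(p,q)\to(p\sigma,q\sigma)$, $\sigma\in\Sigma$; an SCC-node of $\Gamma^2$ is a node that lies on a closed path with at least one edge. For $k\ge 1$, say that two nonempty words over $\Sigma$ have the same $k$-data if they have the same prefix of length $k-1$ and the same suffix of length $k-1$ (the whole word if it is shorter) and the same set of factors of length $k$. A language $L$ is locally testable if for some $k\ge1$ any two nonempty words with the same $k$-data are both in $L$ or both not in $L$. The automaton $A$ is locally testable if its transition semigroup, generated by the letters, is: for some $k\ge 1$ any two nonempty words with the same $k$-data induce the same transformation of $Q$. **The test.** (1) Check that every SCC-node $(p,q)$ of $\Gamma^2$ with $p\sim q$ satisfies $p=q$; if not, reject. (2) Delete from $\Gamma^2$ all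 edges $(p,q)\to(r,s)$ with $s\not\succeq q$ and $s\not\succeq p$. Mark every node $(p,q)$ such that for some $\sigma\in\Sigma$ exactly one of $p\sigma\succeq q$, $q\sigma\succeq q$ holds. Add a source node with an edge to every SCC-node $(p,q)$ of $\Gamma^2$ with $p\succ q$. Accept if and only if no marked node is reachable from the source. **Claim.** (a) For every $A$, the test accepts if and only if $A$ is locally testable. If moreover $A$ has a start state and accepting states for which it is reduced (all states are reachable from the start state and distinct states are distinguished by some word), then the test accepts if and only if the language accepted by $A$ is locally testable. (b) The test can be carried out in $O(n^2)$ time for a fixed alphabet, more precisely in $O((|\Sigma|+1)\,n^2)$ time uniformly in $\Sigma$: there are one random access machine program (operations: constants, addition, truncated subtraction, indirect load and store, branching and loops on a register being nonzero, each at unit cost) and one constant $C$ such that, given the transition table of any $A$ with $n$ states, the program halts after at most $C(|\Sigma|+1)n^2$ steps, never computes a number larger than $C(|\Sigma|+1)n^2$, and outputs the verdict of the test, that is, whether $A$ is locally testable, together with the outcome of check (1), the table of the relation $\succeq$, and, if check (1) succeeds, the tables of the marked nodes and of the nodes reachable from the source. -/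

import Mathlib

namespace LocalTestability

universe u v

/-! ### Locally testable languages and automata -/

section Testable

variable {α : Type u} {σ : Type v}

/-- The words `u` and `v` have the same prefix of length `k - 1`, the same suffix of length `k - 1`
(the whole word, if it is shorter than that) and the same set of factors of length `k`. -/
def SameTestData (k : ℕ) (u v : List α) : Prop :=
  u.take (k - 1) = v.take (k - 1) ∧
  u.rtake (k - 1) = v.rtake (k - 1) ∧
  ∀ x : List α, x.length = k → (x <:+: u ↔ x <:+: v)

/-- A language is locally testable if for some positive `k` membership of a nonempty word depends
only on its prefix and suffix of length `k - 1` and on its set of factors of length `k`. -/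
def LocallyTestableLanguage (L : Language α) : Prop :=
  ∃ k : ℕ, 0 < k ∧ ∀ u v : List α, u ≠ [] → v ≠ [] → SameTestData k u v → (u ∈ L ↔ v ∈ L)

/-- The transition semigroup of `A`, generated by the letters, is locally testable: for some
positive `k`, any two nonempty words with the same test data induce the same transformation of
the set of states. -/
def LocallyTestableTransitions (A : DFA α σ) : Prop :=
  ∃ k : ℕ, 0 < k ∧ ∀ u v : List α, u ≠ [] → v ≠ [] → SameTestData k u v →
    ∀ p : σ, A.evalFrom p u = A.evalFrom p v

/-- `A` is reduced (minimal): every state is reachable from the start state, and distinct states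
are distinguished by some word. -/
def IsReducedDFA (A : DFA α σ) : Prop :=
  (∀ q : σ, ∃ w : List α, A.eval w = q) ∧
  ∀ p q : σ, (∀ w : List α, A.evalFrom p w ∈ A.accept ↔ A.evalFrom q w ∈ A.accept) → p = q

end Testable

/-! ### The state transition graph, its square, and the test -/

section Graph

variable {α : Type u} {σ : Type v}

/-- Edges of the state transition graph `Γ` of `A`. -/
def Edge (A : DFA α σ) (p q : σ) : Prop := ∃ a : α, A.step p a = q

/-- `p ⪰ q`: the node `q` is reachable from `p`, or `p = q`. -/
def Reach (A : DFA α σ) : σ → σ → Prop := Relation.ReflTransGen (Edge A)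

/-- `p ∼ q`: `p ⪰ q` and `q ⪰ p`. -/
def Equi (A : DFA α σ) (p q : σ) : Prop := Reach A p q ∧ Reach A q p

/-- `p ≻ q`: `p ⪰ q` but not `q ⪰ p`. -/
def StrictReach (A : DFA α σ) (p q : σ) : Prop := Reach A p q ∧ ¬ Reach A q p

/-- Edges of the direct product `Γ²`: both components move along the same letter. -/
def PairEdge (A : DFA α σ) (x y : σ × σ) : Prop :=
  ∃ a : α, A.step x.1 a = y.1 ∧ A.step x.2 a = y.2

/-- `x` is an SCC-node of `Γ²`: it lies on a closed path with at least one edge. -/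
def SCCNode (A : DFA α σ) (x : σ × σ) : Prop := Relation.TransGen (PairEdge A) x x

/-- Condition (1): an SCC-node `(p, q)` of `Γ²` with `p ∼ q` has `p = q`. -/
def ConditionOne (A : DFA α σ) : Prop :=
  ∀ p q : σ, SCCNode A (p, q) → Equi A p q → p = q

/-- The edges of `Γ²` that survive the deletion of all edges `(p, q) → (r, s)` with
`s ⋡ q` and `s ⋡ p`. -/
def KeptEdge (A : DFA α σ) (x y : σ × σ) : Prop :=
  PairEdge A x y ∧ ¬ (¬ Reach A y.2 x.2 ∧ ¬ Reach A y.2 x.1)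

/-- `(p, q)` is marked: for some letter `a`, exactly one of `pa ⪰ q`, `qa ⪰ q` holds. -/
def Marked (A : DFA α σ) (x : σ × σ) : Prop :=
  ∃ a : α, Xor (Reach A (A.step x.1 a) x.2) (Reach A (A.step x.2 a) x.2)

/-- The pruned square with an additional source node `none`, which has edges to all SCC-nodes
`(p, q)` of `Γ²` with `p ≻ q`. -/
def SourcedEdge (A : DFA α σ) : Option (σ × σ) → Option (σ × σ) → Prop
  | none, some y => SCCNode A y ∧ StrictReach A y.1 y.2
  | some x, some y => KeptEdge A x y
  | _, none => False

/-- The node `x` of `Γ²` is reachable from the source. -/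
def Visited (A : DFA α σ) (x : σ × σ) : Prop :=
  Relation.ReflTransGen (SourcedEdge A) none (some x)

/-- The verdict of the algorithm. -/
def TestAccepts (A : DFA α σ) : Prop :=
  ConditionOne A ∧ ∀ x : σ × σ, Visited A x → ¬ Marked A x

end Graph

/-! ### A random access machine with a step count -/

/-- Programs of a random access machine with registers numbered by `ℕ` and a memory of
cells numbered by `ℕ`. -/
inductive Prog : Type
  /-- do nothing -/
  | skip : Prog
  /-- `r x := c` -/
  | const (x c : ℕ) : Prog
  /-- `r x := r y + r z` -/
  | add (x y z : ℕ) : Prog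
  /-- `r x := r y - r z`, truncated at `0` -/
  | sub (x y z : ℕ) : Prog
  /-- `r x := mem (r y)` -/
  | load (x y : ℕ) : Prog
  /-- `mem (r x) := r y` -/
  | store (x y : ℕ) : Prog
  /-- sequential composition -/
  | seq (c d : Prog) : Prog
  /-- if `r x ≠ 0` then `c` else `d` -/
  | ite (x : ℕ) (c d : Prog) : Prog
  /-- while `r x ≠ 0` do `c` -/
  | loop (x : ℕ) (c : Prog) : Prog

/-- Contents of the registers and of the memory. -/
structure MachineState : Type where
  reg : ℕ → ℕ
  mem : ℕ → ℕ

namespace MachineState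

def setReg (s : MachineState) (x m : ℕ) : MachineState :=
  { s with reg := Function.update s.reg x m }

def setMem (s : MachineState) (i m : ℕ) : MachineState :=
  { s with mem := Function.update s.mem i m }

end MachineState

/-- `Runs W P s t s'`: started in state `s`, the program `P` halts in state `s'` after exactly `t`
steps, and no number that it computes on the way exceeds `W` (a word has about `log W` bits).
Every elementary instruction and every test of a register is one step. -/
inductive Runs (W : ℕ) : Prog → MachineState → ℕ → MachineState → Prop
  | skip (s : MachineState) : Runs W Prog.skip s 1 s
  | const (s : MachineState) (x c : ℕ) (h : c ≤ W) :
      Runs W (Prog.const x c) s 1 (s.setReg x c)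
  | add (s : MachineState) (x y z : ℕ) (h : s.reg y + s.reg z ≤ W) :
      Runs W (Prog.add x y z) s 1 (s.setReg x (s.reg y + s.reg z))
  | sub (s : MachineState) (x y z : ℕ) (h : s.reg y - s.reg z ≤ W) :
      Runs W (Prog.sub x y z) s 1 (s.setReg x (s.reg y - s.reg z))
  | load (s : MachineState) (x y : ℕ) (h : s.mem (s.reg y) ≤ W) :
      Runs W (Prog.load x y) s 1 (s.setReg x (s.mem (s.reg y)))
  | store (s : MachineState) (x y : ℕ) (h : s.reg y ≤ W) :
      Runs W (Prog.store x y) s 1 (s.setMem (s.reg x) (s.reg y))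
  | seq {c d : Prog} {s s' s'' : MachineState} {t t' : ℕ}
      (h : Runs W c s t s') (h' : Runs W d s' t' s'') :
      Runs W (Prog.seq c d) s (t + t') s''
  | iteTrue {x : ℕ} {c d : Prog} {s s' : MachineState} {t : ℕ}
      (hx : s.reg x ≠ 0) (h : Runs W c s t s') : Runs W (Prog.ite x c d) s (1 + t) s'
  | iteFalse {x : ℕ} {c d : Prog} {s s' : MachineState} {t : ℕ}
      (hx : s.reg x = 0) (h : Runs W d s t s') : Runs W (Prog.ite x c d) s (1 + t) s'
  | loopDone {x : ℕ} {c : Prog} {s : MachineState}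
      (hx : s.reg x = 0) : Runs W (Prog.loop x c) s 1 s
  | loopStep {x : ℕ} {c : Prog} {s s' s'' : MachineState} {t t' : ℕ}
      (hx : s.reg x ≠ 0) (h : Runs W c s t s') (h' : Runs W (Prog.loop x c) s' t' s'') :
      Runs W (Prog.loop x c) s (1 + t + t') s''

/-- The machine state that presents the transition graph of an automaton with `k` letters and `n`
states: register `0` holds `n`, register `1` holds `k`, memory cell `p * k + a` holds the
state `pa`, and everything else is `0`. -/
def inputState {k n : ℕ} (A : DFA (Fin k) (Fin n)) : MachineState where
  reg x := if x = 0 then n else if x = 1 then k else 0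
  mem i := if h : i < n * k then
      (A.step (Fin.divNat ⟨i, h⟩) (Fin.modNat ⟨i, h⟩) : ℕ) else 0

/-- The number `m` is the truth value (`1` or `0`) of `P`. -/
def IsBit (P : Prop) (m : ℕ) : Prop := (P ∧ m = 1) ∨ (¬ P ∧ m = 0)

/-- From cell `b` on, the memory of `s` holds the `n × n` table of truth values of `R`. -/
def IsTable {n : ℕ} (s : MachineState) (b : ℕ) (R : Fin n × Fin n → Prop) : Prop :=
  ∀ p q : Fin n, IsBit (R (p, q)) (s.mem (b + p * n + q))

/-- What the algorithm leaves behind: the verdict (register `0`), the result of the check of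
condition (1) (register `1`), the reachability table of `Γ` (from the cell given by register `2`
on) and, if condition (1) holds, the marked nodes and the nodes reachable from the source
(from the cells given by registers `3` and `4` on). -/
def AlgorithmOutput {k n : ℕ} (A : DFA (Fin k) (Fin n)) (s : MachineState) : Prop :=
  IsBit (TestAccepts A) (s.reg 0) ∧
  IsBit (ConditionOne A) (s.reg 1) ∧
  IsTable s (s.reg 2) (fun x => Reach A x.1 x.2) ∧
  (ConditionOne A →
    IsTable s (s.reg 3) (Marked A) ∧ IsTable s (s.reg 4) (Visited A))

end LocalTestability

open LocalTestability

/-! Both directions of (a) go through a reformulation of the test, `testAccepts_iff`: condition (1)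
together with `ConditionTwo`, which says that for an SCC-node (p, q) with p ⪰ q a word w satisfies
pw ⪰ q if and only if qw ⪰ q. A marked node is a failure of this at a single letter. Along kept
edges from a source the second component stays equivalent to q as long as no failure has occurred,
so the pruned search finds a failure whenever there is one.

Necessity: a loop at (p, q) can be repeated until its label t is longer than k. Words that begin and
end with t and have the same set of blocks between the displayed copies of t have the same k-data
(`sameTestData_of_blocks`). Suitable blocks give both conditions.

Sufficiency: let N be the number of maps Q → Q. Words of length 2N are the vertices of a de Bruijn
graph, and two words with the same data for k = 2N + 1 are two paths in it with the same ends and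
the same set of edges. By the pigeonhole principle every stretch of N letters contains a position at
which all states reached are fixed by one nonempty word. The state is recorded with a delay, at the
last such position. Two delayed states at one window then form an SCC-node, so condition (1) makes ⪰
antisymmetric on them and condition (2) says that an edge treats comparable ones alike. This is an
`IsLocalAction`, and `IsLocalAction.pathAct_eq` shows that paths with the same ends and edges act
alike. If the end can return to the start along edges of the path, the two final states are each ⪰
the other. Otherwise both paths leave the strong component of the start by the same edge, and the
rest is shorter.

For the language, the k-data are a congruence, and in a reduced automaton words lead to every state
and separate any two.

Complexity: every phase is linear in the edges of a graph on Q × Q with |Σ| edges per node. The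
relation ⪰ is one search along (p, q) → (p, qa). Strong components of Γ² are never computed.
Restricted to edges that stay in the classes of both coordinates and avoid the diagonal, Γ² is
trimmed by topological sorting. The nodes that survive are those to which a cycle leads, and they
can replace the SCC-nodes (`conditionOne_iff_acc`, `visited_iff_acc`). Search and sorting are one
worklist algorithm (`halts_worklistProg`) with different initial counters. The programs are verified
on a machine with arrays and compiled at the cost of a factor of two (`ArrayRuns.compile`). -/

namespace LocalTestability

universe u v w

/-! ### Paths in a deterministic graph acting on a preordered set -/

section LocalAction

variable {V : Type u} {α : Type v} {Q : Type w}

/-- A deterministic graph with vertices `V` and edges `V × α` acts on `Q`, increasing a preorder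
`R`; the set `D z` of states at the vertex `z` is partially ordered by `R`, and for states
`p`, `q` with `R p q` in it an edge leaves the part above `q` from both or from neither. -/
structure IsLocalAction (step : V → α → V) (act : V → α → Q → Q) (R : Q → Q → Prop)
    (D : V → Set Q) : Prop where
  refl : ∀ q, R q q
  trans : ∀ {p q r}, R p q → R q r → R p r
  le_act : ∀ z a q, R q (act z a q)
  mapsTo : ∀ {z q} a, q ∈ D z → act z a q ∈ D (step z a)
  antisymm : ∀ {z p q}, p ∈ D z → q ∈ D z → R p q → R q p → p = q
  act_iff : ∀ {z p q} a, p ∈ D z → q ∈ D z → R p q → (R (act z a p) q ↔ R (act z a q) q)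

/-- The action of a path. -/
def pathAct (step : V → α → V) (act : V → α → Q → Q) : V → List α → Q → Q
  | _, [], q => q
  | z, a :: w, q => pathAct step act (step z a) w (act z a q)

/-- The edges of a path. -/
def pathEdges (step : V → α → V) : V → List α → Set (V × α)
  | _, [] => ∅
  | z, a :: w => insert (z, a) (pathEdges step (step z a) w)

variable {step : V → α → V} {act : V → α → Q → Q} {R : Q → Q → Prop} {D : V → Set Q}

theorem pathAct_append (z : V) (x y : List α) (q : Q) :
    pathAct step act z (x ++ y) q = pathAct step act (x.foldl step z) y (pathAct step act z x q) := by
  induction x generalizing z q with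
  | nil => rfl
  | cons a x ih => simpa [pathAct] using ih _ _

theorem pathEdges_append (z : V) (x y : List α) :
    pathEdges step z (x ++ y) = pathEdges step z x ∪ pathEdges step (x.foldl step z) y := by
  induction x generalizing z with
  | nil => simp [pathEdges]
  | cons a x ih => simp [pathEdges, ih, Set.insert_union]

theorem exists_eq_append_of_mem_pathEdges {z : V} {x : List α} {e : V × α}
    (h : e ∈ pathEdges step z x) :
    ∃ x₁ x₂, x = x₁ ++ e.2 :: x₂ ∧ x₁.foldl step z = e.1 := by
  induction x generalizing z with
  | nil => simp [pathEdges] at h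
  | cons a x ih =>
    rcases h with rfl | h
    · exact ⟨[], x, rfl, rfl⟩
    · obtain ⟨x₁, x₂, hx, hc⟩ := ih h
      exact ⟨a :: x₁, x₂, by rw [hx]; rfl, hc⟩

theorem mem_pathEdges_append (z : V) (x₁ x₂ : List α) (a : α) :
    (x₁.foldl step z, a) ∈ pathEdges step z (x₁ ++ a :: x₂) := by
  rw [pathEdges_append]
  exact Or.inr (Or.inl rfl)

/-- The vertex `z` can be reached from `c` along edges in `E`. -/
def Returns (step : V → α → V) (E : Set (V × α)) (z c : V) : Prop :=
  ∃ g : List α, pathEdges step c g ⊆ E ∧ g.foldl step c = z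

theorem Returns.of_path {E : Set (V × α)} {z c : V} {x : List α}
    (hx : pathEdges step c x ⊆ E) (h : Returns step E z (x.foldl step c)) :
    Returns step E z c := by
  obtain ⟨g, hg, hz⟩ := h
  exact ⟨x ++ g, by rw [pathEdges_append]; exact Set.union_subset hx hg, by simpa using hz⟩

theorem Returns.of_edge {E : Set (V × α)} {z : V} {e : V × α} (he : e ∈ E)
    (h : Returns step E z (step e.1 e.2)) : Returns step E z e.1 :=
  Returns.of_path (x := [e.2]) (by simpa [pathEdges] using he) h

theorem Returns.of_mem_pathEdges {E : Set (V × α)} {z c : V} {x : List α} {e : V × α}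
    (hx : pathEdges step c x ⊆ E) (he : e ∈ pathEdges step c x) (h : Returns step E z e.1) :
    Returns step E z c := by
  obtain ⟨x₁, x₂, rfl, hc⟩ := exists_eq_append_of_mem_pathEdges he
  rw [pathEdges_append] at hx
  exact Returns.of_path (Set.subset_union_left.trans hx) (hc ▸ h)

theorem Returns.step_of_mem_pathEdges {E : Set (V × α)} {z c : V} {x : List α} {e : V × α}
    (hx : pathEdges step c x ⊆ E) (he : e ∈ pathEdges step c x)
    (h : Returns step E z (x.foldl step c)) : Returns step E z (step e.1 e.2) := by
  obtain ⟨x₁, x₂, rfl, hc⟩ := exists_eq_append_of_mem_pathEdges he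
  rw [pathEdges_append, hc] at hx
  refine Returns.of_path (x := x₂) (fun e' he' => hx (Or.inr (Or.inr he'))) ?_
  simpa [hc] using h

theorem exists_exit (P : V → Prop) {z : V} {x : List α} (hz : P z) (hx : ¬ P (x.foldl step z)) :
    ∃ x₁ a x₂, x = x₁ ++ a :: x₂ ∧ P (x₁.foldl step z) ∧ ¬ P (step (x₁.foldl step z) a) := by
  induction x generalizing z with
  | nil => exact absurd hz hx
  | cons a x ih =>
    by_cases h : P (step z a)
    · obtain ⟨x₁, b, x₂, rfl, h₁, h₂⟩ := ih h hx
      exact ⟨a :: x₁, b, x₂, rfl, h₁, h₂⟩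
    · exact ⟨[], a, x, rfl, hz, h⟩

/-- A path that cannot return to its start within its own edges splits at the one edge by which it
leaves the strong component of its start. -/
theorem exists_split {z : V} {x : List α} {E : Set (V × α)} (hE : pathEdges step z x = E)
    (hx : ¬ Returns step E z (x.foldl step z)) :
    ∃ x₁ a x₂, x = x₁ ++ a :: x₂ ∧
      pathEdges step z x₁ = {e ∈ E | Returns step E z (step e.1 e.2)} ∧
      pathEdges step (step (x₁.foldl step z) a) x₂ = {e ∈ E | ¬ Returns step E z e.1} ∧
      (∀ e ∈ E, Returns step E z e.1 → ¬ Returns step E z (step e.1 e.2) →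
        e = (x₁.foldl step z, a)) ∧
      Returns step E z (x₁.foldl step z) ∧
      ¬ Returns step E z (step (x₁.foldl step z) a) := by
  obtain ⟨x₁, a, x₂, rfl, h₁, h₂⟩ :=
    exists_exit (Returns step E z) ⟨[], by simp [pathEdges], rfl⟩ hx
  have hE' := hE
  rw [pathEdges_append, pathEdges] at hE'
  have hx₁ : pathEdges step z x₁ ⊆ E := hE' ▸ Set.subset_union_left
  have hx₂ : pathEdges step (step (x₁.foldl step z) a) x₂ ⊆ E := by
    rw [← hE']
    exact fun e he => Or.inr (Or.inr he)
  have hst : ∀ e ∈ pathEdges step z x₁, Returns step E z (step e.1 e.2) :=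
    fun e he => Returns.step_of_mem_pathEdges hx₁ he h₁
  -- A vertex on the second piece that could return would let the target of the exit edge return as
  -- well, along the part of that piece in between. So the component, once left, is never entered
  -- again.
  have hnr : ∀ e ∈ pathEdges step (step (x₁.foldl step z) a) x₂, ¬ Returns step E z e.1 :=
    fun e he hr => h₂ (Returns.of_mem_pathEdges hx₂ he hr)
  have hcases : ∀ e ∈ E, e ∈ pathEdges step z x₁ ∨ e = (x₁.foldl step z, a) ∨
      e ∈ pathEdges step (step (x₁.foldl step z) a) x₂ := by
    intro e he
    rw [← hE'] at he
    exact he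
  refine ⟨x₁, a, x₂, rfl, ?_, ?_, ?_, h₁, h₂⟩
  · refine Set.Subset.antisymm (fun e he => ⟨hx₁ he, hst e he⟩) fun e he => ?_
    rcases hcases e he.1 with h | rfl | h
    · exact h
    · exact absurd he.2 h₂
    · exact absurd (Returns.of_edge he.1 he.2) (hnr e h)
  · refine Set.Subset.antisymm (fun e he => ⟨hx₂ he, hnr e he⟩) fun e he => ?_
    rcases hcases e he.1 with h | rfl | h
    · exact absurd (Returns.of_edge he.1 (hst e h)) he.2
    · exact absurd h₁ he.2
    · exact h
  · intro e he hr hns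
    rcases hcases e he with h | h | h
    · exact absurd (hst e h) hns
    · exact h
    · exact absurd hr (hnr e h)

namespace IsLocalAction

theorem le_pathAct (h : IsLocalAction step act R D) (z : V) (x : List α) (q : Q) :
    R q (pathAct step act z x q) := by
  induction x generalizing z q with
  | nil => exact h.refl q
  | cons a x ih => exact h.trans (h.le_act z a q) (ih _ _)

theorem pathAct_mem (h : IsLocalAction step act R D) {z : V} (x : List α) {q : Q} (hq : q ∈ D z) :
    pathAct step act z x q ∈ D (x.foldl step z) := by
  induction x generalizing z q with
  | nil => exact hq
  | cons a x ih => exact ih (h.mapsTo a hq)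

/-- From a state equivalent to the end of a path, no path along edges of that path descends. -/
theorem pathAct_le (h : IsLocalAction step act R D) {z : V} {x : List α} {p : Q} (hp : p ∈ D z)
    {c : V} (g : List α) {q : Q} (hq : q ∈ D c) (h₁ : R (pathAct step act z x p) q)
    (h₂ : R q (pathAct step act z x p)) (hg : pathEdges step c g ⊆ pathEdges step z x) :
    R (pathAct step act c g q) (pathAct step act z x p) := by
  induction g generalizing c q with
  | nil => exact h₂
  | cons a g ih =>
    obtain ⟨x₁, x₂, hx, hc⟩ := exists_eq_append_of_mem_pathEdges (hg (Or.inl rfl))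
    dsimp only at hx hc
    have hP : pathAct step act z x₁ p ∈ D c := hc ▸ h.pathAct_mem x₁ hp
    -- The path x uses this edge too, at the state P, and can still reach the end afterwards. Hence
    -- P and its successor both lie above q, and `act_iff` transfers this to the successor of q.
    have hPx : R (act c a (pathAct step act z x₁ p)) (pathAct step act z x p) := by
      rw [hx, pathAct_append, hc]
      exact h.le_pathAct _ _ _
    have hPq := h.trans hPx h₁
    have := (h.act_iff a hP hq (h.trans (h.le_act _ _ _) hPq)).1 hPq
    exact ih (h.mapsTo a hq) (h.trans h₁ (h.le_act _ _ _)) (h.trans this h₂)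
      fun e he => hg (Or.inr he)

/-- Letter by letter: as long as the lower state q does not fall out of its class, `act_iff` keeps
the upper state p above it. The successors then satisfy the same hypotheses. -/
theorem pathAct_le_of_le (h : IsLocalAction step act R D) {c : V} (y : List α) {p q : Q}
    (hp : p ∈ D c) (hq : q ∈ D c) (hpq : R p q) (hy : R (pathAct step act c y q) q) :
    R (pathAct step act c y p) q := by
  induction y generalizing c p q with
  | nil => exact hpq
  | cons a y ih =>
    have h₁ : R (act c a q) q := h.trans (h.le_pathAct _ _ _) hy
    have h₂ := (h.act_iff a hp hq hpq).2 h₁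
    exact h.trans (ih (h.mapsTo a hp) (h.mapsTo a hq) (h.trans h₂ (h.le_act _ _ _))
      (h.trans hy (h.le_act _ _ _))) h₁

/-- Continue from the end q of x along g to a state q₁ at z. It is equivalent to q because g uses
only edges of x, and y moves it only within its class. Since p ⪰ q₁, the path y takes p to a state
above q₁. -/
theorem pathAct_le_pathAct (h : IsLocalAction step act R D) {z : V} {x y g : List α} {p : Q}
    (hp : p ∈ D z) (hyx : pathEdges step z y ⊆ pathEdges step z x)
    (hg : pathEdges step (x.foldl step z) g ⊆ pathEdges step z x)
    (hgz : g.foldl step (x.foldl step z) = z) :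
    R (pathAct step act z y p) (pathAct step act z x p) := by
  set q := pathAct step act z x p with hq
  have hqD := h.pathAct_mem x hp
  rw [← hq] at hqD
  set q₁ := pathAct step act (x.foldl step z) g q with hq₁
  have hqq₁ : R q q₁ := h.le_pathAct _ _ _
  have hq₁q : R q₁ q := h.pathAct_le hp g hqD (h.refl _) (h.refl _) hg
  have hq₁D : q₁ ∈ D z := by simpa only [hgz] using h.pathAct_mem g hqD
  have h₁ : R (pathAct step act z y q₁) q := h.pathAct_le hp y hq₁D hqq₁ hq₁q hyx
  exact h.trans (h.pathAct_le_of_le y hp hq₁D (h.trans (h.le_pathAct _ _ _) hqq₁)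
    (h.trans h₁ hqq₁)) hq₁q

/-- The hypotheses are symmetric in x and y, so each final state is ⪰ the other, and antisymmetry at
the common end vertex applies. -/
theorem pathAct_eq_of_return (h : IsLocalAction step act R D) {z : V} {x y g : List α} {p : Q}
    (hp : p ∈ D z) (hend : x.foldl step z = y.foldl step z)
    (hxy : pathEdges step z x = pathEdges step z y)
    (hg : pathEdges step (x.foldl step z) g ⊆ pathEdges step z x)
    (hgz : g.foldl step (x.foldl step z) = z) :
    pathAct step act z x p = pathAct step act z y p := by
  refine h.antisymm (h.pathAct_mem x hp) (hend ▸ h.pathAct_mem y hp) ?_ ?_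
  · exact h.pathAct_le_pathAct hp hxy.le (hend ▸ hxy ▸ hg) (hend ▸ hgz)
  · exact h.pathAct_le_pathAct hp hxy.ge hg hgz

/-- Two paths with the same ends and the same set of edges act in the same way. -/
theorem pathAct_eq (h : IsLocalAction step act R D) {z : V} {x y : List α} {p : Q}
    (hp : p ∈ D z) (hend : x.foldl step z = y.foldl step z)
    (hxy : pathEdges step z x = pathEdges step z y) :
    pathAct step act z x p = pathAct step act z y p := by
  induction hn : x.length using Nat.strong_induction_on generalizing z x y p with
  | _ n ih =>
    by_cases hr : Returns step (pathEdges step z x) z (x.foldl step z)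
    · obtain ⟨g, hg, hgz⟩ := hr
      exact h.pathAct_eq_of_return hp hend hxy hg hgz
    · obtain ⟨x₁, a, x₂, hx, hx₁, hx₂, -, hrx, hnx⟩ := exists_split rfl hr
      obtain ⟨y₁, b, y₂, hy, hy₁, hy₂, huy, -, -⟩ := exists_split hxy.symm (hend ▸ hr)
      have hmem : (x₁.foldl step z, a) ∈ pathEdges step z x := by
        have := mem_pathEdges_append (step := step) z x₁ x₂ a
        rwa [← hx] at this
      -- The exit edge of x is an edge of y that leaves the component of the start, and y has only
      -- one such edge.
      obtain ⟨hc, rfl⟩ := Prod.mk.inj (huy _ hmem hrx hnx)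
      have hE₁ : pathEdges step z x₁ = pathEdges step z y₁ := hx₁.trans hy₁.symm
      have h₁ : pathAct step act z x₁ p = pathAct step act z y₁ p := by
        -- The return path g stays among the edges of x₁: from the target of each of its edges the
        -- rest of g leads back to z.
        obtain ⟨g, hg, hgz⟩ := hrx
        refine h.pathAct_eq_of_return hp hc hE₁ (g := g) (fun e he => ?_) hgz
        rw [hx₁]
        exact ⟨hg he, Returns.step_of_mem_pathEdges hg he ⟨[], by simp [pathEdges], hgz⟩⟩
      have h₂ := ih x₂.length (by rw [← hn, hx]; simp; omega)
        (h.mapsTo a (h.pathAct_mem x₁ hp)) (x := x₂) (y := y₂)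
        (by rw [hx, hy] at hend; simpa [hc] using hend)
        (by rw [hx₂, hc, hy₂]) rfl
      rw [hx, hy, pathAct_append, pathAct_append, pathAct, pathAct, h₂, hc, h₁]

end IsLocalAction
end LocalAction
end LocalTestability

namespace LocalTestability

universe u v

/-! ### Reachability and words -/

section Words

variable {α : Type u} {σ : Type v} {A : DFA α σ}

theorem reach_iff {p q : σ} : Reach A p q ↔ ∃ w : List α, A.evalFrom p w = q := by
  constructor
  · intro h
    induction h with
    | refl => exact ⟨[], rfl⟩
    | tail _ h ih =>
      obtain ⟨w, rfl⟩ := ih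
      obtain ⟨a, rfl⟩ := h
      exact ⟨w ++ [a], by simp⟩
  · rintro ⟨w, rfl⟩
    induction w generalizing p with
    | nil => exact Relation.ReflTransGen.refl
    | cons a w ih => exact Relation.ReflTransGen.head ⟨a, rfl⟩ ih

theorem reach_evalFrom (p : σ) (w : List α) : Reach A p (A.evalFrom p w) := reach_iff.2 ⟨w, rfl⟩

theorem reach_step (p : σ) (a : α) : Reach A p (A.step p a) := reach_evalFrom p [a]

theorem Reach.refl (p : σ) : Reach A p p := Relation.ReflTransGen.refl

theorem Reach.trans {p q r : σ} (h : Reach A p q) (h' : Reach A q r) : Reach A p r :=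
  Relation.ReflTransGen.trans h h'

theorem transGen_pairEdge_iff {x y : σ × σ} : Relation.TransGen (PairEdge A) x y ↔
    ∃ w : List α, w ≠ [] ∧ A.evalFrom x.1 w = y.1 ∧ A.evalFrom x.2 w = y.2 := by
  constructor
  · intro h
    induction h with
    | single h =>
      obtain ⟨a, h₁, h₂⟩ := h
      exact ⟨[a], by simp, h₁, h₂⟩
    | tail _ h ih =>
      obtain ⟨w, hw, h₁, h₂⟩ := ih
      obtain ⟨a, h₃, h₄⟩ := h
      exact ⟨w ++ [a], by simp, by simp [h₁, h₃], by simp [h₂, h₄]⟩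
  · rintro ⟨w, hw, h₁, h₂⟩
    induction w using List.reverseRecOn generalizing y with
    | nil => exact absurd rfl hw
    | append_singleton w a ih =>
      rw [DFA.evalFrom_append_singleton] at h₁ h₂
      by_cases hw' : w = []
      · subst hw'
        exact Relation.TransGen.single ⟨a, h₁, h₂⟩
      · exact Relation.TransGen.tail
          (ih (y := (A.evalFrom x.1 w, A.evalFrom x.2 w)) hw' rfl rfl) ⟨a, h₁, h₂⟩

theorem sccNode_iff {p q : σ} : SCCNode A (p, q) ↔
    ∃ w : List α, w ≠ [] ∧ A.evalFrom p w = p ∧ A.evalFrom q w = q :=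
  transGen_pairEdge_iff

/-! ### The test as two conditions on words -/

/-- For an SCC-node `(p, q)` with `p ⪰ q`, every word leads from both components into the part
above `q`, or from neither. -/
def ConditionTwo (A : DFA α σ) : Prop :=
  ∀ p q : σ, SCCNode A (p, q) → Reach A p q →
    ∀ w : List α, Reach A (A.evalFrom p w) q ↔ Reach A (A.evalFrom q w) q

theorem visited_iff {x : σ × σ} : Visited A x ↔
    ∃ y, SCCNode A y ∧ StrictReach A y.1 y.2 ∧ Relation.ReflTransGen (KeptEdge A) y x := by
  constructor
  · intro h
    have : ∀ z, Relation.ReflTransGen (SourcedEdge A) none z → ∀ x, z = some x →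
        ∃ y, SCCNode A y ∧ StrictReach A y.1 y.2 ∧ Relation.ReflTransGen (KeptEdge A) y x := by
      intro z hz
      induction hz with
      | refl => simp
      | @tail b c _ hbc ih =>
        rintro x rfl
        rcases b with _ | b
        · exact ⟨x, hbc.1, hbc.2, Relation.ReflTransGen.refl⟩
        · obtain ⟨y, h₁, h₂, h₃⟩ := ih b rfl
          exact ⟨y, h₁, h₂, h₃.tail hbc⟩
    exact this _ h x rfl
  · rintro ⟨y, h₁, h₂, h₃⟩
    refine Relation.ReflTransGen.head (b := some y) ⟨h₁, h₂⟩ ?_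
    induction h₃ with
    | refl => exact Relation.ReflTransGen.refl
    | tail _ h ih => exact ih.tail h

/-- When x.1 ⪰ x.2, reaching x.1 implies reaching x.2, so the deletion rule only asks whether the
second component stays in its class. -/
theorem KeptEdge.reach_snd {x y : σ × σ} (h : KeptEdge A x y) (hx : Reach A x.1 x.2) :
    Reach A y.2 x.2 := by
  have h' := h.2
  by_contra hn
  exact h' ⟨hn, fun h'' => hn (h''.trans hx)⟩

/-- Induction on w. While qw ⪰ q, the pair (pw, qw) has been reached along kept edges and is
unmarked, which settles the next letter. Once qw has left the class of q, so has pw the part above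
q, and neither comes back. -/
theorem reach_evalFrom_iff_of_unmarked {y : σ × σ} (hy : Reach A y.1 y.2)
    (hu : ∀ z, Relation.ReflTransGen (KeptEdge A) y z → ¬ Marked A z) (w : List α) :
    (Reach A (A.evalFrom y.1 w) y.2 ↔ Reach A (A.evalFrom y.2 w) y.2) ∧
    (Reach A (A.evalFrom y.2 w) y.2 →
      Relation.ReflTransGen (KeptEdge A) y (A.evalFrom y.1 w, A.evalFrom y.2 w)) := by
  induction w using List.reverseRecOn with
  | nil => exact ⟨by simp [hy, Reach.refl], fun _ => Relation.ReflTransGen.refl⟩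
  | append_singleton w a ih =>
    simp only [DFA.evalFrom_append_singleton]
    by_cases hq : Reach A (A.evalFrom y.2 w) y.2
    · have hv := ih.2 hq
      have hm := hu _ hv
      have key : Reach A (A.step (A.evalFrom y.1 w) a) (A.evalFrom y.2 w) ↔
          Reach A (A.step (A.evalFrom y.2 w) a) (A.evalFrom y.2 w) := by
        by_contra hx
        exact hm ⟨a, by simpa [Xor, xor_iff_not_iff] using (xor_iff_not_iff _ _).2 hx⟩
      -- The state qw is equivalent to q, so the mark at (pw, qw), which refers to qw, speaks about
      -- q.
      have conv : ∀ r, Reach A r (A.evalFrom y.2 w) ↔ Reach A r y.2 :=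
        fun r => ⟨fun h => h.trans hq, fun h => h.trans (reach_evalFrom _ _)⟩
      rw [conv, conv] at key
      refine ⟨key, fun h => hv.tail ⟨⟨a, rfl, rfl⟩, fun hn => hn.1 ((conv _).2 h)⟩⟩
    · have h₂ : ¬ Reach A (A.step (A.evalFrom y.2 w) a) y.2 :=
        fun h => hq ((reach_step _ _).trans h)
      have h₁ : ¬ Reach A (A.step (A.evalFrom y.1 w) a) y.2 :=
        fun h => hq (ih.1.1 ((reach_step _ _).trans h))
      exact ⟨⟨fun h => absurd h h₁, fun h => absurd h h₂⟩, fun h => absurd h h₂⟩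

/-- Sources require p ≻ q whereas `ConditionTwo` allows p ∼ q. In the latter case condition (1)
gives p = q, and nothing is left to show. -/
theorem testAccepts_iff : TestAccepts A ↔ ConditionOne A ∧ ConditionTwo A := by
  refine and_congr_right fun h₁ => ⟨fun h p q hs hpq w => ?_, fun h x hx => ?_⟩
  · by_cases hqp : Reach A q p
    · rw [h₁ p q hs ⟨hpq, hqp⟩]
    · exact (reach_evalFrom_iff_of_unmarked (y := (p, q)) hpq
        (fun z hz => h z (visited_iff.2 ⟨(p, q), hs, ⟨hpq, hqp⟩, hz⟩)) w).1
  · obtain ⟨y, hs, hy, hyx⟩ := visited_iff.1 hx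
    -- Both components of every visited pair remain above y.2: the second because the edges are
    -- kept, the first by `ConditionTwo`. A mark would then contradict `ConditionTwo` for the word
    -- extended by one letter.
    have key : ∀ z, Relation.ReflTransGen (KeptEdge A) y z →
        ∃ w, z = (A.evalFrom y.1 w, A.evalFrom y.2 w) ∧ Reach A z.1 y.2 ∧ Reach A z.2 y.2 := by
      intro z hz
      induction hz with
      | refl => exact ⟨[], rfl, hy.1, Reach.refl _⟩
      | @tail b c hb hc ih =>
        obtain ⟨w, hbw, hb₁, hb₂⟩ := ih
        obtain ⟨a, ha₁, ha₂⟩ := hc.1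
        have hcw : c = (A.evalFrom y.1 (w ++ [a]), A.evalFrom y.2 (w ++ [a])) := by
          rw [DFA.evalFrom_append_singleton, DFA.evalFrom_append_singleton]
          rw [hbw] at ha₁ ha₂
          exact Prod.ext ha₁.symm ha₂.symm
        have hbb : Reach A b.1 b.2 := hb₁.trans (by rw [hbw]; exact reach_evalFrom _ _)
        have hc₂ : Reach A c.2 y.2 := (hc.reach_snd hbb).trans hb₂
        refine ⟨_, hcw, ?_, hc₂⟩
        have := (h y.1 y.2 hs hy.1 (w ++ [a])).2
        rw [hcw] at hc₂ ⊢
        exact this hc₂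
    obtain ⟨w, hxw, hx₁, hx₂⟩ := key x hyx
    rintro ⟨a, ha⟩
    have conv : ∀ r, Reach A r x.2 ↔ Reach A r y.2 :=
      fun r => ⟨fun h => h.trans hx₂, fun h => h.trans (by rw [hxw]; exact reach_evalFrom _ _)⟩
    have h₃ := h y.1 y.2 hs hy.1 (w ++ [a])
    rw [DFA.evalFrom_append_singleton, DFA.evalFrom_append_singleton] at h₃
    rw [conv, conv, hxw] at ha
    rcases ha with ha | ha
    · exact ha.2 (h₃.1 ha.1)
    · exact ha.2 (h₃.2 ha.1)

end Words

/-! ### Test data -/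

section TestData

variable {α : Type u} {σ : Type v}

/-- A factor that meets both a and b contains all of t and at least two further letters. -/
theorem infix_append_of_overlap {x a t b : List α} (hx : x.length ≤ t.length + 1) :
    x <:+: a ++ t ++ b ↔ x <:+: a ++ t ∨ x <:+: t ++ b := by
  constructor
  · rintro ⟨s, r, h⟩
    by_cases hl : (s ++ x).length ≤ (a ++ t).length
    · left
      have : s ++ x <+: a ++ t :=
        List.prefix_of_prefix_length_le (l₃ := a ++ t ++ b) ⟨r, h⟩ ⟨b, rfl⟩ hl
      obtain ⟨r', hr⟩ := this
      exact ⟨s, r', hr⟩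
    · right
      have hs : a.length ≤ s.length := by
        simp only [List.length_append] at hl
        omega
      have : x ++ r <:+ t ++ b := by
        refine List.suffix_of_suffix_length_le (l₃ := a ++ t ++ b) ⟨s, by simpa using h⟩
          ⟨a, by simp⟩ ?_
        have := congrArg List.length h
        simp only [List.length_append] at this ⊢
        omega
      obtain ⟨s', hs⟩ := this
      exact ⟨s', r, by simpa using hs⟩
  · rintro (⟨s, r, h⟩ | ⟨s, r, h⟩)
    · exact ⟨s, r ++ b, by rw [← h]; simp⟩
    · exact ⟨a ++ s, r, by simp [← h]⟩

theorem rtake_append_of_le {a t : List α} {m : ℕ} (h : m ≤ t.length) :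
    (a ++ t).rtake m = t.rtake m := by
  rw [List.rtake_eq_reverse_take_reverse, List.rtake_eq_reverse_take_reverse, List.reverse_append,
    List.take_append_of_le_length (by simpa using h)]

/-- Words that begin and end with the long word `t` and pass through the same blocks between
occurrences of `t` have the same test data. -/
theorem sameTestData_of_blocks {k : ℕ} {t u v : List α} (ht : k ≤ t.length)
    (h : ∀ x : List α, x.length ≤ t.length → (x <:+: t ++ u ++ t ↔ x <:+: t ++ v ++ t)) :
    SameTestData k (t ++ u ++ t) (t ++ v ++ t) := by
  have hk : k - 1 ≤ t.length := by omega
  refine ⟨?_, ?_, fun x hx => h x (by omega)⟩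
  · rw [List.append_assoc, List.append_assoc, List.take_append_of_le_length hk,
      List.take_append_of_le_length hk]
  · rw [rtake_append_of_le hk, rtake_append_of_le hk]

theorem infix_blocks_two {x t a b : List α} (hx : x.length ≤ t.length) :
    x <:+: t ++ (a ++ t ++ b) ++ t ↔ x <:+: t ++ a ++ t ∨ x <:+: t ++ b ++ t := by
  have := infix_append_of_overlap (x := x) (a := t ++ a) (t := t) (b := b ++ t) (by omega)
  simpa [List.append_assoc] using this

theorem infix_blocks_three {x t a b c : List α} (hx : x.length ≤ t.length) :
    x <:+: t ++ (a ++ t ++ b ++ t ++ c) ++ t ↔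
      x <:+: t ++ a ++ t ∨ x <:+: t ++ b ++ t ∨ x <:+: t ++ c ++ t := by
  have := infix_append_of_overlap (x := x) (a := t ++ a) (t := t) (b := b ++ t ++ c ++ t) (by omega)
  have h₂ := infix_blocks_two (x := x) (t := t) (a := b) (b := c) hx
  simp only [List.append_assoc] at this h₂ ⊢
  rw [this, h₂]

/-! ### Pumping, and the necessity of the two conditions -/

theorem evalFrom_replicate {A : DFA α σ} {p : σ} {u : List α} (h : A.evalFrom p u = p) (m : ℕ) :
    A.evalFrom p (List.replicate m u).flatten = p := by
  induction m with
  | zero => rfl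
  | succ m ih => rw [List.replicate_succ, List.flatten_cons, DFA.evalFrom_of_append, h, ih]

theorem exists_long_loop {A : DFA α σ} {p q : σ} (h : SCCNode A (p, q)) (k : ℕ) :
    ∃ t : List α, k ≤ t.length ∧ A.evalFrom p t = p ∧ A.evalFrom q t = q := by
  obtain ⟨u, hu, hp, hq⟩ := sccNode_iff.1 h
  refine ⟨(List.replicate k u).flatten, ?_, evalFrom_replicate hp k, evalFrom_replicate hq k⟩
  have : 0 < u.length := List.length_pos_of_ne_nil hu
  simpa using Nat.le_mul_of_pos_right k this

/-- With pa = q and qb = p, the block sequences a, b and a, b, a between copies of t have the same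
set of blocks, but they lead from p to p and to q, respectively. -/
theorem LocallyTestableTransitions.conditionOne {A : DFA α σ}
    (h : LocallyTestableTransitions A) : ConditionOne A := by
  obtain ⟨k, hk, h⟩ := h
  intro p q hs ⟨hpq, hqp⟩
  obtain ⟨t, ht, htp, htq⟩ := exists_long_loop hs k
  obtain ⟨a, ha⟩ := reach_iff.1 hpq
  obtain ⟨b, hb⟩ := reach_iff.1 hqp
  have ht0 : t ≠ [] := by
    rintro rfl
    simp at ht
    omega
  have := h (t ++ (a ++ t ++ b) ++ t) (t ++ (a ++ t ++ b ++ t ++ a) ++ t) (by simp [ht0])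
    (by simp [ht0]) (sameTestData_of_blocks ht fun x hx => by
      rw [infix_blocks_two hx, infix_blocks_three hx]; tauto) p
  simpa [DFA.evalFrom_of_append, htp, htq, ha, hb] using this

/-- If pwc = q, compare the block wc with wc repeated: the second use starts at q and has to end at
q. If qwc = q and pb = q, compare b, wc with wc, b, wc: the latter reads w first from p and still
ends at q. -/
theorem LocallyTestableTransitions.conditionTwo {A : DFA α σ}
    (h : LocallyTestableTransitions A) : ConditionTwo A := by
  obtain ⟨k, hk, h⟩ := h
  intro p q hs hpq w
  obtain ⟨t, ht, htp, htq⟩ := exists_long_loop hs k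
  obtain ⟨b, hb⟩ := reach_iff.1 hpq
  have ht0 : t ≠ [] := by
    rintro rfl
    simp at ht
    omega
  constructor
  · intro hw
    obtain ⟨c, hc⟩ := reach_iff.1 hw
    have := h (t ++ (w ++ c) ++ t) (t ++ ((w ++ c) ++ t ++ (w ++ c)) ++ t) (by simp [ht0])
      (by simp [ht0]) (sameTestData_of_blocks ht fun x hx => by
        rw [infix_blocks_two hx]; tauto) p
    simp only [DFA.evalFrom_of_append, htp, hc, htq] at this
    exact reach_iff.2 ⟨c ++ t, by rw [DFA.evalFrom_of_append, ← this]⟩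
  · intro hw
    obtain ⟨c, hc⟩ := reach_iff.1 hw
    have := h (t ++ (b ++ t ++ (w ++ c)) ++ t) (t ++ ((w ++ c) ++ t ++ b ++ t ++ (w ++ c)) ++ t)
      (by simp [ht0]) (by simp [ht0]) (sameTestData_of_blocks ht fun x hx => by
        rw [infix_blocks_two hx, infix_blocks_three hx]; tauto) p
    simp only [DFA.evalFrom_of_append, htp, hb, htq, hc] at this
    exact reach_iff.2 ⟨c ++ t ++ b ++ t ++ (w ++ c) ++ t, by
      simp only [DFA.evalFrom_of_append]; exact this.symm⟩

/-! ### The test data as a congruence -/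

/-- The prefix of length k - 1 is then all of u, while a word v of length at least k would have a
factor of length k, which u has not. -/
theorem SameTestData.eq_of_length_lt {k : ℕ} {u v : List α} (h : SameTestData k u v) (hk : 0 < k)
    (hu : u.length < k) : u = v := by
  obtain ⟨h₁, -, h₃⟩ := h
  rw [List.take_of_length_le (by omega)] at h₁
  by_cases hv : v.length < k
  · rw [h₁, List.take_of_length_le (by omega)]
  · have hl : (v.take k).length = k := by simp; omega
    have := ((h₃ _ hl).2 (List.take_prefix k v).isInfix).length_le
    omega

theorem SameTestData.symm {k : ℕ} {u v : List α} (h : SameTestData k u v) : SameTestData k v u :=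
  ⟨h.1.symm, h.2.1.symm, fun x hx => (h.2.2 x hx).symm⟩

theorem SameTestData.reverse {k : ℕ} {u v : List α} (h : SameTestData k u v) :
    SameTestData k u.reverse v.reverse := by
  obtain ⟨h₁, h₂, h₃⟩ := h
  rw [List.rtake_eq_reverse_take_reverse, List.rtake_eq_reverse_take_reverse,
    List.reverse_inj] at h₂
  refine ⟨h₂, ?_, fun x hx => ?_⟩
  · rw [List.rtake_eq_reverse_take_reverse, List.rtake_eq_reverse_take_reverse, List.reverse_reverse,
      List.reverse_reverse, h₁]
  · have := h₃ x.reverse (by simpa using hx)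
    rwa [← List.reverse_infix, List.reverse_reverse, ← List.reverse_infix (l₂ := v),
      List.reverse_reverse] at this

theorem infix_append_left_iff {k : ℕ} {x y u : List α} (hx : x.length = k) (hu : k ≤ u.length) :
    x <:+: y ++ u ↔ x <:+: y ++ u.take (k - 1) ∨ x <:+: u := by
  have hl : (u.take (k - 1)).length = k - 1 := by simp; omega
  have := infix_append_of_overlap (x := x) (a := y) (t := u.take (k - 1)) (b := u.drop (k - 1))
    (by omega)
  rwa [List.append_assoc, List.take_append_drop] at this

/-- Once u has length at least k, the factors of y ++ u of length k are those of u and those of y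
followed by the first k - 1 letters of u. Both are determined by the data of u. Shorter words with
the same data are equal. -/
theorem SameTestData.append_left {k : ℕ} {u v : List α} (h : SameTestData k u v) (hk : 0 < k)
    (y : List α) : SameTestData k (y ++ u) (y ++ v) := by
  by_cases hu : u.length < k
  · rw [h.eq_of_length_lt hk hu]
    exact ⟨rfl, rfl, fun _ _ => Iff.rfl⟩
  by_cases hv : v.length < k
  · rw [h.symm.eq_of_length_lt hk hv]
    exact ⟨rfl, rfl, fun _ _ => Iff.rfl⟩
  obtain ⟨h₁, h₂, h₃⟩ := h
  refine ⟨?_, ?_, fun x hx => ?_⟩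
  · have : ∀ w : List α, (y ++ w).take (k - 1) = (y ++ w.take (k - 1)).take (k - 1) := by
      intro w
      simp [List.take_append, List.take_take]
    rw [this u, h₁, ← this v]
  · rw [rtake_append_of_le (by omega), rtake_append_of_le (by omega), h₂]
  · rw [infix_append_left_iff (u := u) hx (by omega), infix_append_left_iff (u := v) hx (by omega),
      h₁, h₃ x hx]

theorem SameTestData.append_right {k : ℕ} {u v : List α} (h : SameTestData k u v) (hk : 0 < k)
    (y : List α) : SameTestData k (u ++ y) (v ++ y) := by
  have := (h.reverse.append_left hk y.reverse).reverse
  simpa using this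

/-- Put u and v into a context: a word leading to p on the left, a separating word on the right. The
congruence property keeps the data equal, so no word separates the images of p. -/
theorem locallyTestableLanguage_accepts_iff {A : DFA α σ} (hA : IsReducedDFA A) :
    LocallyTestableLanguage A.accepts ↔ LocallyTestableTransitions A := by
  constructor
  · rintro ⟨k, hk, h⟩
    refine ⟨k, hk, fun u v hu hv huv p => hA.2 _ _ fun w => ?_⟩
    obtain ⟨y, rfl⟩ := hA.1 p
    have := h (y ++ u ++ w) (y ++ v ++ w) (by simp [hu]) (by simp [hv])
      ((huv.append_left hk y).append_right hk w)
    simpa [DFA.mem_accepts, DFA.eval, DFA.evalFrom_of_append] using this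
  · rintro ⟨k, hk, h⟩
    refine ⟨k, hk, fun u v hu hv huv => ?_⟩
    rw [DFA.mem_accepts, DFA.mem_accepts]
    exact iff_of_eq (congrArg (· ∈ A.accept) (h u v hu hv huv A.start))

end TestData

end LocalTestability

namespace LocalTestability

universe u v

/-! ### Windows

Words are read backwards here: the head of a list is the letter that was read last. -/

section Windows

variable {α : Type u} {σ : Type v} (A : DFA α σ)

/-- The state reached from `p` after the word whose reverse is `r`. -/
def evalRev (p : σ) (r : List α) : σ := A.evalFrom p r.reverse

/-- Every state reached by the word is fixed by a common nonempty word. -/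
def IsStabilized (r : List α) : Prop :=
  ∃ e : List α, e ≠ [] ∧ ∀ p, A.evalFrom (evalRev A p r) e = evalRev A p r

variable {A}

theorem evalRev_append (p : σ) (r s : List α) :
    evalRev A p (r ++ s) = evalRev A (evalRev A p s) r := by
  simp [evalRev, DFA.evalFrom_of_append]

theorem evalRev_cons (p : σ) (a : α) (r : List α) :
    evalRev A p (a :: r) = A.step (evalRev A p r) a := by
  simp [evalRev]

theorem IsStabilized.append {r : List α} (h : IsStabilized A r) (s : List α) :
    IsStabilized A (r ++ s) := by
  obtain ⟨e, he, h⟩ := h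
  exact ⟨e, he, fun p => by rw [evalRev_append]; exact h _⟩

/-- Pigeonhole: a word has one more prefix than letters, so two of its prefixes induce the same map.
The letters between them fix every state in the image of the shorter one. -/
theorem exists_isStabilized_drop [Finite σ] {r : List α} (hr : Nat.card (σ → σ) ≤ r.length) :
    ∃ i ≤ r.length, IsStabilized A (r.drop i) := by
  have hn : ¬ Function.Injective
      (fun (i : Fin (r.length + 1)) (p : σ) => evalRev A p (r.drop i)) := by
    intro hi
    have := Nat.card_le_card_of_injective _ hi
    rw [Nat.card_eq_fintype_card, Fintype.card_fin] at this
    omega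
  have key : ∀ i j : ℕ, i < j → j ≤ r.length →
      (∀ p, evalRev A p (r.drop i) = evalRev A p (r.drop j)) → IsStabilized A (r.drop j) := by
    intro i j hij hj h
    have hd : r.drop i = (r.drop i).take (j - i) ++ r.drop j := by
      conv_lhs => rw [← List.take_append_drop (j - i) (r.drop i)]
      rw [List.drop_drop]
      congr 2
      omega
    -- The letters read between the two positions; they are reversed because lists run backwards
    -- here.
    refine ⟨((r.drop i).take (j - i)).reverse, ?_, fun p => ?_⟩
    · intro h
      have := congrArg List.length h
      simp at this
      omega
    · have h₁ := h p
      rw [hd, evalRev_append] at h₁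
      exact h₁
  simp only [Function.Injective, not_forall] at hn
  obtain ⟨i, j, hij, hne⟩ := hn
  rcases lt_or_gt_of_ne (fun h => hne (Fin.ext h) : (i : ℕ) ≠ j) with h | h
  · exact ⟨j, by omega, key i j h (by omega) fun p => congrFun hij p⟩
  · exact ⟨i, by omega, key j i h (by omega) fun p => (congrFun hij p).symm⟩

variable (A)

open Classical in
/-- The letters read since the last position at which the last `N` letters were stabilized. -/
noncomputable def pending (N : ℕ) : List α → List α
  | [] => []
  | a :: r => if IsStabilized A ((a :: r).take N) then [] else a :: pending N r

/-- The word up to the last position at which the last `N` letters were stabilized. -/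
noncomputable def settled (N : ℕ) (r : List α) : List α := r.drop (pending A N r).length

variable {A} {N : ℕ}

theorem pending_append_settled (r : List α) : pending A N r ++ settled A N r = r := by
  induction r with
  | nil => simp [pending, settled]
  | cons a r ih =>
    rw [settled, pending]
    split_ifs with h
    · simp
    · simpa [settled] using ih

/-- A stabilized position i letters back stops the recursion for `pending` there or later, and
wherever it stops a stabilized window is found. -/
theorem isStabilized_settled {r : List α} {i : ℕ} (h : IsStabilized A ((r.drop i).take N)) :
    (pending A N r).length ≤ i ∧ IsStabilized A ((settled A N r).take N) := by
  induction r generalizing i with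
  | nil => simpa [pending, settled] using h
  | cons a r ih =>
    rw [settled, pending]
    split_ifs with ha
    · exact ⟨by simp, by simpa using ha⟩
    · cases i with
      | zero => exact absurd h ha
      | succ i =>
        obtain ⟨h₁, h₂⟩ := ih (i := i) (by simpa using h)
        exact ⟨by simpa using h₁, by simpa [settled] using h₂⟩

/-- The pigeonhole principle finds a stabilized position among the last N letters using only those
letters. Further older letters shrink the image, hence keep it fixed, and complete the window at
that position to N letters. -/
theorem take_take_drop_isStabilized [Finite σ] (hN : Nat.card (σ → σ) ≤ N) {r : List α}
    (hr : N ≤ r.length) :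
    (pending A N r).length ≤ N ∧ IsStabilized A ((settled A N r).take N) := by
  obtain ⟨i, hi, h⟩ := exists_isStabilized_drop (A := A) (r := r.take N) (by simpa [hr] using hN)
  have hi' : i ≤ N := hi.trans (by simp)
  have h₁ : IsStabilized A ((r.drop i).take N) := by
    have := h.append (((r.drop i).drop (N - i)).take i)
    rw [List.drop_take, ← List.take_add] at this
    rwa [Nat.sub_add_cancel hi'] at this
  exact ⟨(isStabilized_settled h₁).1.trans hi', (isStabilized_settled h₁).2⟩

/-- Each position is judged by the N letters before it, so the recursion looks no further back than
N letters beyond the pending ones. As at most N letters are pending, windows of length N + N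
suffice. -/
theorem pending_take {m : ℕ} {r : List α} (h : (pending A N r).length + N ≤ m) :
    pending A N (r.take m) = pending A N r := by
  induction r generalizing m with
  | nil => simp
  | cons a r ih =>
    cases m with
    | zero =>
      have : pending A N (a :: r) = [] := List.eq_nil_of_length_eq_zero (by omega)
      rw [this, List.take_zero]
      rfl
    | succ m =>
      rw [List.take_succ_cons, pending, pending, ← List.take_succ_cons, List.take_take,
        min_eq_left (by omega)]
      rw [pending] at h
      split_ifs at h ⊢ with ha
      · rfl
      · rw [ih (by simpa using (by simp at h; omega : (pending A N r).length + N ≤ m))]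

theorem settled_take {m : ℕ} {r : List α} (h : (pending A N r).length + N ≤ m) :
    settled A N r = settled A N (r.take m) ++ r.drop m := by
  have h₁ := pending_append_settled (A := A) (N := N) (r.take m)
  have h₂ := pending_append_settled (A := A) (N := N) r
  rw [pending_take h] at h₁
  have : pending A N r ++ settled A N r =
      pending A N r ++ (settled A N (r.take m) ++ r.drop m) := by
    rw [h₂, ← List.append_assoc, h₁, List.take_append_drop]
  exact List.append_cancel_left this

/-! ### The delayed action on windows -/

variable (A N)

open Classical in
/-- The action of a letter, delayed until the last `N` letters are stabilized. -/
noncomputable def windowAct (r : List α) (a : α) (q : σ) : σ :=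
  if IsStabilized A ((a :: r).take N) then A.step (evalRev A q (pending A N r)) a else q

/-- The window of the last `m` letters moves on. -/
def windowStep (m : ℕ) (r : List α) (a : α) : List α := (a :: r).take m

/-- The delayed states at the window `r` of length `m`. -/
def windowStates (m : ℕ) (r : List α) : Set σ :=
  {q | r.length = m ∧ ∃ p, q = evalRev A p (settled A N r)}

variable {A N}

/-- An unstabilized position adds a letter to the pending ones and leaves the settled part alone; a
stabilized one releases all pending letters. So `windowAct` updates the delayed state correctly. -/
theorem windowAct_settled (r : List α) (a : α) (p : σ) :
    windowAct A N r a (evalRev A p (settled A N r)) = evalRev A p (settled A N (a :: r)) := by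
  rw [windowAct]
  split_ifs with h
  · rw [← evalRev_append, pending_append_settled, ← evalRev_cons, settled, pending, if_pos h]
    rfl
  · rw [settled, settled, pending, if_neg h]
    simp

theorem reach_windowAct (r : List α) (a : α) (q : σ) : Reach A q (windowAct A N r a q) := by
  rw [windowAct]
  split_ifs
  · rw [← evalRev_cons]
    exact reach_evalFrom _ _
  · exact Reach.refl q

/-- All delayed states at one window are images under the same settled word, hence fixed by a common
nonempty word. Any two of them form an SCC-node, to which both conditions apply. -/
theorem isLocalAction_window [Finite σ] (hN : Nat.card (σ → σ) ≤ N) (h₁ : ConditionOne A)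
    (h₂ : ConditionTwo A) :
    IsLocalAction (windowStep (N + N)) (windowAct A N) (Reach A) (windowStates A N (N + N)) := by
  have hscc : ∀ {r p q}, p ∈ windowStates A N (N + N) r → q ∈ windowStates A N (N + N) r →
      SCCNode A (p, q) := by
    rintro r p q ⟨hr, p, rfl⟩ ⟨-, q, rfl⟩
    have hs := (take_take_drop_isStabilized (A := A) hN (r := r) (by omega)).2.append
      ((settled A N r).drop N)
    rw [List.take_append_drop] at hs
    obtain ⟨e, he, hs⟩ := hs
    exact sccNode_iff.2 ⟨e, he, hs p, hs q⟩
  refine ⟨Reach.refl, Reach.trans, reach_windowAct, ?_, fun hp hq h h' =>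
    h₁ _ _ (hscc hp hq) ⟨h, h'⟩, ?_⟩
  · rintro r q a ⟨hr, p, rfl⟩
    -- The oldest letter drops out of the window; its effect is absorbed into the starting state.
    refine ⟨by simp [windowStep, hr], evalRev A p ((a :: r).drop (N + N)), ?_⟩
    rw [windowAct_settled, windowStep, ← evalRev_append, ← settled_take]
    have := (take_take_drop_isStabilized (A := A) hN (r := a :: r) (by simp; omega)).1
    omega
  · intro r p q a hp hq hpq
    rw [windowAct, windowAct]
    split_ifs
    · rw [← evalRev_cons, ← evalRev_cons]
      exact h₂ p q (hscc hp hq) hpq _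
    · exact ⟨fun _ => Reach.refl q, fun _ => hpq⟩

/-- The window determines the pending letters and the stabilized positions, so a walk through
windows follows the delayed state of the whole word, including what preceded the window. -/
theorem pathAct_window [Finite σ] (hN : Nat.card (σ → σ) ≤ N) {r : List α} (hr : N ≤ r.length)
    (x : List α) (p : σ) :
    pathAct (windowStep (N + N)) (windowAct A N) (r.take (N + N)) x (evalRev A p (settled A N r)) =
      evalRev A p (settled A N (x.reverse ++ r)) := by
  induction x generalizing r with
  | nil => rfl
  | cons a x ih =>
    have hp := (take_take_drop_isStabilized (A := A) hN hr).1
    have hs : windowStep (N + N) (r.take (N + N)) a = (a :: r).take (N + N) := by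
      cases h : N + N with
      | zero => simp [windowStep]
      | succ m => simp [windowStep, List.take_take]
    have ha : ∀ q, windowAct A N (r.take (N + N)) a q = windowAct A N r a q := by
      intro q
      have : (a :: r.take (N + N)).take N = (a :: r).take N := by
        cases N with
        | zero => rfl
        | succ N =>
          rw [List.take_succ_cons, List.take_succ_cons, List.take_take, min_eq_left (by omega)]
      rw [windowAct, windowAct, this, pending_take (by omega)]
    rw [pathAct, ha, windowAct_settled, hs, ih (by simp; omega)]
    simp

theorem foldl_windowStep {m : ℕ} {r : List α} (hr : r.length = m) (x : List α) :
    x.foldl (windowStep m) r = (x.reverse ++ r).take m := by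
  induction x using List.reverseRecOn with
  | nil => simp [hr]
  | append_singleton x a ih =>
    rw [List.foldl_append, ih]
    cases m with
    | zero => simp [windowStep]
    | succ m => simp [windowStep, List.take_take]

/-- A window followed by the next letter is a factor of length m + 1, so equal sets of factors mean
equal sets of edges. -/
theorem mem_pathEdges_window {m : ℕ} {z : List α} (hz : z.length = m) (x : List α)
    (e : List α × α) : e ∈ pathEdges (windowStep m) z.reverse x ↔
      e.1.length = m ∧ (e.1.reverse ++ [e.2]) <:+: z ++ x := by
  have hz' : z.reverse.length = m := by simpa using hz
  constructor
  · intro h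
    obtain ⟨x₁, x₂, rfl, hc⟩ := exists_eq_append_of_mem_pathEdges h
    rw [foldl_windowStep hz'] at hc
    have hl : e.1.length = m := by rw [← hc]; simp; omega
    refine ⟨hl, ?_⟩
    have hsuf : e.1.reverse <:+ z ++ x₁ := by
      rw [← hc, ← List.reverse_prefix]
      simpa using List.take_prefix m (x₁.reverse ++ z.reverse)
    obtain ⟨s, hs⟩ := hsuf
    exact ⟨s, x₂, by rw [← List.append_assoc, ← List.append_assoc, ← hs]; simp⟩
  · rintro ⟨hl, s, t, h⟩
    have hpre : z <+: s ++ e.1.reverse := by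
      refine List.prefix_of_prefix_length_le (l₃ := z ++ x) ⟨x, rfl⟩ ⟨[e.2] ++ t, ?_⟩ ?_
      · rw [← h]; simp
      · simp; omega
    obtain ⟨x₁, hx₁⟩ := hpre
    have hx : x = x₁ ++ e.2 :: t := by
      have : z ++ x = z ++ (x₁ ++ e.2 :: t) := by
        rw [← h, ← List.append_assoc z, hx₁]
        simp
      exact List.append_cancel_left this
    have hc : x₁.foldl (windowStep m) z.reverse = e.1 := by
      rw [foldl_windowStep hz', ← List.reverse_append, hx₁, List.reverse_append,
        List.reverse_reverse, ← hl, List.take_left']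
      rfl
    have := mem_pathEdges_append (step := windowStep m) z.reverse x₁ t e.2
    rwa [hc, ← hx] at this

/-- For k = 2N + 1 the common prefix is the common start vertex, the common suffix the common end
vertex, and the factors are the edges. Thus the delayed states agree, and the letters still pending
depend on the common suffix alone. -/
theorem locallyTestableTransitions_of_conditions [Finite σ] (h₁ : ConditionOne A)
    (h₂ : ConditionTwo A) : LocallyTestableTransitions A := by
  set N := Nat.card (σ → σ) with hN
  refine ⟨N + N + 1, by omega, fun u v _ _ huv p => ?_⟩
  by_cases hu : u.length < N + N + 1
  · rw [huv.eq_of_length_lt (by omega) hu]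
  by_cases hv : v.length < N + N + 1
  · rw [huv.symm.eq_of_length_lt (by omega) hv]
  obtain ⟨ht, hr, hf⟩ := huv
  rw [Nat.add_sub_cancel] at ht hr
  rw [List.rtake_eq_reverse_take_reverse, List.rtake_eq_reverse_take_reverse,
    List.reverse_inj] at hr
  set z := u.take (N + N) with hz
  have hzl : z.length = N + N := by simp [hz]; omega
  have hux : u = z ++ u.drop (N + N) := (List.take_append_drop _ _).symm
  have hvx : v = z ++ v.drop (N + N) := by rw [ht, List.take_append_drop]
  set x := u.drop (N + N)
  set y := v.drop (N + N)
  have hact := isLocalAction_window (A := A) hN.ge h₁ h₂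
  have hzr : z.reverse.length = N + N := by simpa using hzl
  have hend : x.foldl (windowStep (N + N)) z.reverse = y.foldl (windowStep (N + N)) z.reverse := by
    rw [foldl_windowStep hzr, foldl_windowStep hzr, ← List.reverse_append, ← List.reverse_append,
      ← hux, ← hvx, hr]
  have hedges : pathEdges (windowStep (N + N)) z.reverse x =
      pathEdges (windowStep (N + N)) z.reverse y := by
    ext e
    rw [mem_pathEdges_window hzl, mem_pathEdges_window hzl, ← hux, ← hvx]
    exact and_congr_right fun hl => hf _ (by simp [hl])
  have key := hact.pathAct_eq (p := evalRev A p (settled A N z.reverse)) ⟨hzr, p, rfl⟩ hend hedges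
  have htake : z.reverse.take (N + N) = z.reverse := List.take_of_length_le hzr.le
  have hu' := pathAct_window (A := A) hN.ge (r := z.reverse) (by omega) x p
  have hv' := pathAct_window (A := A) hN.ge (r := z.reverse) (by omega) y p
  rw [htake, ← List.reverse_append, ← hux] at hu'
  rw [htake, ← List.reverse_append, ← hvx] at hv'
  have hpu := (take_take_drop_isStabilized (A := A) hN.ge (r := u.reverse) (by simp; omega)).1
  have hpv := (take_take_drop_isStabilized (A := A) hN.ge (r := v.reverse) (by simp; omega)).1
  have hpend : pending A N u.reverse = pending A N v.reverse := by
    rw [← pending_take (m := N + N) (by omega), hr, pending_take (by omega)]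
  have hrev : ∀ w : List α, A.evalFrom p w = evalRev A (evalRev A p (settled A N w.reverse))
      (pending A N w.reverse) := by
    intro w
    rw [← evalRev_append, pending_append_settled, evalRev, List.reverse_reverse]
  rw [hrev u, hrev v, hpend, ← hu', ← hv', key]

theorem locallyTestableTransitions_iff [Finite σ] :
    LocallyTestableTransitions A ↔ TestAccepts A := by
  rw [testAccepts_iff]
  exact ⟨fun h => ⟨h.conditionOne, h.conditionTwo⟩,
    fun h => locallyTestableTransitions_of_conditions h.1 h.2⟩

end Windows

end LocalTestability

namespace LocalTestability

universe u v

/-! ### Trimming the square of the state transition graph -/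

section Trim

variable {α : Type u} {σ : Type v}

theorem not_acc_of_transGen {β : Type*} {r : β → β → Prop} {x : β} (h : Relation.TransGen r x x) :
    ¬ Acc r x := fun hx => by
  replace hx := hx.transGen
  induction hx with
  | intro y _ ih => exact ih y h h

/-- Without a cycle leading to x, the transitive closure among the nodes leading to x is
irreflexive, hence well founded by finiteness. -/
theorem exists_cycle_of_not_acc {β : Type*} [Finite β] {r : β → β → Prop} {x : β}
    (h : ¬ Acc r x) : ∃ y, Relation.TransGen r y y ∧ Relation.ReflTransGen r y x := by
  by_contra! hc
  refine h ?_
  let r' : β → β → Prop := fun a b => Relation.TransGen r a b ∧ Relation.ReflTransGen r b x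
  have : IsTrans β r' := ⟨fun a b c h h' => ⟨h.1.trans h'.1, h'.2⟩⟩
  have : Std.Irrefl r' := ⟨fun a h => hc a h.1 h.2⟩
  have hwf : WellFounded r' := Finite.wellFounded_of_trans_of_irrefl r'
  have key : ∀ y, Relation.ReflTransGen r y x → Acc r y := by
    intro y
    induction y using hwf.induction with
    | _ y ih =>
      intro hy
      exact Acc.intro y fun z hz => ih z ⟨.single hz, hy⟩ (.head hz hy)
  exact key x .refl

/-- The edges of `Γ²` that stay in the strong components of both coordinates and do not end on the
diagonal. -/
def TrimEdge (A : DFA α σ) (x y : σ × σ) : Prop :=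
  PairEdge A x y ∧ Reach A y.1 x.1 ∧ Reach A y.2 x.2 ∧ y.1 ≠ y.2

variable {A : DFA α σ}

theorem PairEdge.reach {x y : σ × σ} (h : PairEdge A x y) :
    Reach A x.1 y.1 ∧ Reach A x.2 y.2 := by
  obtain ⟨a, h₁, h₂⟩ := h
  exact ⟨h₁ ▸ reach_step _ a, h₂ ▸ reach_step _ a⟩

theorem reach_of_trimEdges {x y : σ × σ} (h : Relation.ReflTransGen (TrimEdge A) x y) :
    Equi A x.1 y.1 ∧ Equi A x.2 y.2 := by
  induction h with
  | refl => exact ⟨⟨.refl _, .refl _⟩, ⟨.refl _, .refl _⟩⟩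
  | tail _ h ih =>
    obtain ⟨⟨h₁, h₂⟩, h₃, h₄⟩ := ih
    have := h.1.reach
    exact ⟨⟨h₁.trans this.1, h.2.1.trans h₂⟩, h₃.trans this.2, h.2.2.1.trans h₄⟩

theorem sccNode_of_cycle {x : σ × σ} (h : Relation.TransGen (TrimEdge A) x x) : SCCNode A x :=
  Relation.TransGen.mono (r := TrimEdge A) (fun _ _ h => h.1) _ _ h

theorem ne_of_cycle {x : σ × σ} (h : Relation.TransGen (TrimEdge A) x x) : x.1 ≠ x.2 := by
  obtain ⟨y, -, hy⟩ := Relation.TransGen.tail'_iff.1 h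
  exact hy.2.2.2

/-- A closed walk leaves the strong component of neither coordinate. It cannot touch the diagonal
either, since a deterministic step from the diagonal stays on it. -/
theorem SCCNode.cycle {x : σ × σ} (h : SCCNode A x) (hx : x.1 ≠ x.2) :
    Relation.TransGen (TrimEdge A) x x := by
  have reach : ∀ {y z}, Relation.ReflTransGen (PairEdge A) y z →
      Reach A y.1 z.1 ∧ Reach A y.2 z.2 := by
    intro y z h
    induction h with
    | refl => exact ⟨.refl _, .refl _⟩
    | tail _ h ih => exact ⟨ih.1.trans h.reach.1, ih.2.trans h.reach.2⟩
  have diag : ∀ {y z}, Relation.ReflTransGen (PairEdge A) y z → y.1 = y.2 → z.1 = z.2 := by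
    intro y z h hy
    induction h with
    | refl => exact hy
    | tail _ h ih =>
      obtain ⟨a, h₁, h₂⟩ := h
      rw [← h₁, ← h₂, ih]
  have key : ∀ y, Relation.TransGen (PairEdge A) x y → Relation.ReflTransGen (PairEdge A) y x →
      Relation.TransGen (TrimEdge A) x y := by
    intro y hxy
    induction hxy with
    | single h' =>
      intro hy
      exact .single ⟨h', (reach hy).1, (reach hy).2, fun he => hx (diag hy he)⟩
    | @tail b c hb hbc ih =>
      intro hc
      have hcb := reach (hc.trans hb.to_reflTransGen)
      exact .tail (ih (.head hbc hc)) ⟨hbc, hcb.1, hcb.2, fun he => hx (diag hc he)⟩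
  exact key x h .refl

/-- Trim edges preserve the classes of both coordinates, so a node to which a trim cycle leads has
the same order relations between its coordinates as the off-diagonal SCC-node on that cycle. -/
theorem conditionOne_iff_acc [Finite σ] : ConditionOne A ↔
    ∀ x : σ × σ, ¬ Acc (TrimEdge A) x → Reach A x.1 x.2 → ¬ Reach A x.2 x.1 := by
  constructor
  · intro h x hx h₁ h₂
    obtain ⟨y, hy, hyx⟩ := exists_cycle_of_not_acc hx
    obtain ⟨⟨h₃, h₄⟩, h₅, h₆⟩ := reach_of_trimEdges hyx
    exact ne_of_cycle hy (h y.1 y.2 (sccNode_of_cycle hy)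
      ⟨(h₃.trans h₁).trans h₆, (h₅.trans h₂).trans h₄⟩)
  · intro h p q hs hpq
    by_contra hne
    exact h (p, q) (not_acc_of_transGen (hs.cycle hne)) hpq.1 hpq.2

/-- Nodes to which a trim cycle leads may serve as sources in place of SCC-nodes: trim edges are
kept edges, so such a node is itself visited from the SCC-node on the cycle, whose coordinates are
related in the same way. -/
theorem visited_iff_acc [Finite σ] {x : σ × σ} : Visited A x ↔
    ∃ y, ¬ Acc (TrimEdge A) y ∧ StrictReach A y.1 y.2 ∧
      Relation.ReflTransGen (KeptEdge A) y x := by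
  rw [visited_iff]
  constructor
  · rintro ⟨y, hs, hy, hyx⟩
    refine ⟨y, not_acc_of_transGen (hs.cycle fun he => hy.2 ?_), hy, hyx⟩
    rw [he]
    exact .refl _
  · rintro ⟨y, hn, hy, hyx⟩
    obtain ⟨z, hz, hzy⟩ := exists_cycle_of_not_acc hn
    obtain ⟨⟨h₁, h₂⟩, h₃, h₄⟩ := reach_of_trimEdges hzy
    refine ⟨z, sccNode_of_cycle hz, ⟨(h₁.trans hy.1).trans h₄, fun h =>
      hy.2 ((h₄.trans h).trans h₁)⟩, Relation.ReflTransGen.trans ?_ hyx⟩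
    exact Relation.ReflTransGen.mono (r := TrimEdge A)
        (fun a b h => ⟨h.1, fun hn => hn.1 h.2.2.1⟩) _ _ hzy

end Trim

end LocalTestability

namespace LocalTestability

/-! ### A machine with arrays -/

/-- Programs with registers and sixteen arrays. -/
inductive ArrayProg : Type
  | skip : ArrayProg
  | const (x c : ℕ) : ArrayProg
  | add (x y z : ℕ) : ArrayProg
  | sub (x y z : ℕ) : ArrayProg
  /-- `r x := arr i (r y)` -/
  | load (x i y : ℕ) : ArrayProg
  /-- `arr i (r x) := r y` -/
  | store (i x y : ℕ) : ArrayProg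
  | seq (c d : ArrayProg) : ArrayProg
  | ite (x : ℕ) (c d : ArrayProg) : ArrayProg
  | loop (x : ℕ) (c : ArrayProg) : ArrayProg

notation:60 c:61 " ;; " d:60 => ArrayProg.seq c d

/-- Contents of the registers and of the arrays. -/
structure ArrayState : Type where
  reg : ℕ → ℕ
  arr : ℕ → ℕ → ℕ

namespace ArrayState

def setReg (s : ArrayState) (x m : ℕ) : ArrayState :=
  { s with reg := Function.update s.reg x m }

def setArr (s : ArrayState) (i j m : ℕ) : ArrayState :=
  { s with arr := Function.update s.arr i (Function.update (s.arr i) j m) }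

@[simp] theorem setReg_reg (s : ArrayState) (x m y : ℕ) :
    (s.setReg x m).reg y = if y = x then m else s.reg y := by
  simp [setReg, Function.update_apply]

@[simp] theorem setReg_arr (s : ArrayState) (x m : ℕ) : (s.setReg x m).arr = s.arr := rfl

@[simp] theorem setArr_reg (s : ArrayState) (i j m : ℕ) : (s.setArr i j m).reg = s.reg := rfl

theorem setArr_arr (s : ArrayState) (i j m i' j' : ℕ) :
    (s.setArr i j m).arr i' j' = if i' = i ∧ j' = j then m else s.arr i' j' := by
  by_cases h : i' = i
  · subst h
    simp [setArr, Function.update_apply]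
  · simp [setArr, h]

@[simp] theorem setArr_arr_self (s : ArrayState) (i j m j' : ℕ) :
    (s.setArr i j m).arr i j' = if j' = j then m else s.arr i j' := by
  simp [setArr_arr]

theorem setArr_arr_of_ne (s : ArrayState) {i j m i' : ℕ} (h : i' ≠ i) :
    (s.setArr i j m).arr i' = s.arr i' := by
  funext j'
  simp [setArr_arr, h]

end ArrayState

/-- Execution of array programs, with a step count; arrays have `S` cells and sums are bounded
by `W`. -/
inductive ArrayRuns (W S : ℕ) : ArrayProg → ArrayState → ℕ → ArrayState → Prop
  | skip (s : ArrayState) : ArrayRuns W S .skip s 1 s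
  | const (s : ArrayState) (x c : ℕ) (h : c ≤ W) :
      ArrayRuns W S (.const x c) s 1 (s.setReg x c)
  | add (s : ArrayState) (x y z : ℕ) (h : s.reg y + s.reg z ≤ W) :
      ArrayRuns W S (.add x y z) s 1 (s.setReg x (s.reg y + s.reg z))
  | sub (s : ArrayState) (x y z : ℕ) :
      ArrayRuns W S (.sub x y z) s 1 (s.setReg x (s.reg y - s.reg z))
  | load (s : ArrayState) (x i y : ℕ) (hi : i < 16) (h : s.reg y < S) :
      ArrayRuns W S (.load x i y) s 1 (s.setReg x (s.arr i (s.reg y)))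
  | store (s : ArrayState) (i x y : ℕ) (hi : i < 16) (h : s.reg x < S) :
      ArrayRuns W S (.store i x y) s 1 (s.setArr i (s.reg x) (s.reg y))
  | seq {c d : ArrayProg} {s s' s'' : ArrayState} {t t' : ℕ}
      (h : ArrayRuns W S c s t s') (h' : ArrayRuns W S d s' t' s'') :
      ArrayRuns W S (.seq c d) s (t + t') s''
  | iteTrue {x : ℕ} {c d : ArrayProg} {s s' : ArrayState} {t : ℕ}
      (hx : s.reg x ≠ 0) (h : ArrayRuns W S c s t s') : ArrayRuns W S (.ite x c d) s (1 + t) s'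
  | iteFalse {x : ℕ} {c d : ArrayProg} {s s' : ArrayState} {t : ℕ}
      (hx : s.reg x = 0) (h : ArrayRuns W S d s t s') : ArrayRuns W S (.ite x c d) s (1 + t) s'
  | loopDone {x : ℕ} {c : ArrayProg} {s : ArrayState}
      (hx : s.reg x = 0) : ArrayRuns W S (.loop x c) s 1 s
  | loopStep {x : ℕ} {c : ArrayProg} {s s' s'' : ArrayState} {t t' : ℕ}
      (hx : s.reg x ≠ 0) (h : ArrayRuns W S c s t s') (h' : ArrayRuns W S (.loop x c) s' t' s'') :
      ArrayRuns W S (.loop x c) s (1 + t + t') s''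

/-! #### Compilation -/

/-- The random access machine keeps register `r` in register `r + 20`, the base address of
array `i` in register `i + 2`, and uses register `19` for addresses. -/
def ArrayProg.compile : ArrayProg → Prog
  | .skip => .skip
  | .const x c => .const (x + 20) c
  | .add x y z => .add (x + 20) (y + 20) (z + 20)
  | .sub x y z => .sub (x + 20) (y + 20) (z + 20)
  | .load x i y => .seq (.add 19 (i + 2) (y + 20)) (.load (x + 20) 19)
  | .store i x y => .seq (.add 19 (i + 2) (x + 20)) (.store 19 (y + 20))
  | .seq c d => .seq c.compile d.compile
  | .ite x c d => .ite (x + 20) c.compile d.compile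
  | .loop x c => .loop (x + 20) c.compile

/-- The state `s` of the random access machine represents the array state `a`. -/
structure Represents (W S : ℕ) (s : MachineState) (a : ArrayState) : Prop where
  reg : ∀ x, s.reg (x + 20) = a.reg x
  reg_le : ∀ x, a.reg x ≤ W
  base : ∀ i < 16, s.reg (i + 2) = i * S
  mem : ∀ i < 16, ∀ j < S, s.mem (i * S + j) = a.arr i j
  arr_le : ∀ i < 16, ∀ j < S, a.arr i j ≤ W

variable {W S : ℕ}

theorem Represents.setReg {s : MachineState} {a : ArrayState} (h : Represents W S s a) (x : ℕ)
    {m : ℕ} (hm : m ≤ W) : Represents W S (s.setReg (x + 20) m) (a.setReg x m) where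
  reg y := by
    by_cases hy : y = x
    · simp [MachineState.setReg, hy]
    · simp [MachineState.setReg, hy, Function.update_of_ne, h.reg]
  reg_le y := by
    rw [ArrayState.setReg_reg]
    split_ifs
    · exact hm
    · exact h.reg_le y
  base i hi := by
    rw [← h.base i hi, MachineState.setReg]
    exact Function.update_of_ne (show i + 2 ≠ _ by omega) _ _
  mem := h.mem
  arr_le := h.arr_le

theorem Represents.setAddress {s : MachineState} {a : ArrayState} (h : Represents W S s a)
    (m : ℕ) : Represents W S (s.setReg 19 m) a where
  reg y := by
    rw [← h.reg y]
    change Function.update s.reg 19 m (y + 20) = s.reg (y + 20)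
    exact Function.update_of_ne (show y + 20 ≠ 19 by omega) _ _
  reg_le := h.reg_le
  base i hi := by
    rw [← h.base i hi, MachineState.setReg]
    exact Function.update_of_ne (show i + 2 ≠ 19 by omega) _ _
  mem := h.mem
  arr_le := h.arr_le

theorem address_injective {i i' j j' : ℕ} (hj : j < S) (hj' : j' < S)
    (h : i * S + j = i' * S + j') : i = i' ∧ j = j' := by
  have h₁ : (i * S + j) / S = i := by
    rw [mul_comm, Nat.mul_add_div (by omega), Nat.div_eq_of_lt hj, add_zero]
  have h₂ : (i' * S + j') / S = i' := by
    rw [mul_comm, Nat.mul_add_div (by omega), Nat.div_eq_of_lt hj', add_zero]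
  have : i = i' := by rw [← h₁, h, h₂]
  subst this
  exact ⟨rfl, by omega⟩

theorem Represents.setMem {s : MachineState} {a : ArrayState} (h : Represents W S s a) {i j m : ℕ}
    (hj : j < S) (hm : m ≤ W) :
    Represents W S (s.setMem (i * S + j) m) (a.setArr i j m) where
  reg := h.reg
  reg_le := h.reg_le
  base := h.base
  mem i' hi' j' hj' := by
    rw [ArrayState.setArr_arr]
    change Function.update s.mem (i * S + j) m (i' * S + j') = _
    rw [Function.update_apply]
    by_cases hc : i' = i ∧ j' = j
    · rw [if_pos (by rw [hc.1, hc.2]), if_pos hc]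
    · rw [if_neg fun he => hc (address_injective hj' hj he), if_neg hc]
      exact h.mem i' hi' j' hj'
  arr_le i' hi' j' hj' := by
    rw [ArrayState.setArr_arr]
    split_ifs
    · exact hm
    · exact h.arr_le i' hi' j' hj'

theorem address_le (hW : 16 * S ≤ W) {i j : ℕ} (hi : i < 16) (hj : j < S) : i * S + j ≤ W := by
  have : (i + 1) * S ≤ 16 * S := Nat.mul_le_mul_right S hi
  rw [add_mul, one_mul] at this
  omega

/-- Only array accesses need a second instruction, to add the base address. Loaded numbers,
differences and addresses are bounded by the invariant, so just constants and sums need a bound in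
`ArrayRuns`. -/
theorem ArrayRuns.compile (hW : 16 * S ≤ W) {P : ArrayProg} {a a' : ArrayState} {t : ℕ}
    (h : ArrayRuns W S P a t a') {s : MachineState} (hs : Represents W S s a) :
    ∃ t' s', t' ≤ 2 * t ∧ Runs W P.compile s t' s' ∧ Represents W S s' a' := by
  induction h generalizing s with
  | skip a => exact ⟨1, s, by omega, .skip s, hs⟩
  | const a x c h => exact ⟨1, _, by omega, .const s _ c h, hs.setReg x h⟩
  | add a x y z h =>
    refine ⟨1, _, by omega, .add s _ _ _ (by rwa [hs.reg, hs.reg]), ?_⟩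
    rw [hs.reg, hs.reg]
    exact hs.setReg x h
  | sub a x y z =>
    have h : a.reg y - a.reg z ≤ W := (Nat.sub_le _ _).trans (hs.reg_le y)
    refine ⟨1, _, by omega, .sub s _ _ _ (by rwa [hs.reg, hs.reg]), ?_⟩
    rw [hs.reg, hs.reg]
    exact hs.setReg x h
  | load a x i y hi h =>
    have had : s.reg (i + 2) + s.reg (y + 20) = i * S + a.reg y := by rw [hs.base i hi, hs.reg]
    have hmem : (s.setReg 19 (s.reg (i + 2) + s.reg (y + 20))).mem
        ((s.setReg 19 (s.reg (i + 2) + s.reg (y + 20))).reg 19) = a.arr i (a.reg y) := by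
      rw [← hs.mem i hi _ h, had]
      simp [MachineState.setReg]
    refine ⟨1 + 1, _, by omega, .seq (.add s _ _ _ ?_) (.load _ _ _ ?_), ?_⟩
    · rw [had]
      exact address_le hW hi h
    · rw [hmem]
      exact hs.arr_le i hi _ h
    · rw [hmem]
      exact (hs.setAddress _).setReg x (hs.arr_le i hi _ h)
  | store a i x y hi h =>
    have had : s.reg (i + 2) + s.reg (x + 20) = i * S + a.reg x := by rw [hs.base i hi, hs.reg]
    have h₁ := hs.setAddress (s.reg (i + 2) + s.reg (x + 20))
    have h₂ : (s.setReg 19 (s.reg (i + 2) + s.reg (x + 20))).reg 19 = i * S + a.reg x := by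
      rw [← had]
      simp [MachineState.setReg]
    refine ⟨1 + 1, _, by omega, .seq (.add s _ _ _ ?_) (.store _ _ _ ?_), ?_⟩
    · rw [had]
      exact address_le hW hi h
    · rw [h₁.reg]
      exact hs.reg_le y
    · rw [h₁.reg, h₂]
      exact h₁.setMem h (hs.reg_le y)
  | seq _ _ ih ih' =>
    obtain ⟨t₁, s₁, ht₁, hr₁, hs₁⟩ := ih hs
    obtain ⟨t₂, s₂, ht₂, hr₂, hs₂⟩ := ih' hs₁
    exact ⟨_, s₂, by omega, .seq hr₁ hr₂, hs₂⟩
  | iteTrue hx _ ih =>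
    obtain ⟨t₁, s₁, ht₁, hr₁, hs₁⟩ := ih hs
    exact ⟨_, s₁, by omega, .iteTrue (by rwa [hs.reg]) hr₁, hs₁⟩
  | iteFalse hx _ ih =>
    obtain ⟨t₁, s₁, ht₁, hr₁, hs₁⟩ := ih hs
    exact ⟨_, s₁, by omega, .iteFalse (by rwa [hs.reg]) hr₁, hs₁⟩
  | loopDone hx => exact ⟨_, s, by omega, .loopDone (by rwa [hs.reg]), hs⟩
  | loopStep hx _ _ ih ih' =>
    obtain ⟨t₁, s₁, ht₁, hr₁, hs₁⟩ := ih hs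
    obtain ⟨t₂, s₂, ht₂, hr₂, hs₂⟩ := ih' hs₁
    exact ⟨_, s₂, by omega, .loopStep (by rwa [hs.reg]) hr₁ hr₂, hs₂⟩

/-! #### Frames -/

/-- The registers that a program may change. -/
def ArrayProg.regs : ArrayProg → List ℕ
  | .skip => []
  | .const x _ => [x]
  | .add x _ _ => [x]
  | .sub x _ _ => [x]
  | .load x _ _ => [x]
  | .store _ _ _ => []
  | .seq c d => c.regs ++ d.regs
  | .ite _ c d => c.regs ++ d.regs
  | .loop _ c => c.regs

/-- The arrays that a program may change. -/
def ArrayProg.arrs : ArrayProg → List ℕ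
  | .store i _ _ => [i]
  | .seq c d => c.arrs ++ d.arrs
  | .ite _ c d => c.arrs ++ d.arrs
  | .loop _ c => c.arrs
  | _ => []

/-- The states `a` and `b` differ only in what `P` may change. -/
def ArrayProg.Frame (P : ArrayProg) (a b : ArrayState) : Prop :=
  (∀ x, x ∉ P.regs → b.reg x = a.reg x) ∧ ∀ i, i ∉ P.arrs → b.arr i = a.arr i

/-- Registers and arrays are named by literals in the program text, so what a run may change can be
read off the syntax. For concrete programs `decide` can then settle such side conditions. -/
theorem ArrayRuns.frame {P : ArrayProg} {a a' : ArrayState} {t : ℕ} (h : ArrayRuns W S P a t a') :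
    P.Frame a a' := by
  induction h with
  | skip a => exact ⟨fun _ _ => rfl, fun _ _ => rfl⟩
  | const a x c h =>
    exact ⟨fun y hy => by simp [ArrayProg.regs] at hy; simp [hy], fun _ _ => rfl⟩
  | add a x y z h =>
    exact ⟨fun y hy => by simp [ArrayProg.regs] at hy; simp [hy], fun _ _ => rfl⟩
  | sub a x y z =>
    exact ⟨fun y hy => by simp [ArrayProg.regs] at hy; simp [hy], fun _ _ => rfl⟩
  | load a x i y hi h =>
    exact ⟨fun y hy => by simp [ArrayProg.regs] at hy; simp [hy], fun _ _ => rfl⟩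
  | store a i x y hi h =>
    exact ⟨fun y hy => rfl, fun j hj => ArrayState.setArr_arr_of_ne _
      (by simpa [ArrayProg.arrs] using hj)⟩
  | seq _ _ ih ih' =>
    refine ⟨fun x hx => ?_, fun i hi => ?_⟩
    · simp only [ArrayProg.regs, List.mem_append, not_or] at hx
      rw [ih'.1 x hx.2, ih.1 x hx.1]
    · simp only [ArrayProg.arrs, List.mem_append, not_or] at hi
      rw [ih'.2 i hi.2, ih.2 i hi.1]
  | iteTrue hx _ ih =>
    refine ⟨fun x hx => ?_, fun i hi => ?_⟩
    · simp only [ArrayProg.regs, List.mem_append, not_or] at hx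
      exact ih.1 x hx.1
    · simp only [ArrayProg.arrs, List.mem_append, not_or] at hi
      exact ih.2 i hi.1
  | iteFalse hx _ ih =>
    refine ⟨fun x hx => ?_, fun i hi => ?_⟩
    · simp only [ArrayProg.regs, List.mem_append, not_or] at hx
      exact ih.1 x hx.2
    · simp only [ArrayProg.arrs, List.mem_append, not_or] at hi
      exact ih.2 i hi.2
  | loopDone hx => exact ⟨fun _ _ => rfl, fun _ _ => rfl⟩
  | loopStep hx _ _ ih ih' =>
    refine ⟨fun x hx => ?_, fun i hi => ?_⟩
    · rw [ih'.1 x hx, ih.1 x hx]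
    · rw [ih'.2 i hi, ih.2 i hi]

/-! #### Total correctness -/

/-- Started in `a`, the program halts after at most `T` steps in a state with property `Q`. -/
def Halts (W S : ℕ) (P : ArrayProg) (a : ArrayState) (T : ℕ) (Q : ArrayState → Prop) : Prop :=
  ∃ t a', t ≤ T ∧ ArrayRuns W S P a t a' ∧ Q a'

theorem Halts.mono {P : ArrayProg} {a : ArrayState} {T T' : ℕ} {Q Q' : ArrayState → Prop}
    (h : Halts W S P a T Q) (hT : T ≤ T') (hQ : ∀ b, P.Frame a b → Q b → Q' b) :
    Halts W S P a T' Q' := by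
  obtain ⟨t, a', ht, hr, hq⟩ := h
  exact ⟨t, a', ht.trans hT, hr, hQ a' hr.frame hq⟩

theorem Halts.seq {P P' : ArrayProg} {a : ArrayState} {T T' : ℕ} {Q R : ArrayState → Prop}
    (h : Halts W S P a T Q) (h' : ∀ b, P.Frame a b → Q b → Halts W S P' b T' R) :
    Halts W S (P ;; P') a (T + T') R := by
  obtain ⟨t, b, ht, hr, hq⟩ := h
  obtain ⟨t', c, ht', hr', hq'⟩ := h' b hr.frame hq
  exact ⟨t + t', c, by omega, .seq hr hr', hq'⟩

/-- The number of steps of a program without loops. -/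
def ArrayProg.cost : ArrayProg → ℕ
  | .seq c d => c.cost + d.cost
  | .ite _ c d => 1 + max c.cost d.cost
  | _ => 1

/-- A precondition for the postcondition `Q` of a program without loops. -/
def ArrayProg.Pre (W S : ℕ) : ArrayProg → (ArrayState → Prop) → ArrayState → Prop
  | .skip, Q, a => Q a
  | .const x c, Q, a => c ≤ W ∧ Q (a.setReg x c)
  | .add x y z, Q, a => a.reg y + a.reg z ≤ W ∧ Q (a.setReg x (a.reg y + a.reg z))
  | .sub x y z, Q, a => Q (a.setReg x (a.reg y - a.reg z))
  | .load x i y, Q, a => i < 16 ∧ a.reg y < S ∧ Q (a.setReg x (a.arr i (a.reg y)))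
  | .store i x y, Q, a => i < 16 ∧ a.reg x < S ∧ Q (a.setArr i (a.reg x) (a.reg y))
  | .seq c d, Q, a => c.Pre W S (d.Pre W S Q) a
  | .ite x c d, Q, a => (a.reg x ≠ 0 → c.Pre W S Q a) ∧ (a.reg x = 0 → d.Pre W S Q a)
  | .loop _ _, _, _ => False

theorem ArrayProg.Pre.mono {P : ArrayProg} {a : ArrayState} {Q R : ArrayState → Prop}
    (h : P.Pre W S Q a) (hQ : ∀ b, Q b → R b) : P.Pre W S R a := by
  induction P generalizing a Q R with
  | skip => exact hQ _ h
  | const x c => exact ⟨h.1, hQ _ h.2⟩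
  | add x y z => exact ⟨h.1, hQ _ h.2⟩
  | sub x y z => exact hQ _ h
  | load x i y => exact ⟨h.1, h.2.1, hQ _ h.2.2⟩
  | store i x y => exact ⟨h.1, h.2.1, hQ _ h.2.2⟩
  | seq c d ihc ihd => exact ihc h fun b hb => ihd hb hQ
  | ite x c d ihc ihd => exact ⟨fun hx => ihc (h.1 hx) hQ, fun hx => ihd (h.2 hx) hQ⟩
  | loop x c => exact h.elim

theorem ArrayProg.Pre.halts {P : ArrayProg} {a : ArrayState} {Q : ArrayState → Prop}
    (h : P.Pre W S Q a) : Halts W S P a P.cost Q := by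
  induction P generalizing a Q with
  | skip => exact ⟨1, a, le_rfl, .skip a, h⟩
  | const x c => exact ⟨1, _, le_rfl, .const a x c h.1, h.2⟩
  | add x y z => exact ⟨1, _, le_rfl, .add a x y z h.1, h.2⟩
  | sub x y z => exact ⟨1, _, le_rfl, .sub a x y z, h⟩
  | load x i y => exact ⟨1, _, le_rfl, .load a x i y h.1 h.2.1, h.2.2⟩
  | store i x y => exact ⟨1, _, le_rfl, .store a i x y h.1 h.2.1, h.2.2⟩
  | seq c d ihc ihd => exact (ihc h).seq fun b _ hb => ihd hb
  | ite x c d ihc ihd =>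
    by_cases hx : a.reg x = 0
    · obtain ⟨t, b, ht, hr, hq⟩ := ihd (h.2 hx)
      exact ⟨1 + t, b, by simp only [cost]; omega, .iteFalse hx hr, hq⟩
    · obtain ⟨t, b, ht, hr, hq⟩ := ihc (h.1 hx)
      exact ⟨1 + t, b, by simp only [cost]; omega, .iteTrue hx hr, hq⟩
  | loop x c => exact h.elim

/-- The index of the invariant bounds the remaining iterations and drops by one in each. The loop
may stop with a positive index. -/
theorem Halts.loop {x : ℕ} {P : ArrayProg} {T : ℕ} {a : ArrayState} {m : ℕ}
    (I : ℕ → ArrayState → Prop) (h₀ : I m a)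
    (h : ∀ m b, P.Frame a b → I m b → b.reg x ≠ 0 → ∃ m', m = m' + 1 ∧ Halts W S P b T (I m')) :
    Halts W S (.loop x P) a (m * (T + 1) + 1) fun b => b.reg x = 0 ∧ ∃ m, I m b := by
  have key : ∀ m b, P.Frame a b → I m b → Halts W S (.loop x P) b (m * (T + 1) + 1)
      fun b => b.reg x = 0 ∧ ∃ m, I m b := by
    intro m
    induction m with
    | zero =>
      intro b hf hI
      by_cases hx : b.reg x = 0
      · exact ⟨1, b, by omega, .loopDone hx, hx, 0, hI⟩
      · obtain ⟨m', hm, -⟩ := h 0 b hf hI hx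
        omega
    | succ m ih =>
      intro b hf hI
      by_cases hx : b.reg x = 0
      · exact ⟨1, b, by omega, .loopDone hx, hx, _, hI⟩
      · obtain ⟨m', hm, t, c, ht, hr, hc⟩ := h _ b hf hI hx
        obtain rfl : m = m' := by omega
        have hfc := hr.frame
        obtain ⟨t', d, ht', hr', hd⟩ := ih c ⟨fun y hy => (hfc.1 y hy).trans (hf.1 y hy),
          fun i hi => (hfc.2 i hi).trans (hf.2 i hi)⟩ hc
        refine ⟨1 + t + t', d, ?_, .loopStep hx hr hr', hd⟩
        rw [add_mul]
        omega
  exact key m a ⟨fun _ _ => rfl, fun _ _ => rfl⟩ h₀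

/-- Do `P` for the values of register `i` below the value of register `b`; register `3` is
supposed to hold `1`. -/
def ArrayProg.count (i t b : ℕ) (P : ArrayProg) : ArrayProg :=
  .const i 0 ;; .sub t b i ;; .loop t (P ;; .add i i 3 ;; .sub t b i)

/-- The invariant must not depend on the two loop registers. The body may assume that everything it
does not write is as at the start. Each round costs T, two instructions and one test. -/
theorem Halts.count {i t b : ℕ} {P : ArrayProg} {T m : ℕ} {a : ArrayState}
    (I : ℕ → ArrayState → Prop) (hb : a.reg b = m) (h₃ : a.reg 3 = 1) (hm : m ≤ W)
    (hib : b ≠ i ∧ b ≠ t ∧ 3 ≠ i ∧ 3 ≠ t ∧ i ≠ t) (hP : i ∉ P.regs ∧ b ∉ P.regs ∧ 3 ∉ P.regs)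
    (hI : ∀ j c d, I j c → d.arr = c.arr → (∀ x, x ≠ i → x ≠ t → d.reg x = c.reg x) → I j d)
    (h₀ : I 0 a)
    (h : ∀ j < m, ∀ c, (∀ x, x ≠ i → x ≠ t → x ∉ P.regs → c.reg x = a.reg x) →
      (∀ x, x ∉ P.arrs → c.arr x = a.arr x) → I j c → c.reg i = j → Halts W S P c T (I (j + 1))) :
    Halts W S (.count i t b P) a (m * (T + 3) + 3) (I m) := by
  obtain ⟨hbi, hbt, h3i, h3t, hit⟩ := hib
  have pre : Halts W S (.const i 0) a 1 fun c => c = a.setReg i 0 :=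
    ⟨1, _, le_rfl, .const a i 0 (Nat.zero_le _), rfl⟩
  refine (pre.seq (T' := m * (T + 3) + 2) (R := I m) ?_).mono (by omega) fun _ _ hc => hc
  rintro _ - rfl
  have pre' : Halts W S (.sub t b i) (a.setReg i 0) 1 fun c => c = (a.setReg i 0).setReg t m := by
    refine ⟨1, _, le_rfl, .sub _ t b i, ?_⟩
    simp [hbi, hb]
  refine (pre'.seq (T' := m * (T + 3) + 1) (R := I m) ?_).mono (by omega) fun _ _ hc => hc
  rintro _ - rfl
  set a' := (a.setReg i 0).setReg t m with ha'
  have ha'r : ∀ x, x ≠ i → x ≠ t → a'.reg x = a.reg x := by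
    intro x hx hx'
    simp [ha', hx, hx']
  -- `Halts.loop` counts down, so the index is the number r of rounds still to do, and `I` is taken
  -- at m - r.
  let J : ℕ → ArrayState → Prop := fun r c =>
    I (m - r) c ∧ r ≤ m ∧ c.reg i = m - r ∧ c.reg t = r
  have hJ : J m a' := by
    refine ⟨?_, le_rfl, by simp [ha', hit], by simp [ha']⟩
    rw [Nat.sub_self]
    exact hI 0 a a' h₀ rfl ha'r
  refine (Halts.loop (T := T + 2) J hJ ?_).mono le_rfl ?_
  · rintro r c ⟨hfr, hfa⟩ ⟨hc, hr, hci, hct⟩ hne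
    simp only [ArrayProg.regs, ArrayProg.arrs, List.mem_append, not_or, List.mem_singleton,
      List.append_nil] at hfr hfa
    obtain ⟨r, rfl⟩ : ∃ r', r = r' + 1 := ⟨r - 1, by omega⟩
    refine ⟨r, rfl, ?_⟩
    have hcb : c.reg b = m := by
      rw [hfr b ⟨hP.2.1, hbi, hbt⟩, ha'r b hbi hbt, hb]
    have hc3 : c.reg 3 = 1 := by
      rw [hfr 3 ⟨hP.2.2, h3i, h3t⟩, ha'r 3 h3i h3t, h₃]
    have body := h (m - (r + 1)) (by omega) c
      (fun x hx hx' hxP => by rw [hfr x ⟨hxP, hx, hx'⟩, ha'r x hx hx'])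
      (fun x hx => by rw [hfa x hx]; rfl) hc hci
    refine (body.seq (T' := 2) ?_).mono le_rfl fun _ _ hc => hc
    intro d hd hId
    have hdi : d.reg i = m - (r + 1) := by rw [hd.1 i hP.1, hci]
    have hdb : d.reg b = m := by rw [hd.1 b hP.2.1, hcb]
    have hd3 : d.reg 3 = 1 := by rw [hd.1 3 hP.2.2, hc3]
    refine ⟨1 + 1, _, le_rfl, .seq (.add d i i 3 (by omega)) (.sub _ t b i), ?_⟩
    have e₁ : m - (r + 1) + 1 = m - r := by omega
    refine ⟨?_, by omega, by simp [hit, hdi, hd3, e₁], ?_⟩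
    · rw [e₁] at hId
      refine hI _ d _ hId rfl fun x hx hx' => ?_
      simp [hx, hx']
    · simp [hbi, hdb, hdi, hd3, e₁]
      omega
  · rintro c - ⟨hc0, r, hc, hr, hci, hct⟩
    rw [hct] at hc0
    subst hc0
    exact hc

end LocalTestability

namespace LocalTestability

/-! ### The worklist algorithm -/

section Worklist

open Finset

variable {W S : ℕ}

open Classical in
/-- The number of edges from `x` with a letter below `j` that end in `y`; there is an edge from `x`
to `tgt x a` for the letter `a` if `e x a` holds. -/
noncomputable def edgeCount (e : ℕ → ℕ → Prop) (tgt : ℕ → ℕ → ℕ) (j x y : ℕ) : ℕ :=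
  ∑ a ∈ range j, if e x a ∧ tgt x a = y then 1 else 0

/-- The number of edges from `D` to `y`. -/
noncomputable def inCount (e : ℕ → ℕ → Prop) (tgt : ℕ → ℕ → ℕ) (k : ℕ) (D : Finset ℕ) (y : ℕ) :
    ℕ :=
  ∑ x ∈ D, edgeCount e tgt k x y

variable {e : ℕ → ℕ → Prop} {tgt : ℕ → ℕ → ℕ} {k : ℕ}

open Classical in
theorem edgeCount_succ (j x y : ℕ) : edgeCount e tgt (j + 1) x y =
    edgeCount e tgt j x y + if e x j ∧ tgt x j = y then 1 else 0 := by
  rw [edgeCount, sum_range_succ, ← edgeCount]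

theorem edgeCount_mono {j j' : ℕ} (h : j ≤ j') (x y : ℕ) :
    edgeCount e tgt j x y ≤ edgeCount e tgt j' x y :=
  sum_le_sum_of_subset (range_subset_range.2 h)

theorem inCount_mono {D D' : Finset ℕ} (h : D ⊆ D') (y : ℕ) :
    inCount e tgt k D y ≤ inCount e tgt k D' y :=
  sum_le_sum_of_subset h

/-- Every node below `N` that has at least `c₀` incoming edges from `M` belongs to `M`. -/
def ClosedUnder (e : ℕ → ℕ → Prop) (tgt : ℕ → ℕ → ℕ) (k N : ℕ) (c₀ : ℕ → ℕ) (M : Finset ℕ) :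
    Prop :=
  ∀ y < N, c₀ y ≤ inCount e tgt k M y → y ∈ M

/-- The nodes below `N` at which the counter in array `c` is zero. -/
def zeros (N c : ℕ) (b : ArrayState) : Finset ℕ := (range N).filter fun y => b.arr c y = 0

theorem mem_zeros {N c : ℕ} {b : ArrayState} {y : ℕ} :
    y ∈ zeros N c b ↔ y < N ∧ b.arr c y = 0 := by
  simp [zeros]

/-- The stack in array `8`, of the height given by register `10`, holds once each node
with counter zero outside `D`. -/
structure StackInv (N c : ℕ) (D : Finset ℕ) (b : ArrayState) : Prop where
  union : D ∪ (range (b.reg 10)).image (b.arr 8) = zeros N c b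
  card : D.card + b.reg 10 = (zeros N c b).card

theorem StackInv.of_eq {N c : ℕ} {D : Finset ℕ} {b b' : ArrayState} (h : StackInv N c D b)
    (hr : b'.reg 10 = b.reg 10) (h8 : b'.arr 8 = b.arr 8) (hc : b'.arr c = b.arr c) :
    StackInv N c D b' := by
  have hz : zeros N c b' = zeros N c b := by simp [zeros, hc]
  exact ⟨by rw [hr, h8, hz, h.union], by rw [hr, hz, h.card]⟩

theorem image_range_push {f g : ℕ → ℕ} {s y : ℕ} (hg : ∀ i, g i = if i = s then y else f i) :
    (range (s + 1)).image g = insert y ((range s).image f) := by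
  rw [range_add_one, image_insert, hg s, if_pos rfl]
  congr 1
  refine image_congr fun i hi => ?_
  have : i < s := by simpa using hi
  rw [hg, if_neg (by omega)]

theorem card_zeros_le (N c : ℕ) (b : ArrayState) : (zeros N c b).card ≤ N :=
  (card_filter_le _ _).trans (card_range N).le

theorem StackInv.push {N c y : ℕ} {D : Finset ℕ} {b b' : ArrayState} (h : StackInv N c D b)
    (hy : y < N) (hne : b.arr c y ≠ 0) (h10 : b'.reg 10 = b.reg 10 + 1)
    (h8 : ∀ i, b'.arr 8 i = if i = b.reg 10 then y else b.arr 8 i)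
    (hc : ∀ i, b'.arr c i = if i = y then 0 else b.arr c i) : StackInv N c D b' := by
  have hz : zeros N c b' = insert y (zeros N c b) := by
    ext i
    rw [mem_insert, mem_zeros, mem_zeros, hc]
    by_cases hi : i = y
    · simp [hi, hy]
    · simp [hi]
  have hn : y ∉ zeros N c b := fun hm => hne (mem_zeros.1 hm).2
  constructor
  · rw [h10, image_range_push h8, hz, ← h.union, union_insert]
  · rw [h10, hz, card_insert_of_notMem hn, ← h.card, add_assoc]

/-- A node with nonzero counter is neither processed nor on the stack, so the stack has room for it.
-/
theorem StackInv.lt_of_ne {N c y : ℕ} {D : Finset ℕ} {b : ArrayState} (h : StackInv N c D b)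
    (hy : y < N) (hne : b.arr c y ≠ 0) : b.reg 10 < N := by
  have hn : y ∉ zeros N c b := fun hm => hne (mem_zeros.1 hm).2
  have : (insert y (zeros N c b)).card ≤ (range N).card :=
    card_le_card (insert_subset (mem_range.2 hy) (filter_subset _ _))
  rw [card_insert_of_notMem hn, ← h.card, card_range] at this
  omega

/-- Decrement the counter of the node in register `30`, and push it when the counter becomes
zero. -/
def decrementProg (c : ℕ) : ArrayProg :=
  .load 24 c 30 ;; .ite 24 (.sub 24 24 3 ;; .store c 30 24 ;;
    .ite 24 .skip (.store 8 10 30 ;; .add 10 10 3)) .skip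

/-- A node is pushed exactly when its counter changes from one to zero, and zero counters are left
alone. So no node is pushed twice, and the decrement agrees with truncated subtraction. -/
theorem pre_decrementProg {N c y : ℕ} {D : Finset ℕ} {b : ArrayState} (hc : c < 16) (hc8 : c ≠ 8)
    (hNS : N ≤ S) (hNW : N ≤ W) (h : StackInv N c D b) (h30 : b.reg 30 = y) (hy : y < N)
    (h3 : b.reg 3 = 1) :
    (decrementProg c).Pre W S (fun b' => StackInv N c D b' ∧
      ∀ z, b'.arr c z = if z = y then b.arr c z - 1 else b.arr c z) b := by
  have hyS : y < S := by omega
  simp only [decrementProg, ArrayProg.Pre, ArrayState.setReg_reg, ArrayState.setReg_arr,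
    ArrayState.setArr_reg, ArrayState.setArr_arr_self, h30, h3, hc, hyS, true_and,
    Nat.reduceEqDiff, if_true, if_false]
  refine ⟨fun hv => ⟨fun hv' => ⟨?_, ?_⟩, fun hv' => ⟨by omega, ?_, ?_, ?_, ?_⟩⟩, fun hv => ⟨?_, ?_⟩⟩
  · have hz : zeros N c (((b.setReg 24 (b.arr c y)).setReg 24 (b.arr c y - 1)).setArr c y
        (b.arr c y - 1)) = zeros N c b := by
      ext z
      rw [mem_zeros, mem_zeros, ArrayState.setArr_arr_self]
      by_cases hzy : z = y
      · simp [hzy, hv, hv']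
      · simp [hzy]
    refine ⟨?_, ?_⟩
    · rw [hz, ← h.union, ArrayState.setArr_arr_of_ne _ (Ne.symm hc8)]
      simp
    · rw [hz, ← h.card]
      simp
  · intro z
    split_ifs with hz
    · rw [hz]
    · rfl
  · exact (h.lt_of_ne hy hv).trans_le hNS
  · exact (h.lt_of_ne hy hv).trans_le hNW
  · refine h.push hy hv (by simp) (fun i => ?_) fun i => ?_
    · rw [ArrayState.setReg_arr, ArrayState.setArr_arr_self,
        ArrayState.setArr_arr_of_ne _ (Ne.symm hc8)]
      rfl
    · rw [ArrayState.setReg_arr, ArrayState.setArr_arr_of_ne _ hc8, ArrayState.setArr_arr_self, hv']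
      rfl
  · intro z
    rw [ArrayState.setArr_arr_of_ne _ hc8, ArrayState.setArr_arr_self]
    split_ifs with hz
    · rw [hz]
    · rfl
  · exact h.of_eq (by simp) rfl rfl
  · intro z
    split_ifs with hz
    · rw [hz, hv]
    · rfl

/-- The worklist algorithm for the counters in array `c`. The program `E` finds for the node in
register `20` and the letter in register `22` the target (register `30`) and whether there is an
edge (register `31`). -/
def worklistProg (c : ℕ) (E : ArrayProg) : ArrayProg :=
  .const 10 0 ;;
  .count 20 21 2 (.load 24 c 20 ;; .ite 24 .skip (.store 8 10 20 ;; .add 10 10 3)) ;;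
  .loop 10 (.sub 10 10 3 ;; .load 20 8 10 ;;
    .count 22 23 1 (E ;; .ite 31 (decrementProg c) .skip))

theorem halts_initStack {N c : ℕ} {a : ArrayState} (hc : c < 16) (hc8 : c ≠ 8) (hNS : N ≤ S)
    (hNW : N ≤ W) (h2 : a.reg 2 = N) (h3 : a.reg 3 = 1) (h10 : a.reg 10 = 0) :
    Halts W S
      (.count 20 21 2 (.load 24 c 20 ;; .ite 24 .skip (.store 8 10 20 ;; .add 10 10 3))) a
      (N * 7 + 3) (StackInv N c ∅) := by
  refine (Halts.count (T := 4) (fun j b => (∀ i, b.arr c i = a.arr c i) ∧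
      b.reg 10 = ((range j).filter fun y => a.arr c y = 0).card ∧
      (range (b.reg 10)).image (b.arr 8) = (range j).filter fun y => a.arr c y = 0)
    h2 h3 hNW (by decide) (by simp [ArrayProg.regs]) ?_ ?_ ?_).mono le_rfl ?_
  · rintro j b d ⟨h₁, h₂, h₃⟩ harr hreg
    have := hreg 10 (by decide) (by decide)
    rw [this, harr]
    exact ⟨h₁, h₂, h₃⟩
  · simp [h10]
  · rintro j hj b hreg - ⟨h₁, h₂, h₃⟩ hbj
    have hb3 : b.reg 3 = 1 := by
      rw [hreg 3 (by decide) (by decide) (by simp [ArrayProg.regs]), h3]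
    have hle : ((range j).filter fun y => a.arr c y = 0).card ≤ j :=
      (card_filter_le _ _).trans (card_range j).le
    have hjS : j < S := by omega
    refine (ArrayProg.Pre.halts ?_ : Halts W S _ b _ _)
    have hbS : b.reg 10 < S := by omega
    have hbW : b.reg 10 + 1 ≤ W := by omega
    simp only [ArrayProg.Pre, ArrayState.setReg_reg, ArrayState.setReg_arr, hbj, hb3, hc, hjS,
      ArrayState.setArr_reg, Nat.reduceEqDiff, if_true, if_false, true_and, h₁, hbS, hbW, Nat.reduceLT]
    rw [range_add_one, filter_insert]
    refine ⟨fun hne => ?_, fun he => ?_⟩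
    · rw [if_neg hne]
      exact ⟨fun _ => trivial, h₂, h₃⟩
    · rw [if_pos he, card_insert_of_notMem (by simp), ← h₂, ← h₃, ArrayState.setArr_arr_of_ne _ hc8]
      exact ⟨h₁, rfl, image_range_push fun i => ArrayState.setArr_arr_self _ _ _ _ _⟩
  · rintro b - ⟨h₁, h₂, h₃⟩
    have hz : zeros N c b = (range N).filter fun y => a.arr c y = 0 := by
      simp only [zeros, h₁]
    exact ⟨by rw [hz, h₃, empty_union], by rw [hz, ← h₂, card_empty, zero_add]⟩

/-- The cardinality clause excludes repetitions: were the top of the stack already processed,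
processed and stacked nodes would be too few to exhaust the zeros. -/
theorem StackInv.pop {N c : ℕ} {D : Finset ℕ} {b b' : ArrayState} (h : StackInv N c D b)
    (hne : b.reg 10 ≠ 0) (h10 : b'.reg 10 = b.reg 10 - 1) (harr : b'.arr = b.arr) :
    b.arr 8 (b.reg 10 - 1) ∉ D ∧ b.arr 8 (b.reg 10 - 1) ∈ zeros N c b ∧
      StackInv N c (insert (b.arr 8 (b.reg 10 - 1)) D) b' := by
  obtain ⟨s, hs⟩ : ∃ s, b.reg 10 = s + 1 := ⟨b.reg 10 - 1, by omega⟩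
  have hz : zeros N c b' = zeros N c b := by simp only [zeros, harr]
  have hu := h.union
  have hcard := h.card
  rw [hs] at hcard h10 ⊢
  rw [hs, range_add_one, image_insert, union_insert, ← insert_union] at hu
  rw [Nat.add_sub_cancel] at h10 ⊢
  have hn : b.arr 8 s ∉ D := by
    intro hm
    rw [insert_eq_of_mem hm] at hu
    have h₁ := card_union_le D ((range s).image (b.arr 8))
    have h₂ := card_image_le (s := range s) (f := b.arr 8)
    rw [card_range] at h₂
    rw [hu] at h₁
    omega
  refine ⟨hn, ?_, ?_, ?_⟩
  · rw [← hu]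
    exact mem_union_left _ (mem_insert_self _ _)
  · rw [h10, harr, hz, hu]
  · rw [h10, hz, ← hcard, card_insert_of_notMem hn]
    omega

/-- The zeros at the end are the least set closed under "enough incoming edges from the set". Every
node is processed at most once, each time at the cost of one pass over the letters. -/
theorem halts_worklistProg {N c T : ℕ} {E : ArrayProg} {a : ArrayState} {c₀ : ℕ → ℕ} (hc : c < 16)
    (hc8 : c ≠ 8) (hNS : N ≤ S) (hNW : N ≤ W) (hkW : k ≤ W) (h1 : a.reg 1 = k) (h2 : a.reg 2 = N)
    (h3 : a.reg 3 = 1) (h₀ : ∀ y < N, a.arr c y = c₀ y) (hreg : ∀ x ∈ E.regs, 30 ≤ x)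
    (harr : E.arrs = []) (htgt : ∀ x < N, ∀ j < k, tgt x j < N)
    (hE : ∀ b x j, (∀ r < 10, b.reg r = a.reg r) → (∀ i, i ≠ 8 → i ≠ c → b.arr i = a.arr i) →
      x < N → j < k → b.reg 20 = x → b.reg 22 = j →
      Halts W S E b T fun b' => b'.reg 30 = tgt x j ∧ (b'.reg 31 ≠ 0 ↔ e x j)) :
    Halts W S (worklistProg c E) a (N * (k * (T + 11) + 6) + (N * 7 + 5)) fun b =>
      ClosedUnder e tgt k N c₀ (zeros N c b) ∧ ∀ M, ClosedUnder e tgt k N c₀ M → zeros N c b ⊆ M := by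
  have hEreg : ∀ r < 30, r ∉ E.regs := fun r hr hm => by have := hreg r hm; omega
  have hregs : ∀ r < 30, r ≠ 24 → r ≠ 10 → r ∉
      (E ;; .ite 31 (decrementProg c) .skip).regs := by
    intro r hr h24 h10
    simp [ArrayProg.regs, decrementProg, hEreg r hr, h24, h10]
  have harrs : ∀ i, i ≠ 8 → i ≠ c → i ∉
      (E ;; .ite 31 (decrementProg c) .skip).arrs := by
    intro i h8 hic
    simp [ArrayProg.arrs, decrementProg, harr, h8, hic]
  have pre : Halts W S (.const 10 0) a 1 fun b => b = a.setReg 10 0 :=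
    ⟨1, _, le_rfl, .const a 10 0 (Nat.zero_le _), rfl⟩
  refine (pre.seq (T' := N * (k * (T + 11) + 6) + (N * 7 + 4)) ?_).mono (by omega) fun _ _ hb => hb
  rintro _ - rfl
  have init := halts_initStack (W := W) (S := S) (a := a.setReg 10 0) hc hc8 hNS hNW (by simpa using h2)
    (by simpa using h3) (by simp)
  refine (init.seq (T' := N * (k * (T + 11) + 6) + 1) ?_).mono (by omega) fun _ _ hb => hb
  rintro a₁ ⟨hfr₁, hfa₁⟩ hst₁
  have ha₁r : ∀ r < 10, a₁.reg r = a.reg r := by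
    intro r hr
    rw [hfr₁ r (by simp [ArrayProg.regs, ArrayProg.count]; omega), ArrayState.setReg_reg,
      if_neg (by omega)]
  have ha₁a : ∀ i, i ≠ 8 → a₁.arr i = a.arr i := by
    intro i hi
    rw [hfa₁ i (by simp [ArrayProg.arrs, ArrayProg.count, hi]), ArrayState.setReg_arr]
  -- D is the set of processed nodes, and m counts the unprocessed ones. Counters have been lowered
  -- by the edges from D, and all zeros lie in every closed set.
  refine (Halts.loop (T := k * (T + 11) + 5) (m := N) (fun m b => ∃ D, StackInv N c D b ∧
    D.card + m = N ∧ (∀ y < N, b.arr c y = c₀ y - inCount e tgt k D y) ∧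
    ∀ M, ClosedUnder e tgt k N c₀ M → zeros N c b ⊆ M) ?_ ?_).mono le_rfl ?_
  · refine ⟨∅, hst₁, by simp, fun y hy => ?_, fun M hM y hy => ?_⟩
    · rw [ha₁a c hc8, h₀ y hy]
      simp [inCount]
    · obtain ⟨hyN, hy0⟩ := mem_zeros.1 hy
      rw [ha₁a c hc8, h₀ y hyN] at hy0
      exact hM y hyN (by omega)
  · rintro m b ⟨hfr, hfa⟩ ⟨D, hst, hDm, hcnt, hleast⟩ hne
    have hbr : ∀ r < 10, b.reg r = a.reg r := by
      intro r hr
      rw [hfr r ?_, ha₁r r hr]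
      simp only [ArrayProg.regs, ArrayProg.count, List.mem_append, not_or, List.mem_singleton]
      have := hregs r (by omega) (by omega) (by omega)
      simp only [ArrayProg.regs, List.mem_append, not_or] at this
      refine ⟨by omega, by omega, by omega, by omega, this, by omega, by omega⟩
    have hba : ∀ i, i ≠ 8 → i ≠ c → b.arr i = a.arr i := by
      intro i h8 hic
      rw [hfa i ?_, ha₁a i h8]
      have := harrs i h8 hic
      simp only [ArrayProg.arrs, ArrayProg.count, List.mem_append, not_or, List.nil_append,
        List.append_nil] at this ⊢
      exact this
    have hlt : D.card < N := by
      have := card_zeros_le N c b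
      have := hst.card
      omega
    obtain ⟨m, rfl⟩ : ∃ m', m = m' + 1 := ⟨m - 1, by omega⟩
    refine ⟨m, rfl, ?_⟩
    have hb3 : b.reg 3 = 1 := by rw [hbr 3 (by omega), h3]
    have hb1 : b.reg 1 = k := by rw [hbr 1 (by omega), h1]
    set x := b.arr 8 (b.reg 10 - 1) with hx
    have hs10 : b.reg 10 - 1 < S := by
      have := card_zeros_le N c b
      have := hst.card
      omega
    have pop : Halts W S (.sub 10 10 3) b 1 fun b' => b' = b.setReg 10 (b.reg 10 - 1) := by
      refine ⟨1, _, le_rfl, .sub b 10 10 3, ?_⟩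
      rw [hb3]
    refine (pop.seq (T' := k * (T + 11) + 4) ?_).mono (by omega) fun _ _ hb => hb
    rintro _ - rfl
    have pop' : Halts W S (.load 20 8 10) (b.setReg 10 (b.reg 10 - 1)) 1
        fun b' => b' = (b.setReg 10 (b.reg 10 - 1)).setReg 20 x := by
      refine ⟨1, _, le_rfl, .load _ 20 8 10 (by omega) (by simpa using hs10), ?_⟩
      simp [hx]
    refine (pop'.seq (T' := k * (T + 11) + 3) ?_).mono (by omega) fun _ _ hb => hb
    rintro _ - rfl
    obtain ⟨hxD, hxz, hst'⟩ := hst.pop (b' := (b.setReg 10 (b.reg 10 - 1)).setReg 20 x) hne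
      (by simp) rfl
    rw [← hx] at hxD hxz hst'
    have hxN : x < N := (mem_zeros.1 hxz).1
    set b₁ := (b.setReg 10 (b.reg 10 - 1)).setReg 20 x with hb₁
    have hb₁r : ∀ r, r ≠ 10 → r ≠ 20 → b₁.reg r = b.reg r := by
      intro r hr hr'
      simp [hb₁, hr, hr']
    refine (Halts.count (T := T + 8) (m := k) (fun j d => StackInv N c (insert x D) d ∧
      (∀ y < N, d.arr c y = c₀ y - (inCount e tgt k D y + edgeCount e tgt j x y)) ∧
      ∀ M, ClosedUnder e tgt k N c₀ M → zeros N c d ⊆ M) (by rw [hb₁r 1 (by decide) (by decide), hb1])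
      (by rw [hb₁r 3 (by decide) (by decide), hb3]) hkW (by decide)
      ⟨hregs 22 (by decide) (by decide) (by decide), hregs 1 (by decide) (by decide) (by decide),
        hregs 3 (by decide) (by decide) (by decide)⟩ ?_ ?_ ?_).mono le_rfl ?_
    · rintro j d d' ⟨hd₁, hd₂, hd₃⟩ hda hdr
      refine ⟨hd₁.of_eq (hdr 10 (by decide) (by decide)) (by rw [hda]) (by rw [hda]),
        by rwa [hda], ?_⟩
      simp only [zeros, hda]
      exact hd₃
    · refine ⟨hst', fun y hy => ?_, hleast⟩
      rw [edgeCount, range_zero, sum_empty, add_zero]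
      exact hcnt y hy
    · rintro j hj d hdr hda ⟨hd₁, hd₂, hd₃⟩ hdj
      have hd20 : d.reg 20 = x := by
        rw [hdr 20 (by decide) (by decide) (hregs 20 (by decide) (by decide) (by decide))]
        simp [hb₁]
      have hdr' : ∀ r < 10, d.reg r = a.reg r := by
        intro r hr
        rw [hdr r (by omega) (by omega) (hregs r (by omega) (by omega) (by omega)),
          hb₁r r (by omega) (by omega), hbr r hr]
      have hstep := hE d x j hdr' (fun i h8 hic => by rw [hda i (harrs i h8 hic), ← hba i h8 hic]; rfl)
        hxN hj hd20 hdj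
      refine (hstep.seq (T' := 8) ?_).mono (by omega) fun _ _ hb => hb
      rintro d₁ ⟨hfr₂, hfa₂⟩ ⟨h30, h31⟩
      have hd₁a : d₁.arr = d.arr := by
        funext i
        exact hfa₂ i (by simp [harr])
      have hst₂ : StackInv N c (insert x D) d₁ :=
        hd₁.of_eq (hfr₂ 10 (hEreg 10 (by decide))) (by rw [hd₁a]) (by rw [hd₁a])
      have hd₁3 : d₁.reg 3 = 1 := by rw [hfr₂ 3 (hEreg 3 (by decide)), hdr' 3 (by decide), h3]
      have key : Halts W S (.ite 31 (decrementProg c) .skip) d₁ 8 fun d' =>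
          StackInv N c (insert x D) d' ∧
          ∀ y < N, d'.arr c y = c₀ y - (inCount e tgt k D y + edgeCount e tgt (j + 1) x y) := by
        refine ArrayProg.Pre.halts (P := .ite 31 (decrementProg c) .skip)
          ⟨fun h31' => ?_, fun h31' => ?_⟩
        · have he := h31.1 h31'
          refine (pre_decrementProg hc hc8 hNS hNW hst₂ h30 (htgt x hxN j hj) hd₁3).mono ?_
          rintro d' ⟨hd'₁, hd'₂⟩
          refine ⟨hd'₁, fun y hy => ?_⟩
          rw [hd'₂, hd₁a, hd₂ y hy, edgeCount_succ]
          by_cases hyt : y = tgt x j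
          · rw [if_pos hyt, if_pos ⟨he, hyt.symm⟩]
            omega
          · rw [if_neg hyt, if_neg fun h => hyt h.2.symm, add_zero]
        · have he : ¬ e x j := fun he => h31.2 he h31'
          refine ⟨hst₂, fun y hy => ?_⟩
          rw [hd₁a, hd₂ y hy, edgeCount_succ]
          simp [he]
      refine key.mono le_rfl ?_
      rintro d' - ⟨hd'₁, hd'₂⟩
      refine ⟨hd'₁, hd'₂, fun M hM y hy => ?_⟩
      obtain ⟨hyN, hy0⟩ := mem_zeros.1 hy
      rw [hd'₂ y hyN] at hy0
      -- A counter that has just become zero was lowered by edges from x and D only. These nodes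
      -- have zero counters and so lie in M, which then contains the new zero by closure.
      have hsub : insert x D ⊆ M := by
        refine subset_trans ?_ (hd₃ M hM)
        rw [← hd₁.union]
        exact subset_union_left
      refine hM y hyN ((Nat.sub_eq_zero_iff_le.1 hy0).trans (le_trans ?_ (inCount_mono hsub y)))
      rw [inCount, inCount, sum_insert hxD, add_comm]
      exact Nat.add_le_add_right (edgeCount_mono (by omega) x y) _
    · rintro d - ⟨hd₁, hd₂, hd₃⟩
      refine ⟨insert x D, hd₁, ?_, fun y hy => ?_, hd₃⟩
      · rw [card_insert_of_notMem hxD]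
        omega
      · rw [hd₂ y hy, inCount, inCount, sum_insert hxD, add_comm]
  · rintro b - ⟨h0, m, D, hst, -, hcnt, hleast⟩
    -- With an empty stack all zeros are processed, and the formula for the counters becomes the
    -- closure property.
    have : D = zeros N c b := by
      rw [← hst.union, h0]
      simp
    subst this
    refine ⟨fun y hy hle => mem_zeros.2 ⟨hy, ?_⟩, hleast⟩
    rw [hcnt y hy]
    omega

end Worklist

end LocalTestability

namespace LocalTestability

/-! ### The worklist algorithm on pairs of states -/

section Pairs

open Finset

variable {W S k n : ℕ}

/-- The number of a pair of states. -/
def code (u : Fin n × Fin n) : ℕ := u.1 * n + u.2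

/-- The pair of states with a given number. -/
def node (n : ℕ) [NeZero n] (x : ℕ) : Fin n × Fin n := (Fin.ofNat n (x / n), Fin.ofNat n x)

theorem code_lt (u : Fin n × Fin n) : code u < n * n := by
  have h₁ : (u.1 + 1 : ℕ) * n ≤ n * n := Nat.mul_le_mul_right n u.1.2
  have h₂ := u.2.2
  rw [add_mul, one_mul] at h₁
  rw [code]
  omega

theorem code_div (u : Fin n × Fin n) : code u / n = u.1 := by
  have hn : 0 < n := u.1.pos
  rw [code, mul_comm, Nat.mul_add_div hn, Nat.div_eq_of_lt u.2.2, add_zero]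

theorem code_mod (u : Fin n × Fin n) : code u % n = u.2 := by
  rw [code, mul_comm, Nat.mul_add_mod, Nat.mod_eq_of_lt u.2.2]

variable [NeZero n]

theorem node_code (u : Fin n × Fin n) : node n (code u) = u := by
  refine Prod.ext (Fin.ext ?_) (Fin.ext ?_)
  · rw [node, Fin.val_ofNat, code_div, Nat.mod_eq_of_lt u.1.2]
  · rw [node, Fin.val_ofNat, code_mod]

theorem code_node {x : ℕ} (hx : x < n * n) : code (node n x) = x := by
  have : x / n < n := Nat.div_lt_of_lt_mul hx
  rw [code, node, Fin.val_ofNat, Fin.val_ofNat, Nat.mod_eq_of_lt this, mul_comm, Nat.div_add_mod]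

theorem forall_lt_iff_code {P : ℕ → Prop} : (∀ x < n * n, P x) ↔ ∀ u : Fin n × Fin n, P (code u) :=
  ⟨fun h u => h _ (code_lt u), fun h x hx => code_node hx ▸ h (node n x)⟩

theorem code_injective : Function.Injective (code (n := n)) := fun u v h => by
  rw [← node_code u, h, node_code]

/-- The edges given by the letters `a` that satisfy `P u a`. -/
def EdgeRel (P : Fin n × Fin n → Fin k → Prop) (f : Fin n × Fin n → Fin k → Fin n × Fin n)
    (u v : Fin n × Fin n) : Prop :=
  ∃ a, P u a ∧ f u a = v

def natEdge (P : Fin n × Fin n → Fin k → Prop) (x j : ℕ) : Prop := ∃ h : j < k, P (node n x) ⟨j, h⟩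

def natTarget (f : Fin n × Fin n → Fin k → Fin n × Fin n) (x j : ℕ) : ℕ :=
  if h : j < k then code (f (node n x) ⟨j, h⟩) else 0

variable {P : Fin n × Fin n → Fin k → Prop} {f : Fin n × Fin n → Fin k → Fin n × Fin n}

theorem edgeCount_pos_iff {u v : Fin n × Fin n} :
    0 < edgeCount (natEdge P) (natTarget f) k (code u) (code v) ↔ EdgeRel P f u v := by
  rw [edgeCount, Finset.sum_pos_iff]
  constructor
  · rintro ⟨j, hj, h⟩
    have hjk : j < k := mem_range.1 hj
    split_ifs at h with hc
    · obtain ⟨⟨_, hP⟩, ht⟩ := hc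
      rw [node_code] at hP
      rw [natTarget, dif_pos hjk, node_code] at ht
      exact ⟨⟨j, hjk⟩, hP, code_injective ht⟩
    · omega
  · rintro ⟨a, hP, rfl⟩
    refine ⟨a, mem_range.2 a.2, ?_⟩
    rw [if_pos]
    · omega
    · exact ⟨⟨a.2, by rwa [node_code]⟩, by rw [natTarget, dif_pos a.2, node_code]⟩

theorem inCount_pos_iff {D : Finset ℕ} {u : Fin n × Fin n} (hD : ∀ x ∈ D, x < n * n) :
    0 < inCount (natEdge P) (natTarget f) k D (code u) ↔
      ∃ v, code v ∈ D ∧ EdgeRel P f v u := by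
  rw [inCount, Finset.sum_pos_iff]
  constructor
  · rintro ⟨x, hx, h⟩
    have hxn := code_node (hD x hx)
    rw [← hxn] at hx h
    exact ⟨_, hx, edgeCount_pos_iff.1 h⟩
  · rintro ⟨v, hv, h⟩
    exact ⟨_, hv, edgeCount_pos_iff.2 h⟩

/-- The two counts differ by the edges from outside D, so the inequality holds exactly if there are
none. -/
theorem inCount_range_le_iff {D : Finset ℕ} {u : Fin n × Fin n} (hD : D ⊆ range (n * n)) :
    inCount (natEdge P) (natTarget f) k (range (n * n)) (code u) ≤
      inCount (natEdge P) (natTarget f) k D (code u) ↔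
      ∀ v, EdgeRel P f v u → code v ∈ D := by
  have hs := sum_sdiff (f := fun x => edgeCount (natEdge P) (natTarget f) k x (code u)) hD
  have hpos := inCount_pos_iff (P := P) (f := f) (D := range (n * n) \ D) (u := u)
    fun x hx => mem_range.1 (mem_sdiff.1 hx).1
  have key : inCount (natEdge P) (natTarget f) k (range (n * n)) (code u) ≤
      inCount (natEdge P) (natTarget f) k D (code u) ↔
      ¬ 0 < inCount (natEdge P) (natTarget f) k (range (n * n) \ D) (code u) := by
    unfold inCount
    omega
  rw [key, hpos]
  push Not
  refine forall_congr' fun v => ?_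
  rw [mem_sdiff, mem_range]
  have := code_lt v
  tauto

/-- With counter 0 at the sources and 1 elsewhere, one incoming edge suffices to enter a closed set.
The least closed set is therefore the set of reachable nodes. -/
theorem closedUnder_search {c₀ : ℕ → ℕ} {s : Fin n × Fin n → Prop}
    (h₀ : ∀ u, (s u ∧ c₀ (code u) = 0) ∨ (¬ s u ∧ c₀ (code u) = 1)) {Z : Finset ℕ}
    (hZ : Z ⊆ range (n * n)) (hc : ClosedUnder (natEdge P) (natTarget f) k (n * n) c₀ Z)
    (hl : ∀ M, ClosedUnder (natEdge P) (natTarget f) k (n * n) c₀ M → Z ⊆ M) (u : Fin n × Fin n) :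
    code u ∈ Z ↔ ∃ v, s v ∧ Relation.ReflTransGen (EdgeRel P f) v u := by
  classical
  constructor
  · intro hu
    have := hl ((range (n * n)).filter fun x =>
        ∃ v, s v ∧ Relation.ReflTransGen (EdgeRel P f) v (node n x)) ?_ hu
    · simpa [node_code] using (mem_filter.1 this).2
    · refine forall_lt_iff_code.2 fun w hw => ?_
      rw [mem_filter, mem_range, node_code]
      refine ⟨code_lt w, ?_⟩
      rcases h₀ w with h | h
      · exact ⟨w, h.1, .refl⟩
      · rw [h.2, Nat.succ_le_iff, inCount_pos_iff
          fun x hx => mem_range.1 (mem_filter.1 hx).1] at hw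
        obtain ⟨w', hw', hr⟩ := hw
        obtain ⟨v, hv, hvw⟩ := (mem_filter.1 hw').2
        rw [node_code] at hvw
        exact ⟨v, hv, hvw.tail hr⟩
  · rintro ⟨v, hv, h⟩
    induction h with
    | refl =>
      refine hc _ (code_lt v) ?_
      rcases h₀ v with h | h
      · omega
      · exact absurd hv h.1
    | @tail b c _ hbc ih =>
      refine hc _ (code_lt c) ?_
      have := (inCount_pos_iff (P := P) (f := f) (D := Z) fun x hx => mem_range.1 (hZ hx)).2
        ⟨b, ih, hbc⟩
      rcases h₀ c with h | h <;> omega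

/-- With the in-degree as counter, a node enters once all its predecessors have entered. The least
such set is the accessible part, as in topological sorting. -/
theorem closedUnder_trim {Z : Finset ℕ} (hZ : Z ⊆ range (n * n))
    (hc : ClosedUnder (natEdge P) (natTarget f) k (n * n)
      (inCount (natEdge P) (natTarget f) k (range (n * n))) Z)
    (hl : ∀ M, ClosedUnder (natEdge P) (natTarget f) k (n * n)
      (inCount (natEdge P) (natTarget f) k (range (n * n))) M → Z ⊆ M) (u : Fin n × Fin n) :
    code u ∈ Z ↔ Acc (EdgeRel P f) u := by
  classical
  constructor
  · intro hu
    have := hl ((range (n * n)).filter fun x => Acc (EdgeRel P f) (node n x)) ?_ hu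
    · simpa [node_code] using (mem_filter.1 this).2
    · refine forall_lt_iff_code.2 fun w hw => ?_
      rw [inCount_range_le_iff (filter_subset _ _)] at hw
      rw [mem_filter, mem_range, node_code]
      refine ⟨code_lt w, Acc.intro w fun v hv => ?_⟩
      simpa [node_code] using (mem_filter.1 (hw v hv)).2
  · intro h
    induction h with
    | intro w _ ih => exact hc _ (code_lt w) ((inCount_range_le_iff hZ).2 ih)

/-- The program `E` finds for the pair in register `20` and the letter in register `22` the
target (register `30`) and whether there is an edge (register `31`), as long as the registers below
`10` and the arrays outside `X` are as in `a`. -/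
structure EdgeSpec (W S : ℕ) (E : ArrayProg) (a : ArrayState) (X : Set ℕ)
    (P : Fin n × Fin n → Fin k → Prop) (f : Fin n × Fin n → Fin k → Fin n × Fin n) (T : ℕ) :
    Prop where
  regs : ∀ x ∈ E.regs, 30 ≤ x
  arrs : E.arrs = []
  halts : ∀ (b : ArrayState) (u : Fin n × Fin n) (j : Fin k), (∀ r < 10, b.reg r = a.reg r) →
    (∀ i ∉ X, b.arr i = a.arr i) → b.reg 20 = code u → b.reg 22 = j →
    Halts W S E b T fun b' => b'.reg 30 = code (f u j) ∧ (b'.reg 31 ≠ 0 ↔ P u j)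

variable {c T : ℕ} {E : ArrayProg} {a : ArrayState}

theorem EdgeSpec.worklist {c₀ : ℕ → ℕ} (hE : EdgeSpec W S E a {8, c} P f T) (hc : c < 16)
    (hc8 : c ≠ 8) (hS : n * n ≤ S) (hW : n * n ≤ W) (hkW : k ≤ W) (h1 : a.reg 1 = k)
    (h2 : a.reg 2 = n * n) (h3 : a.reg 3 = 1) (h₀ : ∀ y < n * n, a.arr c y = c₀ y) :
    Halts W S (worklistProg c E) a (n * n * (k * (T + 11) + 6) + (n * n * 7 + 5)) fun b =>
      ClosedUnder (natEdge P) (natTarget f) k (n * n) c₀ (zeros (n * n) c b) ∧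
      ∀ M, ClosedUnder (natEdge P) (natTarget f) k (n * n) c₀ M → zeros (n * n) c b ⊆ M := by
  refine halts_worklistProg hc hc8 hS hW hkW h1 h2 h3 h₀ hE.regs hE.arrs ?_ ?_
  · intro x _ j hj
    rw [natTarget, dif_pos hj]
    exact code_lt _
  · intro b x j hr ha hx hj h20 h22
    refine (hE.halts b (node n x) ⟨j, hj⟩ hr (fun i hi => ha i ?_ ?_) ?_ h22).mono le_rfl ?_
    · rintro rfl
      exact hi (by simp)
    · rintro rfl
      exact hi (by simp)
    · rw [h20, code_node hx]
    · rintro b' - ⟨h30, h31⟩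
      refine ⟨by rw [h30, natTarget, dif_pos hj], h31.trans ⟨fun h => ⟨hj, h⟩, fun h => h.2⟩⟩

omit [NeZero n] in
theorem code_mem_zeros {b : ArrayState} {u : Fin n × Fin n} :
    code u ∈ zeros (n * n) c b ↔ b.arr c (code u) = 0 := by
  rw [mem_zeros, and_iff_right (code_lt u)]

theorem EdgeSpec.search {s : Fin n × Fin n → Prop} (hE : EdgeSpec W S E a {8, c} P f T)
    (hc : c < 16) (hc8 : c ≠ 8) (hS : n * n ≤ S) (hW : n * n ≤ W) (hkW : k ≤ W) (h1 : a.reg 1 = k)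
    (h2 : a.reg 2 = n * n) (h3 : a.reg 3 = 1)
    (h₀ : ∀ u, (s u ∧ a.arr c (code u) = 0) ∨ (¬ s u ∧ a.arr c (code u) = 1)) :
    Halts W S (worklistProg c E) a (n * n * (k * (T + 11) + 6) + (n * n * 7 + 5)) fun b =>
      ∀ u, b.arr c (code u) = 0 ↔ ∃ v, s v ∧ Relation.ReflTransGen (EdgeRel P f) v u := by
  refine (hE.worklist hc hc8 hS hW hkW h1 h2 h3 fun y _ => rfl).mono le_rfl ?_
  rintro b - ⟨hb, hl⟩ u
  rw [← code_mem_zeros]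
  exact closedUnder_search h₀ (filter_subset _ _) hb hl u

theorem EdgeSpec.trim (hE : EdgeSpec W S E a {8, c} P f T)
    (hc : c < 16) (hc8 : c ≠ 8) (hS : n * n ≤ S) (hW : n * n ≤ W) (hkW : k ≤ W) (h1 : a.reg 1 = k)
    (h2 : a.reg 2 = n * n) (h3 : a.reg 3 = 1)
    (h₀ : ∀ y < n * n, a.arr c y = inCount (natEdge P) (natTarget f) k (range (n * n)) y) :
    Halts W S (worklistProg c E) a (n * n * (k * (T + 11) + 6) + (n * n * 7 + 5)) fun b =>
      ∀ u, b.arr c (code u) = 0 ↔ Acc (EdgeRel P f) u := by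
  refine (hE.worklist hc hc8 hS hW hkW h1 h2 h3 h₀).mono le_rfl ?_
  rintro b - ⟨hb, hl⟩ u
  rw [← code_mem_zeros]
  exact closedUnder_trim (filter_subset _ _) hb hl u

end Pairs

end LocalTestability

namespace LocalTestability

/-! ### Programs that compute single edges from tables, in constant time -/

section EdgePrograms

open Finset

variable {W S k n : ℕ}

/-- The sizes of arrays and words suffice for an automaton with `n` states and `k` letters. -/
structure Bounds (W S k n : ℕ) : Prop where
  sq_le : n * n ≤ S
  mul_le : n * k ≤ S
  le_left : k ≤ S
  le_right : n ≤ S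
  pos : 0 < S
  le_word : 16 * S ≤ W

/-- The tables of the automaton `A`: its transitions (array `0`), the multiples of `k` and `n`
(arrays `4` and `5`) and the coordinates of pairs of states (arrays `6` and `7`). -/
structure Tables (A : DFA (Fin k) (Fin n)) (a : ArrayState) : Prop where
  reg0 : a.reg 0 = n
  reg1 : a.reg 1 = k
  reg2 : a.reg 2 = n * n
  reg3 : a.reg 3 = 1
  step : ∀ (p : Fin n) (j : Fin k), a.arr 0 (p * k + j) = A.step p j
  mulK : ∀ p : Fin n, a.arr 4 p = p * k
  mulN : ∀ p : Fin n, a.arr 5 p = p * n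
  fst : ∀ u : Fin n × Fin n, a.arr 6 (code u) = u.1
  snd : ∀ u : Fin n × Fin n, a.arr 7 (code u) = u.2

variable {A : DFA (Fin k) (Fin n)} {a b : ArrayState}

theorem Tables.of_eq (h : Tables A a) (hr : ∀ r < 4, b.reg r = a.reg r)
    (ha : ∀ i ∈ [0, 4, 5, 6, 7], b.arr i = a.arr i) : Tables A b where
  reg0 := by rw [hr 0 (by decide), h.reg0]
  reg1 := by rw [hr 1 (by decide), h.reg1]
  reg2 := by rw [hr 2 (by decide), h.reg2]
  reg3 := by rw [hr 3 (by decide), h.reg3]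
  step := by rw [ha 0 (by decide)]; exact h.step
  mulK := by rw [ha 4 (by decide)]; exact h.mulK
  mulN := by rw [ha 5 (by decide)]; exact h.mulN
  fst := by rw [ha 6 (by decide)]; exact h.fst
  snd := by rw [ha 7 (by decide)]; exact h.snd

theorem isBit_iff {P : Prop} {m : ℕ} : IsBit P m ↔ (m = 0 ∨ m = 1) ∧ (m ≠ 0 ↔ P) := by
  unfold IsBit
  by_cases hP : P
  · simp only [hP, true_and, not_true, false_and, or_false, iff_true]
    omega
  · simp only [hP, false_and, not_false_eq_true, true_and, false_or, iff_false]
    omega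

theorem IsBit.ne_zero_iff {P : Prop} {m : ℕ} (h : IsBit P m) : m ≠ 0 ↔ P := (isBit_iff.1 h).2

theorem IsBit.congr {P P' : Prop} {m : ℕ} (h : IsBit P m) (hP : P ↔ P') : IsBit P' m := by
  rwa [IsBit, ← hP]

theorem index_lt (hB : Bounds W S k n) (p : Fin n) (j : Fin k) : (p : ℕ) * k + j < S := by
  have h₁ : (p + 1 : ℕ) * k ≤ n * k := Nat.mul_le_mul_right k p.2
  rw [add_mul, one_mul] at h₁
  have := hB.mul_le
  have := j.2
  omega

/-- For the pair in register `20` and the letter in register `22`, put the two states into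
registers `32` and `33` and their successors into registers `34` and `35`. -/
def decodeProg : ArrayProg :=
  .load 32 6 20 ;; .load 33 7 20 ;; .load 34 4 32 ;; .add 34 34 22 ;; .load 34 0 34 ;;
    .load 35 4 33 ;; .add 35 35 22 ;; .load 35 0 35

theorem halts_decodeProg (hB : Bounds W S k n) (h : Tables A b) {u : Fin n × Fin n} {j : Fin k}
    (h20 : b.reg 20 = code u) (h22 : b.reg 22 = j) :
    Halts W S decodeProg b 8 fun b' => b'.reg 32 = u.1 ∧ b'.reg 33 = u.2 ∧
      b'.reg 34 = A.step u.1 j ∧ b'.reg 35 = A.step u.2 j := by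
  refine ArrayProg.Pre.halts (P := decodeProg) ?_
  have h₁ := (code_lt u).trans_le hB.sq_le
  have h₂ := u.1.2.trans_le hB.le_right
  have h₃ := u.2.2.trans_le hB.le_right
  have h₄ := index_lt hB u.1 j
  have h₅ := index_lt hB u.2 j
  have h₆ := hB.le_word
  simp only [decodeProg, ArrayProg.Pre, ArrayState.setReg_reg, ArrayState.setReg_arr, h20, h22,
    h.fst, h.snd, h.mulK, h.step, Nat.reduceEqDiff, if_true, if_false, true_and, Nat.reduceLT, h₁,
    h₂, h₃, h₄, h₅, and_true]
  omega

/-- Put the number of the pair of states in registers `y` and `z` into register `30`. -/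
def pairProg (y z : ℕ) : ArrayProg := .load 30 5 y ;; .add 30 30 z

theorem halts_pairProg (hB : Bounds W S k n) (h : Tables A b) {y z : ℕ} (u : Fin n × Fin n)
    (hz : z ≠ 30) (hy : b.reg y = u.1) (hz' : b.reg z = u.2) :
    Halts W S (pairProg y z) b 2 fun b' => b'.reg 30 = code u := by
  refine ArrayProg.Pre.halts (P := pairProg y z) ?_
  have h₁ := (code_lt u).trans_le hB.sq_le
  have h₂ := u.1.2.trans_le hB.le_right
  have h₆ := hB.le_word
  rw [code] at h₁ ⊢
  simp only [pairProg, ArrayProg.Pre, ArrayState.setReg_reg, hy, hz, hz', h.mulN, if_true,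
    if_false, true_and, Nat.reduceLT, h₂, and_true]
  omega

/-- Put the truth value of `p ⪰ q`, for the states `p`, `q` in registers `y` and `z`, into
register `d`. -/
def reachProg (d y z : ℕ) : ArrayProg := .load d 5 y ;; .add d d z ;; .load d 1 d

/-- Array `1` holds the reachability table of `A`. -/
def ReachTable (A : DFA (Fin k) (Fin n)) (a : ArrayState) : Prop :=
  ∀ u : Fin n × Fin n, IsBit (Reach A u.1 u.2) (a.arr 1 (code u))

theorem halts_reachProg (hB : Bounds W S k n) (h : Tables A b) (hR : ReachTable A b) {d y z : ℕ}
    {p q : Fin n} (hz : z ≠ d) (hy : b.reg y = p) (hz' : b.reg z = q) :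
    Halts W S (reachProg d y z) b 3 fun b' => IsBit (Reach A p q) (b'.reg d) := by
  refine ArrayProg.Pre.halts (P := reachProg d y z) ?_
  have h₁ := (code_lt (p, q)).trans_le hB.sq_le
  have h₂ := p.2.trans_le hB.le_right
  have h₃ := hR (p, q)
  have h₆ := hB.le_word
  rw [code] at h₁ h₃
  dsimp only at h₁ h₃
  simp only [reachProg, ArrayProg.Pre, ArrayState.setReg_reg, ArrayState.setReg_arr, hy, hz, hz',
    h.mulN, if_true, if_false, true_and, Nat.reduceLT, h₁, h₂, h₃, and_true]
  omega

theorem Tables.frame (h : Tables A a) {P : ArrayProg} (hf : P.Frame a b)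
    (hr : ∀ r < 4, r ∉ P.regs) (ha : ∀ i ∈ [0, 4, 5, 6, 7], i ∉ P.arrs) : Tables A b :=
  h.of_eq (fun r hr' => hf.1 r (hr r hr')) fun i hi => hf.2 i (ha i hi)

theorem ReachTable.frame (h : ReachTable A a) {P : ArrayProg} (hf : P.Frame a b)
    (ha : 1 ∉ P.arrs) : ReachTable A b := by
  rw [ReachTable, hf.2 1 ha]
  exact h

/-- The edges `(p, q) → (p, qa)`. -/
def reachEdgeProg : ArrayProg := decodeProg ;; pairProg 32 35 ;; .const 31 1

theorem edgeSpec_reach (hB : Bounds W S k n) (h : Tables A a) {X : Set ℕ}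
    (hX : ∀ i ∈ [0, 4, 5, 6, 7], i ∉ X) :
    EdgeSpec W S reachEdgeProg a X (fun (_ : Fin n × Fin n) (_ : Fin k) => True)
      (fun u j => (u.1, A.step u.2 j)) 16 where
  regs := by decide
  arrs := by decide
  halts b u j hr ha h20 h22 := by
    have hb : Tables A b := h.of_eq (fun r hr' => hr r (by omega)) fun i hi => ha i (hX i hi)
    refine ((halts_decodeProg hB hb h20 h22).seq (T' := 3) ?_).mono (by decide) fun _ _ h => h
    rintro b₁ hf ⟨h32, h33, h34, h35⟩
    have hb₁ : Tables A b₁ := hb.frame hf (by decide) (by decide)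
    refine (halts_pairProg hB hb₁ (u.1, A.step u.2 j) (by decide) h32 h35).seq (T' := 1) ?_
    rintro b₂ - h30
    refine ⟨1, _, le_rfl, .const b₂ 31 1 (by have := hB.pos; have := hB.le_word; omega), ?_, ?_⟩
    · simpa using h30
    · simp

/-- Find the target of an edge of `Γ²` and two truth values of the reachability table. -/
def pairEdgeProg (y z y' z' : ℕ) : ArrayProg :=
  decodeProg ;; pairProg 34 35 ;; reachProg 36 y z ;; reachProg 37 y' z'

theorem halts_pairEdgeProg (hB : Bounds W S k n) (h : Tables A b) (hR : ReachTable A b)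
    {u : Fin n × Fin n} {j : Fin k} (h20 : b.reg 20 = code u) (h22 : b.reg 22 = j) {y z y' z' : ℕ}
    {p q p' q' : Fin n} (hy : y ∈ Set.Icc 32 35) (hz : z ∈ Set.Icc 32 35) (hy' : y' ∈ Set.Icc 32 35)
    (hz' : z' ∈ Set.Icc 32 35)
    (hsel : ∀ b' : ArrayState, b'.reg 32 = u.1 → b'.reg 33 = u.2 → b'.reg 34 = A.step u.1 j →
      b'.reg 35 = A.step u.2 j → b'.reg y = p ∧ b'.reg z = q ∧ b'.reg y' = p' ∧ b'.reg z' = q') :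
    Halts W S (pairEdgeProg y z y' z') b 16 fun b' =>
      b'.reg 30 = code (A.step u.1 j, A.step u.2 j) ∧
      b'.reg 34 = A.step u.1 j ∧ b'.reg 35 = A.step u.2 j ∧
      IsBit (Reach A p q) (b'.reg 36) ∧ IsBit (Reach A p' q') (b'.reg 37) := by
  rw [Set.mem_Icc] at hy hz hy' hz'
  refine (halts_decodeProg hB h h20 h22).seq (T' := 2 + (3 + 3)) ?_
  rintro b₁ hf ⟨h32, h33, h34, h35⟩
  obtain ⟨e₁, e₂, e₃, e₄⟩ := hsel b₁ h32 h33 h34 h35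
  have hb₁ : Tables A b₁ := h.frame hf (by decide) (by decide)
  have hR₁ : ReachTable A b₁ := hR.frame hf (by decide)
  refine (halts_pairProg hB hb₁ (A.step u.1 j, A.step u.2 j) (by decide) h34 h35).seq ?_
  intro b₂ hf₂ h30
  have hb₂ : Tables A b₂ := hb₁.frame hf₂ (by decide) (by decide)
  have hR₂ : ReachTable A b₂ := hR₁.frame hf₂ (by decide)
  have hr₂ : ∀ r, 32 ≤ r → b₂.reg r = b₁.reg r := fun r hr =>
    hf₂.1 r (by simp [pairProg, ArrayProg.regs]; omega)
  refine (halts_reachProg hB hb₂ hR₂ (d := 36) (p := p) (q := q) (by omega)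
    (by rw [hr₂ y (by omega), e₁]) (by rw [hr₂ z (by omega), e₂])).seq ?_
  intro b₃ hf₃ h36
  have hr₃ : ∀ r, r ≠ 36 → b₃.reg r = b₂.reg r := fun r hr =>
    hf₃.1 r (by simpa [reachProg, ArrayProg.regs] using hr)
  have hb₃ : Tables A b₃ := hb₂.frame hf₃
    (fun r hr => by simp [reachProg, ArrayProg.regs]; omega) (by simp [reachProg, ArrayProg.arrs])
  have hR₃ : ReachTable A b₃ := hR₂.frame hf₃ (by simp [reachProg, ArrayProg.arrs])
  refine (halts_reachProg hB hb₃ hR₃ (d := 37) (p := p') (q := q') (by omega)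
    (by rw [hr₃ y' (by omega), hr₂ y' (by omega), e₃])
    (by rw [hr₃ z' (by omega), hr₂ z' (by omega), e₄])).mono le_rfl ?_
  intro b₄ hf₄ h37
  have hr₄ : ∀ r, r ≠ 37 → b₄.reg r = b₃.reg r := fun r hr =>
    hf₄.1 r (by simpa [reachProg, ArrayProg.regs] using hr)
  refine ⟨?_, ?_, ?_, ?_, h37⟩
  · rw [hr₄ 30 (by decide), hr₃ 30 (by decide), h30]
  · rw [hr₄ 34 (by decide), hr₃ 34 (by decide), hr₂ 34 (by decide), h34]
  · rw [hr₄ 35 (by decide), hr₃ 35 (by decide), hr₂ 35 (by decide), h35]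
  · rwa [hr₄ 36 (by decide)]

/-- The edges of `Γ²` that stay in the strong components of both coordinates and do not end on the
diagonal. -/
def trimEdgeProg : ArrayProg :=
  pairEdgeProg 34 32 35 33 ;; .sub 38 34 35 ;; .sub 39 35 34 ;; .add 38 38 39 ;; .const 31 0 ;;
    .ite 36 (.ite 37 (.ite 38 (.const 31 1) .skip) .skip) .skip

theorem edgeSpec_trim (hB : Bounds W S k n) (h : Tables A a) (hR : ReachTable A a) {X : Set ℕ}
    (hX : ∀ i ∈ [0, 1, 4, 5, 6, 7], i ∉ X) :
    EdgeSpec W S trimEdgeProg a X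
      (fun (u : Fin n × Fin n) (j : Fin k) => Reach A (A.step u.1 j) u.1 ∧
        Reach A (A.step u.2 j) u.2 ∧ A.step u.1 j ≠ A.step u.2 j)
      (fun u j => (A.step u.1 j, A.step u.2 j)) 24 where
  regs := by decide
  arrs := by decide
  halts b u j hr ha h20 h22 := by
    have hb : Tables A b := h.of_eq (fun r hr' => hr r (by omega)) fun i hi => ha i (hX i (by
      revert i; decide))
    have hRb : ReachTable A b := by
      rw [ReachTable, ha 1 (hX 1 (by decide))]
      exact hR
    refine (halts_pairEdgeProg hB hb hRb h20 h22 (p := A.step u.1 j) (q := u.1) (p' := A.step u.2 j)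
      (q' := u.2) (by simp) (by simp) (by simp) (by simp)
      fun b' h₁ h₂ h₃ h₄ => ⟨h₃, h₁, h₄, h₂⟩).seq (T' := 8) ?_
    rintro b₁ - ⟨h30, h34, h35, h36, h37⟩
    refine ArrayProg.Pre.halts (P := .sub 38 34 35 ;; .sub 39 35 34 ;; .add 38 38 39 ;; .const 31 0 ;;
      .ite 36 (.ite 37 (.ite 38 (.const 31 1) .skip) .skip) .skip) ?_
    have h₁ := (A.step u.1 j).2.trans_le hB.le_right
    have h₂ := (A.step u.2 j).2.trans_le hB.le_right
    have h₃ := hB.le_word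
    -- Subtraction is truncated, so the sum of both differences vanishes exactly if the numbers are
    -- equal.
    have hne : (A.step u.1 j : ℕ) - A.step u.2 j + (A.step u.2 j - A.step u.1 j) = 0 ↔
        A.step u.1 j = A.step u.2 j := by
      rw [Fin.ext_iff]
      omega
    simp only [ArrayProg.Pre, ArrayState.setReg_reg, Nat.reduceEqDiff, if_true, if_false, h34, h35,
      h30, h36.ne_zero_iff, h37.ne_zero_iff, hne, ne_eq, true_and, Nat.zero_le, not_true,
      not_false_eq_true, true_iff, false_iff]
    have h36' : b₁.reg 36 = 0 ↔ ¬ Reach A (A.step u.1 j) u.1 := by rw [← h36.ne_zero_iff]; omega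
    have h37' : b₁.reg 37 = 0 ↔ ¬ Reach A (A.step u.2 j) u.2 := by rw [← h37.ne_zero_iff]; omega
    rw [h36', h37']
    refine ⟨by omega, fun h₄ => ⟨fun h₅ => ⟨fun h₆ => ⟨by omega, ?_⟩, fun h₆ => ?_⟩, fun h₅ => ?_⟩,
      fun h₄ => ?_⟩
    all_goals tauto

/-- The edges of `Γ²` that the test keeps. -/
def keptEdgeProg : ArrayProg := pairEdgeProg 35 33 35 32 ;; .add 31 36 37

theorem edgeSpec_kept (hB : Bounds W S k n) (h : Tables A a) (hR : ReachTable A a) {X : Set ℕ}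
    (hX : ∀ i ∈ [0, 1, 4, 5, 6, 7], i ∉ X) :
    EdgeSpec W S keptEdgeProg a X
      (fun (u : Fin n × Fin n) (j : Fin k) => Reach A (A.step u.2 j) u.2 ∨ Reach A (A.step u.2 j) u.1)
      (fun u j => (A.step u.1 j, A.step u.2 j)) 24 where
  regs := by decide
  arrs := by decide
  halts b u j hr ha h20 h22 := by
    have hb : Tables A b := h.of_eq (fun r hr' => hr r (by omega)) fun i hi => ha i (hX i (by
      revert i; decide))
    have hRb : ReachTable A b := by
      rw [ReachTable, ha 1 (hX 1 (by decide))]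
      exact hR
    refine ((halts_pairEdgeProg hB hb hRb h20 h22 (p := A.step u.2 j) (q := u.2) (p' := A.step u.2 j)
      (q' := u.1) (by simp) (by simp) (by simp) (by simp)
      fun b' h₁ h₂ h₃ h₄ => ⟨h₄, h₂, h₄, h₁⟩).seq (T' := 1) ?_).mono (by decide) fun _ _ h => h
    rintro b₁ - ⟨h30, h34, h35, h36, h37⟩
    have h₁ := (isBit_iff.1 h36).1
    have h₂ := (isBit_iff.1 h37).1
    have h₃ := hB.le_word
    have h₄ := hB.pos
    refine ⟨1, _, le_rfl, .add b₁ 31 36 37 (by omega), by simpa using h30, ?_⟩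
    rw [ArrayState.setReg_reg, if_pos rfl, ← h36.ne_zero_iff, ← h37.ne_zero_iff]
    omega

/-- The letters on account of which a pair of states is marked. -/
def markEdgeProg : ArrayProg :=
  pairEdgeProg 34 33 35 33 ;; .sub 38 36 37 ;; .sub 39 37 36 ;; .add 31 38 39

theorem edgeSpec_mark (hB : Bounds W S k n) (h : Tables A a) (hR : ReachTable A a) {X : Set ℕ}
    (hX : ∀ i ∈ [0, 1, 4, 5, 6, 7], i ∉ X) :
    EdgeSpec W S markEdgeProg a X
      (fun (u : Fin n × Fin n) (j : Fin k) =>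
        Xor (Reach A (A.step u.1 j) u.2) (Reach A (A.step u.2 j) u.2))
      (fun u j => (A.step u.1 j, A.step u.2 j)) 24 where
  regs := by decide
  arrs := by decide
  halts b u j hr ha h20 h22 := by
    have hb : Tables A b := h.of_eq (fun r hr' => hr r (by omega)) fun i hi => ha i (hX i (by
      revert i; decide))
    have hRb : ReachTable A b := by
      rw [ReachTable, ha 1 (hX 1 (by decide))]
      exact hR
    refine ((halts_pairEdgeProg hB hb hRb h20 h22 (p := A.step u.1 j) (q := u.2) (p' := A.step u.2 j)
      (q' := u.2) (by simp) (by simp) (by simp) (by simp)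
      fun b' h₁ h₂ h₃ h₄ => ⟨h₃, h₂, h₄, h₂⟩).seq (T' := 3) ?_).mono (by decide) fun _ _ h => h
    rintro b₁ - ⟨h30, h34, h35, h36, h37⟩
    refine ArrayProg.Pre.halts (P := .sub 38 36 37 ;; .sub 39 37 36 ;; .add 31 38 39) ?_
    have h₁ := (isBit_iff.1 h36).1
    have h₂ := (isBit_iff.1 h37).1
    have h₃ := hB.le_word
    have h₄ := hB.pos
    simp only [ArrayProg.Pre, ArrayState.setReg_reg, Nat.reduceEqDiff, if_true, if_false, h30,
      true_and]
    refine ⟨by omega, ?_⟩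
    -- The sum of the two truncated differences of two bits is their exclusive or.
    rw [Xor, ← h36.ne_zero_iff, ← h37.ne_zero_iff]
    omega

end EdgePrograms

end LocalTestability

namespace LocalTestability

/-! ### Loops over pairs of states -/

section PairLoops

open Finset

variable {W S k n : ℕ} [NeZero n] {a : ArrayState} {B E : ArrayProg} {T c d : ℕ}

/-- Compute with `B` an entry for each pair of states (register `20`), and store the
entries (register `26`) in array `c`. -/
def fillProg (c : ℕ) (B : ArrayProg) : ArrayProg := .count 20 21 2 (B ;; .store c 20 26)

/-- The entries are specified by a relation, since some tables hold truth values and others counters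
that are zero where a property holds. -/
theorem halts_fillProg (hB : Bounds W S k n) (h2 : a.reg 2 = n * n) (h3 : a.reg 3 = 1) (hc : c < 16)
    (hregs : ∀ r ∈ B.regs, 22 ≤ r) (harrs : B.arrs = []) (R : Fin n × Fin n → ℕ → Prop)
    (h : ∀ b u, (∀ r < 20, b.reg r = a.reg r) → (∀ i ≠ c, b.arr i = a.arr i) →
      b.reg 20 = code u → Halts W S B b T fun b' => R u (b'.reg 26)) :
    Halts W S (fillProg c B) a (n * n * (T + 4) + 3) fun b => ∀ u, R u (b.arr c (code u)) := by
  have hr : ∀ r < 22, r ∉ B.regs := fun r hr hm => by have := hregs r hm; omega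
  have hW := hB.le_word
  have hS := hB.sq_le
  refine (Halts.count (T := T + 1) (fun j b => ∀ u : Fin n × Fin n, code u < j →
    R u (b.arr c (code u))) h2 h3 (by omega) (by decide) ?_ ?_ ?_ ?_).mono le_rfl ?_
  · simp [ArrayProg.regs, hr]
  · intro j b b' hb harr _ u hu
    rw [harr]
    exact hb u hu
  · intro u hu
    omega
  · intro j hj b hbr hba hI h20
    obtain ⟨u, rfl⟩ : ∃ u : Fin n × Fin n, code u = j := ⟨node n j, code_node hj⟩
    refine (h b u (fun r hr' => hbr r (by omega) (by omega) ?_) (fun i hi => hba i ?_) h20).seq ?_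
    · simp [ArrayProg.regs, hr r (by omega)]
    · simp [ArrayProg.arrs, harrs, hi]
    · rintro b₁ ⟨hf₁, hf₂⟩ hR
      have h₁ : b₁.reg 20 = code u := by rw [hf₁ 20 (hr 20 (by decide)), h20]
      refine ⟨1, _, le_rfl, .store b₁ c 20 26 hc (by omega), fun v hv => ?_⟩
      rw [ArrayState.setArr_arr_self, h₁]
      split_ifs with hvu
      · rw [code_injective hvu]
        exact hR
      · rw [hf₂ c (by simp [harrs])]
        exact hI v (by omega)
  · exact fun b _ hb u => hb u (code_lt u)

/-- Set register `d` to zero if `B` finds (in register `26`) a nonzero entry for some pair of states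
(register `20`). -/
def refuteProg (d : ℕ) (B : ArrayProg) : ArrayProg := .count 20 21 2 (B ;; .ite 26 (.const d 0) .skip)

/-- Register d enters with an earlier verdict P and can only be cleared, so the result is a
conjunction. Condition (1) starts from `True`, and the final verdict from the outcome of condition
(1). -/
theorem halts_refuteProg (hB : Bounds W S k n) (h2 : a.reg 2 = n * n) (h3 : a.reg 3 = 1)
    (hd : 3 < d ∧ d < 20) (hregs : ∀ r ∈ B.regs, 22 ≤ r) (harrs : B.arrs = [])
    (R : Fin n × Fin n → Prop) {P : Prop} (hP : IsBit P (a.reg d))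
    (h : ∀ b u, (∀ r < 20, r ≠ d → b.reg r = a.reg r) → b.arr = a.arr →
      b.reg 20 = code u → Halts W S B b T fun b' => b'.reg 26 ≠ 0 ↔ R u) :
    Halts W S (refuteProg d B) a (n * n * (T + 5) + 3)
      fun b => IsBit (P ∧ ∀ u, ¬ R u) (b.reg d) := by
  have hr : ∀ r < 22, r ∉ B.regs := fun r hr hm => by have := hregs r hm; omega
  have hW := hB.le_word
  have hS := hB.sq_le
  refine (Halts.count (T := T + 2) (fun j b => IsBit (P ∧ ∀ u : Fin n × Fin n, code u < j → ¬ R u)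
    (b.reg d)) h2 h3 (by omega) (by decide) ?_ ?_ ?_ ?_).mono le_rfl ?_
  · simp [ArrayProg.regs, hr]
    omega
  · intro j b b' hb _ hreg
    rw [hreg d (by omega) (by omega)]
    exact hb
  · simpa using hP
  · intro j hj b hbr hba hI h20
    obtain ⟨u, rfl⟩ : ∃ u : Fin n × Fin n, code u = j := ⟨node n j, code_node hj⟩
    refine (h b u (fun r hr' hrd => hbr r (by omega) (by omega) ?_) (funext fun i => hba i ?_)
      h20).seq ?_
    · simp [ArrayProg.regs, hr r (by omega), hrd]
    · simp [ArrayProg.arrs, harrs]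
    · rintro b₁ ⟨hf₁, hf₂⟩ hR
      rw [← hf₁ d (hr d (by omega))] at hI
      refine ArrayProg.Pre.halts (P := .ite 26 (.const d 0) .skip) ⟨fun h26 => ⟨Nat.zero_le _, ?_⟩,
        fun h26 => ?_⟩
      · beta_reduce
        rw [ArrayState.setReg_reg, if_pos rfl]
        exact Or.inr ⟨fun hn => hn.2 u (by omega) (hR.1 h26), rfl⟩
      · refine hI.congr (and_congr_right fun _ => ⟨fun hl v hv => ?_, fun hl v hv => hl v (by omega)⟩)
        by_cases hvu : code v = code u
        · rw [code_injective hvu, ← hR]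
          exact fun hn => hn h26
        · exact hl v (by omega)
  · exact fun b _ hb => hb.congr (and_congr_right fun _ =>
      ⟨fun hl u => hl u (code_lt u), fun hl u _ => hl u⟩)

/-- Put into register `26` whether there is an edge from the pair of states in register `20`. -/
def existsEdgeProg (E : ArrayProg) : ArrayProg :=
  .const 26 0 ;; .count 22 23 1 (E ;; .ite 31 (.const 26 1) .skip)

variable {P : Fin n × Fin n → Fin k → Prop} {f : Fin n × Fin n → Fin k → Fin n × Fin n} {X : Set ℕ}

omit [NeZero n] in
theorem EdgeSpec.regs_disjoint (hE : EdgeSpec W S E a X P f T) : ∀ r < 30, r ∉ E.regs :=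
  fun r hr hm => by have := hE.regs r hm; omega

omit [NeZero n] in
theorem EdgeSpec.halts_existsEdgeProg (hE : EdgeSpec W S E a X P f T) (hB : Bounds W S k n)
    (h1 : a.reg 1 = k) (h3 : a.reg 3 = 1) {b : ArrayState} {u : Fin n × Fin n}
    (hbr : ∀ r < 20, b.reg r = a.reg r) (hba : ∀ i ∉ X, b.arr i = a.arr i)
    (h20 : b.reg 20 = code u) :
    Halts W S (existsEdgeProg E) b (k * (T + 5) + 4) fun b' => IsBit (∃ j, P u j) (b'.reg 26) := by
  have hr := hE.regs_disjoint
  have hW := hB.le_word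
  have hk := hB.le_left
  have hpos := hB.pos
  have pre : Halts W S (.const 26 0) b 1 fun b' => b' = b.setReg 26 0 :=
    ⟨1, _, le_rfl, .const b 26 0 (Nat.zero_le _), rfl⟩
  refine (pre.seq (T' := k * (T + 5) + 3) ?_).mono (by omega) fun _ _ h => h
  rintro _ - rfl
  refine (Halts.count (T := T + 2) (m := k) (fun i b' => IsBit (∃ j : Fin k, (j : ℕ) < i ∧ P u j)
    (b'.reg 26)) (by simp [hbr, h1]) (by simp [hbr, h3]) (by omega) (by decide)
    (by simp [ArrayProg.regs, hr]) ?_ ?_ ?_).mono le_rfl ?_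
  · intro j b₁ b₂ hb _ hreg
    rw [hreg 26 (by decide) (by decide)]
    exact hb
  · exact Or.inr ⟨by simp, by simp⟩
  · intro i hi b₁ hr₁ ha₁ hI h22
    have hr₁' : ∀ r < 30, r ≠ 22 → r ≠ 23 → r ≠ 26 → b₁.reg r = b.reg r := by
      intro r hr' h₁ h₂ h₃
      rw [hr₁ r h₁ h₂ (by simp [ArrayProg.regs, hr r hr', h₃])]
      simp [h₃]
    have step := hE.halts b₁ u ⟨i, hi⟩
      (fun r hr' => by rw [hr₁' r (by omega) (by omega) (by omega) (by omega), hbr r (by omega)])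
      (fun j hj => by
        rw [ha₁ j (by simp [ArrayProg.arrs, hE.arrs]), ArrayState.setReg_arr, hba j hj])
      (by rw [hr₁' 20 (by decide) (by decide) (by decide) (by decide), h20]) h22
    refine step.seq ?_
    rintro b₂ ⟨hf₁, hf₂⟩ ⟨-, h31⟩
    rw [← hf₁ 26 (hr 26 (by decide))] at hI
    refine ArrayProg.Pre.halts (P := .ite 31 (.const 26 1) .skip) ⟨fun h => ⟨by omega, ?_⟩, fun h => ?_⟩
    · beta_reduce
      rw [ArrayState.setReg_reg, if_pos rfl]
      exact Or.inl ⟨⟨⟨i, hi⟩, Nat.lt_succ_self i, h31.1 h⟩, rfl⟩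
    · refine hI.congr ⟨fun ⟨j, hj, hP⟩ => ⟨j, by omega, hP⟩, fun ⟨j, hj, hP⟩ => ⟨j, ?_, hP⟩⟩
      by_contra hji
      have : j = ⟨i, hi⟩ := Fin.ext (by simp only; omega)
      subst this
      exact h31.2 hP h
  · exact fun b' _ hb => hb.congr ⟨fun ⟨j, _, hP⟩ => ⟨j, hP⟩, fun ⟨j, hP⟩ => ⟨j, j.2, hP⟩⟩

/-- Count for each pair of states the incoming edges, in array `c`. -/
def countProg (c : ℕ) (E : ArrayProg) : ArrayProg :=
  .count 20 21 2 (.count 22 23 1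
    (E ;; .ite 31 (.load 24 c 30 ;; .add 24 24 3 ;; .store c 30 24) .skip))

theorem edgeCount_le {e : ℕ → ℕ → Prop} {tgt : ℕ → ℕ → ℕ} (j x y : ℕ) :
    edgeCount e tgt j x y ≤ j := by
  refine (sum_le_card_nsmul (range j) _ 1 fun i _ => ?_).trans (by simp)
  split_ifs <;> omega

/-- No counter exceeds the number of all edges, at most n * n * k; this is why S has to be that
large. -/
theorem EdgeSpec.halts_countProg (hE : EdgeSpec W S E a {c} P f T) (hB : Bounds W S k n)
    (hBk : n * n * k ≤ S) (hc : c < 16) (h1 : a.reg 1 = k) (h2 : a.reg 2 = n * n) (h3 : a.reg 3 = 1)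
    (h₀ : ∀ y < n * n, a.arr c y = 0) :
    Halts W S (countProg c E) a (n * n * (k * (T + 7) + 6) + 3) fun b =>
      ∀ y < n * n, b.arr c y = inCount (natEdge P) (natTarget f) k (range (n * n)) y := by
  have hr := hE.regs_disjoint
  have hW := hB.le_word
  have hS := hB.sq_le
  have hk := hB.le_left
  have hpos := hB.pos
  refine (Halts.count (T := k * (T + 7) + 3) (fun i b => ∀ y < n * n,
    b.arr c y = inCount (natEdge P) (natTarget f) k (range i) y) h2 h3 (by omega) (by decide)
    (by simp [ArrayProg.regs, ArrayProg.count, hr]) ?_ ?_ ?_).mono le_rfl fun b _ hb => hb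
  · intro j b b' hb harr _
    rw [harr]
    exact hb
  · intro y hy
    rw [h₀ y hy]
    simp [inCount]
  intro x hx b hbr hba hI h20
  have hbr' : ∀ r < 20, b.reg r = a.reg r := fun r hr' => hbr r (by omega) (by omega) (by
    simp [ArrayProg.regs, ArrayProg.count, hr r (by omega)]
    omega)
  have hba' : ∀ i ≠ c, b.arr i = a.arr i := fun i hi => hba i (by
    simp [ArrayProg.arrs, ArrayProg.count, hE.arrs, hi])
  refine (Halts.count (T := T + 4) (m := k) (fun j b' => ∀ y < n * n,
    b'.arr c y = inCount (natEdge P) (natTarget f) k (range x) y +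
      edgeCount (natEdge P) (natTarget f) j x y) (by rw [hbr' 1 (by decide), h1])
    (by rw [hbr' 3 (by decide), h3]) (by omega) (by decide)
    (by simp [ArrayProg.regs, hr]) ?_ ?_ ?_).mono le_rfl ?_
  · intro j b' b'' hb harr _
    rw [harr]
    exact hb
  · intro y hy
    rw [hI y hy, edgeCount, range_zero, sum_empty, add_zero]
  · intro j hj b₁ hr₁ ha₁ hI₁ h22
    have hr₁' : ∀ r < 22, b₁.reg r = b.reg r := fun r hr' => hr₁ r (by omega) (by omega) (by
      simp [ArrayProg.regs, hr r (by omega)]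
      omega)
    have step := hE.halts b₁ (node n x) ⟨j, hj⟩
      (fun r hr' => by rw [hr₁' r (by omega), hbr' r (by omega)])
      (fun i hi => by
        have hic : i ≠ c := by simpa using hi
        rw [ha₁ i (by simp [ArrayProg.arrs, hE.arrs, hic]), hba' i hic])
      (by rw [hr₁' 20 (by decide), h20, code_node hx]) h22
    refine step.seq ?_
    rintro b₂ ⟨hf₁, hf₂⟩ ⟨h30, h31⟩
    have h₂c : b₂.arr c = b₁.arr c := hf₂ c (by simp [hE.arrs])
    have h₂3 : b₂.reg 3 = 1 := by
      rw [hf₁ 3 (hr 3 (by decide)), hr₁' 3 (by decide), hbr' 3 (by decide), h3]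
    have ht := code_lt (f (node n x) ⟨j, hj⟩)
    have htgt : natTarget f x j = code (f (node n x) ⟨j, hj⟩) := by rw [natTarget, dif_pos hj]
    have hedge : natEdge P x j ↔ P (node n x) ⟨j, hj⟩ := ⟨fun h => h.2, fun h => ⟨hj, h⟩⟩
    refine ArrayProg.Pre.halts (P := .ite 31 (.load 24 c 30 ;; .add 24 24 3 ;; .store c 30 24) .skip)
      ⟨fun h => ?_, fun h y hy => ?_⟩
    · have hle : inCount (natEdge P) (natTarget f) k (range x) (code (f (node n x) ⟨j, hj⟩)) +
          edgeCount (natEdge P) (natTarget f) j x (code (f (node n x) ⟨j, hj⟩)) + 1 ≤ S := by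
        have e₁ : inCount (natEdge P) (natTarget f) k (range x) (code (f (node n x) ⟨j, hj⟩)) ≤
            x * k := by
          refine (sum_le_card_nsmul (range x) _ k fun i _ => edgeCount_le _ _ _).trans ?_
          simp
        have e₂ := edgeCount_le (e := natEdge P) (tgt := natTarget f) j x
          (code (f (node n x) ⟨j, hj⟩))
        have e₃ : (x + 1) * k ≤ n * n * k := Nat.mul_le_mul_right k hx
        rw [add_mul, one_mul] at e₃
        omega
      simp only [ArrayProg.Pre, ArrayState.setReg_reg, ArrayState.setReg_arr, Nat.reduceEqDiff,
        if_true, if_false, h30, h₂3, hc, true_and, h₂c, hI₁ _ ht, ArrayState.setArr_arr_self]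
      refine ⟨by omega, by omega, by omega, fun y hy => ?_⟩
      rw [edgeCount_succ, htgt, hedge]
      by_cases hy' : y = code (f (node n x) ⟨j, hj⟩)
      · rw [if_pos hy', if_pos ⟨h31.1 h, hy'.symm⟩, hy', add_assoc]
      · rw [if_neg hy', if_neg fun h => hy' h.2.symm, hI₁ y hy, add_zero]
    · rw [h₂c, hI₁ y hy, edgeCount_succ, if_neg, add_zero]
      exact fun hn => h31.2 (hedge.1 hn.1) h
  · intro b' _ hb y hy
    rw [hb y hy, inCount, inCount, sum_range_succ]

end PairLoops

end LocalTestability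

namespace LocalTestability

/-! ### The test as an array program -/

section TestProgram

open Finset

variable {W S k n : ℕ} {a b : ArrayState} {A : DFA (Fin k) (Fin n)}

/-- Tabulate the multiples of `k` and of `n`. -/
def multiplesProg : ArrayProg :=
  .const 24 0 ;; .const 25 0 ;;
    .count 20 21 0 (.store 4 20 24 ;; .store 5 20 25 ;; .add 24 24 1 ;; .add 25 25 0)

theorem halts_multiplesProg (hB : Bounds W S k n) (h0 : a.reg 0 = n) (h1 : a.reg 1 = k)
    (h3 : a.reg 3 = 1) : Halts W S multiplesProg a (n * 7 + 5) fun b =>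
      (∀ p < n, b.arr 4 p = p * k) ∧ ∀ p < n, b.arr 5 p = p * n := by
  have hW := hB.le_word
  have hn := hB.le_right
  have hk := hB.le_left
  have hnk := hB.mul_le
  have hnn := hB.sq_le
  have pre : Halts W S (.const 24 0) a 1 fun b => b = a.setReg 24 0 :=
    ⟨1, _, le_rfl, .const a 24 0 (Nat.zero_le _), rfl⟩
  refine (pre.seq (T' := n * 7 + 4) ?_).mono (by omega) fun _ _ h => h
  rintro _ - rfl
  have pre' : Halts W S (.const 25 0) (a.setReg 24 0) 1
      fun b => b = (a.setReg 24 0).setReg 25 0 := ⟨1, _, le_rfl, .const _ 25 0 (Nat.zero_le _), rfl⟩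
  refine (pre'.seq (T' := n * 7 + 3) ?_).mono (by omega) fun _ _ h => h
  rintro _ - rfl
  refine (Halts.count (T := 4) (m := n) (fun j b => b.reg 24 = j * k ∧ b.reg 25 = j * n ∧
    (∀ p < j, b.arr 4 p = p * k) ∧ ∀ p < j, b.arr 5 p = p * n) (by simpa using h0)
    (by simpa using h3) (by omega) (by decide) (by decide) ?_ ?_ ?_).mono le_rfl
    fun b _ hb => hb.2.2
  · rintro j b b' ⟨h24, h25, hb⟩ harr hreg
    rw [hreg 24 (by decide) (by decide), hreg 25 (by decide) (by decide), harr]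
    exact ⟨h24, h25, hb⟩
  · simp
  · rintro j hj b hr - ⟨h24, h25, h4, h5⟩ h20
    have hb0 : b.reg 0 = n := by
      rw [hr 0 (by decide) (by decide) (by decide)]
      simpa using h0
    have hb1 : b.reg 1 = k := by
      rw [hr 1 (by decide) (by decide) (by decide)]
      simpa using h1
    refine ArrayProg.Pre.halts
      (P := .store 4 20 24 ;; .store 5 20 25 ;; .add 24 24 1 ;; .add 25 25 0) ?_
    have e₁ : (j + 1) * k ≤ n * k := Nat.mul_le_mul_right k hj
    have e₂ : (j + 1) * n ≤ n * n := Nat.mul_le_mul_right n hj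
    rw [add_mul, one_mul] at e₁ e₂
    have e₃ : j < S := by omega
    simp only [ArrayProg.Pre, ArrayState.setReg_reg, ArrayState.setReg_arr, ArrayState.setArr_reg,
      Nat.reduceEqDiff, if_true, if_false, h20, h24, h25, hb0, hb1, e₃, true_and, Nat.reduceLT,
      ArrayState.setArr_arr, false_and, add_mul, one_mul]
    refine ⟨by omega, by omega, fun p hp => ?_, fun p hp => ?_⟩
    · split_ifs with h
      · rw [h]
      · exact h4 p (by omega)
    · split_ifs with h
      · rw [h]
      · exact h5 p (by omega)

/-- Tabulate the coordinates of pairs of states. -/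
def coordinatesProg : ArrayProg :=
  .const 24 0 ;; .const 25 0 ;;
    .count 20 21 2 (.store 6 20 24 ;; .store 7 20 25 ;; .add 25 25 3 ;; .sub 26 0 25 ;;
      .ite 26 .skip (.const 25 0 ;; .add 24 24 3))

theorem halts_coordinatesProg (hB : Bounds W S k n) (hn0 : 0 < n) (h0 : a.reg 0 = n)
    (h2 : a.reg 2 = n * n) (h3 : a.reg 3 = 1) : Halts W S coordinatesProg a (n * n * 10 + 5) fun b =>
      (∀ u : Fin n × Fin n, b.arr 6 (code u) = u.1) ∧
      ∀ u : Fin n × Fin n, b.arr 7 (code u) = u.2 := by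
  have hW := hB.le_word
  have hn := hB.le_right
  have hnn := hB.sq_le
  have pre : Halts W S (.const 24 0) a 1 fun b => b = a.setReg 24 0 :=
    ⟨1, _, le_rfl, .const a 24 0 (Nat.zero_le _), rfl⟩
  refine (pre.seq (T' := n * n * 10 + 4) ?_).mono (by omega) fun _ _ h => h
  rintro _ - rfl
  have pre' : Halts W S (.const 25 0) (a.setReg 24 0) 1
      fun b => b = (a.setReg 24 0).setReg 25 0 := ⟨1, _, le_rfl, .const _ 25 0 (Nat.zero_le _), rfl⟩
  refine (pre'.seq (T' := n * n * 10 + 3) ?_).mono (by omega) fun _ _ h => h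
  rintro _ - rfl
  -- There is no division, so registers 24 and 25 run as an odometer: they hold the quotient and the
  -- remainder of the current index by n.
  refine (Halts.count (T := 7) (m := n * n) (fun j b => b.reg 24 * n + b.reg 25 = j ∧ b.reg 25 < n ∧
    ∀ x < j, b.arr 6 x = x / n ∧ b.arr 7 x = x % n) (by simpa using h2)
    (by simpa using h3) (by omega) (by decide) (by decide) ?_ ?_ ?_).mono le_rfl ?_
  · rintro j b b' ⟨h24, h25, hb⟩ harr hreg
    rw [hreg 24 (by decide) (by decide), hreg 25 (by decide) (by decide), harr]
    exact ⟨h24, h25, hb⟩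
  · simpa using hn0
  · rintro j hj b hr - ⟨hj', h25, hI⟩ h20
    have hb0 : b.reg 0 = n := by
      rw [hr 0 (by decide) (by decide) (by decide)]
      simpa using h0
    have hb3 : b.reg 3 = 1 := by
      rw [hr 3 (by decide) (by decide) (by decide)]
      simpa using h3
    have hdiv : j / n = b.reg 24 := by
      rw [← hj', mul_comm, Nat.mul_add_div hn0, Nat.div_eq_of_lt h25, add_zero]
    have hmod : j % n = b.reg 25 := by
      rw [← hj', mul_comm, Nat.mul_add_mod, Nat.mod_eq_of_lt h25]
    have e₁ : b.reg 24 ≤ b.reg 24 * n := Nat.le_mul_of_pos_right _ hn0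
    have e₃ : j < S := by omega
    refine ArrayProg.Pre.halts (P := .store 6 20 24 ;; .store 7 20 25 ;; .add 25 25 3 ;;
      .sub 26 0 25 ;; .ite 26 .skip (.const 25 0 ;; .add 24 24 3)) ?_
    simp only [ArrayProg.Pre, ArrayState.setReg_reg, ArrayState.setReg_arr, ArrayState.setArr_reg,
      Nat.reduceEqDiff, if_true, if_false, h20, hb0, hb3, e₃, true_and, Nat.reduceLT,
      ArrayState.setArr_arr, false_and, OfNat.zero_ne_ofNat, Nat.zero_le]
    have htab : ∀ x < j + 1, (if x = j then b.reg 24 else b.arr 6 x) = x / n ∧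
        (if x = j then b.reg 25 else b.arr 7 x) = x % n := by
      intro x hx
      split_ifs with h
      · rw [h, hdiv, hmod]
        exact ⟨rfl, rfl⟩
      · exact hI x (by omega)
    refine ⟨by omega, fun h => ⟨by omega, by omega, htab⟩, fun h => ⟨by omega, ?_, hn0, htab⟩⟩
    rw [add_mul, one_mul]
    omega
  · rintro b - ⟨-, -, hb⟩
    exact ⟨fun u => by rw [(hb _ (code_lt u)).1, code_div],
      fun u => by rw [(hb _ (code_lt u)).2, code_mod]⟩

/-- Put into register `26` whether the states of the pair in register `20` differ. -/
def distinctProg : ArrayProg :=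
  .load 24 6 20 ;; .load 25 7 20 ;; .sub 26 24 25 ;; .sub 27 25 24 ;; .add 26 26 27 ;;
    .ite 26 (.const 26 1) (.const 26 0)

theorem halts_distinctProg (hB : Bounds W S k n) (h : Tables A b) {u : Fin n × Fin n}
    (h20 : b.reg 20 = code u) :
    Halts W S distinctProg b 7 fun b' =>
      (u.1 = u.2 ∧ b'.reg 26 = 0) ∨ (¬ u.1 = u.2 ∧ b'.reg 26 = 1) := by
  refine ArrayProg.Pre.halts (P := distinctProg) ?_
  have h₁ := (code_lt u).trans_le hB.sq_le
  have h₂ := u.1.2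
  have h₃ := u.2.2
  have h₄ := hB.le_right
  have h₅ := hB.le_word
  simp only [distinctProg, ArrayProg.Pre, ArrayState.setReg_reg, ArrayState.setReg_arr, h20, h₁,
    h.fst, h.snd, Nat.reduceEqDiff, if_true, if_false, true_and, Nat.reduceLT, Nat.zero_le,
    Fin.ext_iff, and_true, and_false, or_false, false_or]
  omega

/-- Put the truth value of the vanishing of the bit of array `c` at register `20` into
register `26`. -/
def complementProg (c : ℕ) : ArrayProg := .load 24 c 20 ;; .sub 26 3 24

theorem halts_complementProg {c x : ℕ} (hc : c < 16) (hx : x < S) (h3 : b.reg 3 = 1)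
    (h20 : b.reg 20 = x) :
    Halts W S (complementProg c) b 2 fun b' => IsBit (b.arr c x = 0) (b'.reg 26) := by
  refine ArrayProg.Pre.halts (P := complementProg c) ?_
  simp only [complementProg, ArrayProg.Pre, ArrayState.setReg_reg, h20, hx,
    Nat.reduceEqDiff, if_true, if_false, true_and, hc, h3, isBit_iff]
  omega

/-- Compute the reachability table (array `1`) by means of array `9`. -/
def reachTableProg : ArrayProg :=
  fillProg 9 distinctProg ;; worklistProg 9 reachEdgeProg ;; fillProg 1 (complementProg 9)

/-- The first component remembers where the search started, so the searches from all n states are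
one search on pairs, started on the diagonal. -/
theorem reflTransGen_edgeRel_reach {u v : Fin n × Fin n} :
    Relation.ReflTransGen (EdgeRel (fun (_ : Fin n × Fin n) (_ : Fin k) => True)
      (fun u j => (u.1, A.step u.2 j))) v u ↔ v.1 = u.1 ∧ Reach A v.2 u.2 := by
  constructor
  · intro h
    induction h with
    | refl => exact ⟨rfl, .refl _⟩
    | tail _ h ih =>
      obtain ⟨j, -, rfl⟩ := h
      exact ⟨ih.1, ih.2.trans (reach_step _ j)⟩
  · rintro ⟨h₁, h₂⟩
    obtain ⟨p, q⟩ := u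
    obtain ⟨p', q'⟩ := v
    dsimp only at h₁ h₂
    subst h₁
    induction h₂ with
    | refl => exact .refl
    | tail _ h ih =>
      obtain ⟨j, rfl⟩ := h
      exact ih.tail ⟨j, trivial, rfl⟩

variable [NeZero n]

theorem halts_reachTableProg (hB : Bounds W S k n) (h : Tables A a) :
    Halts W S reachTableProg a (n * n * (k * 27 + 30) + 11) (ReachTable A) := by
  have hW := hB.le_word
  have hS := hB.sq_le
  have hk := hB.le_left
  have fill := halts_fillProg hB h.reg2 h.reg3 (c := 9) (B := distinctProg) (T := 7) (by decide)
    (by decide) (by decide) (fun u m => (u.1 = u.2 ∧ m = 0) ∨ (¬ u.1 = u.2 ∧ m = 1))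
    fun b u hr ha h20 => halts_distinctProg hB
      (h.of_eq (fun r _ => hr r (by omega)) fun i hi => ha i (by revert i; decide)) h20
  refine (fill.seq (T' := n * n * (k * 27 + 19) + 8) ?_).mono (by linarith) fun _ _ h => h
  intro b hf hb
  have hb' : Tables A b := h.frame hf (by decide) (by decide)
  have search := (edgeSpec_reach hB hb' (X := {8, 9}) (by simp)).search (by decide) (by decide) hS
    (by omega) (by omega) hb'.reg1 hb'.reg2 hb'.reg3 hb
  refine (search.seq (T' := n * n * 6 + 3) ?_).mono (by linarith) fun _ _ h => h
  intro d hf hd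
  have hd' : Tables A d := hb'.frame hf (by decide) (by decide)
  refine (halts_fillProg hB hd'.reg2 hd'.reg3 (c := 1) (B := complementProg 9) (T := 2) (by decide)
    (by decide) (by decide) (fun u m => IsBit (Reach A u.1 u.2) m) ?_).mono le_rfl fun _ _ h => h
  intro b u hr ha h20
  refine (halts_complementProg (c := 9) (by decide) ((code_lt u).trans_le hS)
    (by rw [hr 3 (by decide), hd'.reg3]) h20).mono le_rfl fun b' _ hb => hb.congr ?_
  rw [ha 9 (by decide), hd]
  constructor
  · rintro ⟨v, hv, hvu⟩
    obtain ⟨h₁, h₂⟩ := reflTransGen_edgeRel_reach.1 hvu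
    rwa [← h₁, hv]
  -- The second component starts at the remembered state itself.
  · exact fun hu => ⟨(u.1, u.1), rfl, reflTransGen_edgeRel_reach.2 ⟨rfl, hu⟩⟩

/-- Find the pairs of states to which no cycle leads; their entries in array `10` become zero. -/
def trimProg : ArrayProg := countProg 10 trimEdgeProg ;; worklistProg 10 trimEdgeProg

/-- The entries of array `10` that vanish belong to the accessible pairs of states. -/
def TrimTable (A : DFA (Fin k) (Fin n)) (a : ArrayState) : Prop :=
  ∀ u, a.arr 10 (code u) = 0 ↔ Acc (TrimEdge A) u

omit [NeZero n] in
theorem edgeRel_trim :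
    EdgeRel (fun (u : Fin n × Fin n) (j : Fin k) => Reach A (A.step u.1 j) u.1 ∧
        Reach A (A.step u.2 j) u.2 ∧ A.step u.1 j ≠ A.step u.2 j)
      (fun u j => (A.step u.1 j, A.step u.2 j)) = TrimEdge A := by
  funext u v
  obtain ⟨p, q⟩ := v
  refine propext ⟨?_, ?_⟩
  · rintro ⟨j, h, hv⟩
    obtain ⟨rfl, rfl⟩ := Prod.mk.inj hv
    exact ⟨⟨j, rfl, rfl⟩, h⟩
  · rintro ⟨⟨j, h₁, h₂⟩, h⟩
    dsimp only at h₁ h₂ h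
    subst h₁ h₂
    exact ⟨j, h, rfl⟩

/-- Array 10 first receives the in-degrees of the trim edges. With these counters the worklist
removes exactly the pairs to which no trim cycle leads. -/
theorem halts_trimProg (hB : Bounds W S k n) (hBk : n * n * k ≤ S) (h : Tables A a)
    (hR : ReachTable A a) (h₀ : ∀ y < n * n, a.arr 10 y = 0) :
    Halts W S trimProg a (n * n * (k * 66 + 19) + 8) (TrimTable A) := by
  have hW := hB.le_word
  have hS := hB.sq_le
  have hk := hB.le_left
  have count := (edgeSpec_trim hB h hR (X := {10}) (by simp)).halts_countProg hB hBk (by decide)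
    h.reg1 h.reg2 h.reg3 h₀
  refine (count.seq (T' := n * n * (k * 35 + 13) + 5) ?_).mono (by linarith) fun _ _ h => h
  intro b hf hb
  have hb' : Tables A b := h.frame hf (by decide) (by decide)
  have hRb : ReachTable A b := hR.frame hf (by decide)
  refine ((edgeSpec_trim hB hb' hRb (X := {8, 10}) (by simp)).trim (by decide) (by decide) hS
    (by omega) (by omega) hb'.reg1 hb'.reg2 hb'.reg3 hb).mono (by linarith) fun d _ hd => ?_
  rw [edgeRel_trim] at hd
  exact hd

end TestProgram

end LocalTestability

namespace LocalTestability

/-! ### Condition (1), visited and marked pairs, and the verdict -/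

section TestProgram

open Finset

variable {W S k n : ℕ} {a b : ArrayState} {A : DFA (Fin k) (Fin n)}

/-- For the pair `(p, q)` in register `20`, fetch its entry of array `10` and the truth values of
`p ⪰ q` and `q ⪰ p`. -/
def orderProg : ArrayProg :=
  .load 28 10 20 ;; .load 32 6 20 ;; .load 33 7 20 ;; reachProg 36 32 33 ;; reachProg 37 33 32

theorem halts_orderProg (hB : Bounds W S k n) (h : Tables A b) (hR : ReachTable A b)
    (hT : TrimTable A b) {u : Fin n × Fin n} (h20 : b.reg 20 = code u) :
    Halts W S orderProg b 9 fun b' => (b'.reg 28 ≠ 0 ↔ ¬ Acc (TrimEdge A) u) ∧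
      (b'.reg 36 ≠ 0 ↔ Reach A u.1 u.2) ∧ (b'.reg 37 ≠ 0 ↔ Reach A u.2 u.1) := by
  have h₁ := (code_lt u).trans_le hB.sq_le
  have load : Halts W S (.load 28 10 20) b 1 fun b' => (b'.reg 28 ≠ 0 ↔ ¬ Acc (TrimEdge A) u) ∧
      b'.reg 20 = code u := by
    refine ArrayProg.Pre.halts (P := .load 28 10 20) ⟨by decide, by rwa [h20], ?_⟩
    simp [h20, ← hT u]
  refine (load.seq (T' := 8) ?_).mono (by omega) fun _ _ h => h
  rintro b₁ hf₁ ⟨h28, h20₁⟩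
  have hb₁ : Tables A b₁ := h.frame hf₁ (by decide) (by decide)
  have hR₁ : ReachTable A b₁ := hR.frame hf₁ (by decide)
  have load₂ : Halts W S (.load 32 6 20) b₁ 1 fun b' => b'.reg 32 = u.1 := by
    refine ArrayProg.Pre.halts (P := .load 32 6 20) ⟨by decide, by rwa [h20₁], ?_⟩
    simp [h20₁, hb₁.fst]
  refine (load₂.seq (T' := 7) ?_).mono (by omega) fun _ _ h => h
  rintro b₂ hf₂ h32
  have hb₂ : Tables A b₂ := hb₁.frame hf₂ (by decide) (by decide)
  have hR₂ : ReachTable A b₂ := hR₁.frame hf₂ (by decide)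
  have h20₂ : b₂.reg 20 = code u := by rw [hf₂.1 20 (by decide), h20₁]
  have load₃ : Halts W S (.load 33 7 20) b₂ 1 fun b' => b'.reg 33 = u.2 := by
    refine ArrayProg.Pre.halts (P := .load 33 7 20) ⟨by decide, by rwa [h20₂], ?_⟩
    simp [h20₂, hb₂.snd]
  refine (load₃.seq (T' := 6) ?_).mono (by omega) fun _ _ h => h
  rintro b₃ hf₃ h33
  have hb₃ : Tables A b₃ := hb₂.frame hf₃ (by decide) (by decide)
  have hR₃ : ReachTable A b₃ := hR₂.frame hf₃ (by decide)
  have h32₃ : b₃.reg 32 = u.1 := by rw [hf₃.1 32 (by decide), h32]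
  refine ((halts_reachProg hB hb₃ hR₃ (d := 36) (by decide) h32₃ h33).seq (T' := 3) ?_).mono
    (by omega) fun _ _ h => h
  rintro b₄ hf₄ h36
  have hb₄ : Tables A b₄ := hb₃.frame hf₄ (by decide) (by decide)
  have hR₄ : ReachTable A b₄ := hR₃.frame hf₄ (by decide)
  refine (halts_reachProg hB hb₄ hR₄ (d := 37) (by decide) (by rw [hf₄.1 33 (by decide), h33])
    (by rw [hf₄.1 32 (by decide), h32₃])).mono le_rfl ?_
  intro b₅ hf₅ h37
  refine ⟨?_, ?_, h37.ne_zero_iff⟩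
  · rwa [hf₅.1 28 (by decide), hf₄.1 28 (by decide), hf₃.1 28 (by decide), hf₂.1 28 (by decide)]
  · rw [hf₅.1 36 (by decide)]
    exact h36.ne_zero_iff

/-- Put into register `26` whether the pair in register `20` refutes condition (1). -/
def conflictProg : ArrayProg :=
  orderProg ;; .const 26 0 ;; .ite 28 (.ite 36 (.ite 37 (.const 26 1) .skip) .skip) .skip

theorem halts_conflictProg (hB : Bounds W S k n) (h : Tables A b) (hR : ReachTable A b)
    (hT : TrimTable A b) {u : Fin n × Fin n} (h20 : b.reg 20 = code u) :
    Halts W S conflictProg b 14 fun b' => b'.reg 26 ≠ 0 ↔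
      ¬ Acc (TrimEdge A) u ∧ Reach A u.1 u.2 ∧ Reach A u.2 u.1 := by
  refine ((halts_orderProg hB h hR hT h20).seq (T' := 5) ?_).mono le_rfl fun _ _ h => h
  rintro b₁ - ⟨h28, h36, h37⟩
  have h₁ := hB.le_word
  have h₂ := hB.pos
  refine ArrayProg.Pre.halts
    (P := .const 26 0 ;; .ite 28 (.ite 36 (.ite 37 (.const 26 1) .skip) .skip) .skip) ?_
  rw [← h28, ← h36, ← h37]
  simp only [ArrayProg.Pre, ArrayState.setReg_reg, Nat.reduceEqDiff, if_true, if_false]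
  omega

/-- Put into register `26` a zero exactly if the pair in register `20` is a source. -/
def sourceProg : ArrayProg :=
  orderProg ;; .const 26 1 ;; .ite 28 (.ite 36 (.ite 37 .skip (.const 26 0)) .skip) .skip

theorem halts_sourceProg (hB : Bounds W S k n) (h : Tables A b) (hR : ReachTable A b)
    (hT : TrimTable A b) {u : Fin n × Fin n} (h20 : b.reg 20 = code u) :
    Halts W S sourceProg b 14 fun b' =>
      ((¬ Acc (TrimEdge A) u ∧ StrictReach A u.1 u.2) ∧ b'.reg 26 = 0) ∨
      (¬ (¬ Acc (TrimEdge A) u ∧ StrictReach A u.1 u.2) ∧ b'.reg 26 = 1) := by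
  refine ((halts_orderProg hB h hR hT h20).seq (T' := 5) ?_).mono le_rfl fun _ _ h => h
  rintro b₁ - ⟨h28, h36, h37⟩
  have h₁ := hB.le_word
  have h₂ := hB.pos
  refine ArrayProg.Pre.halts
    (P := .const 26 1 ;; .ite 28 (.ite 36 (.ite 37 .skip (.const 26 0)) .skip) .skip) ?_
  rw [StrictReach, ← h28, ← h36, ← h37]
  simp only [ArrayProg.Pre, ArrayState.setReg_reg, Nat.reduceEqDiff, if_true, if_false, one_ne_zero,
    zero_ne_one, and_true, and_false, or_false, false_or]
  omega

/-- Check condition (1); the result is put into register `4`. -/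
def conditionOneProg : ArrayProg := .const 4 1 ;; refuteProg 4 conflictProg

variable [NeZero n]

theorem halts_conditionOneProg (hB : Bounds W S k n) (h : Tables A a) (hR : ReachTable A a)
    (hT : TrimTable A a) : Halts W S conditionOneProg a (n * n * 19 + 4)
      fun b => IsBit (ConditionOne A) (b.reg 4) := by
  have h₁ := hB.le_word
  have h₂ := hB.pos
  have pre : Halts W S (.const 4 1) a 1 fun b => b.reg 4 = 1 :=
    ⟨1, _, le_rfl, .const a 4 1 (by omega), by simp⟩
  refine (pre.seq (T' := n * n * 19 + 3) ?_).mono (by omega) fun _ _ h => h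
  intro b hf hb
  have hb' : Tables A b := h.frame hf (by decide) (by decide)
  have hRb : ReachTable A b := hR.frame hf (by decide)
  have hTb : TrimTable A b := by
    rw [TrimTable, hf.2 10 (by decide)]
    exact hT
  refine (halts_refuteProg hB hb'.reg2 hb'.reg3 (d := 4) (B := conflictProg) (T := 14) (by decide)
    (by decide) (by decide)
    (fun u => ¬ Acc (TrimEdge A) u ∧ Reach A u.1 u.2 ∧ Reach A u.2 u.1) (P := True)
    (Or.inl ⟨trivial, hb⟩) ?_).mono le_rfl fun c _ hc => hc.congr ?_
  · intro c u hr ha h20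
    refine halts_conflictProg hB (hb'.of_eq (fun r hr' => hr r (by omega) (by omega))
      fun i _ => by rw [ha]) ?_ ?_ h20
    · rw [ReachTable, ha]
      exact hRb
    · rw [TrimTable, ha]
      exact hTb
  · rw [conditionOne_iff_acc, true_and]
    refine forall_congr' fun u => ?_
    tauto

/-- Compute the table of visited pairs (array `3`) by means of array `11`. -/
def visitedProg : ArrayProg :=
  fillProg 11 sourceProg ;; worklistProg 11 keptEdgeProg ;; fillProg 3 (complementProg 11)

omit [NeZero n] in
theorem edgeRel_kept :
    EdgeRel (fun (u : Fin n × Fin n) (j : Fin k) =>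
        Reach A (A.step u.2 j) u.2 ∨ Reach A (A.step u.2 j) u.1)
      (fun u j => (A.step u.1 j, A.step u.2 j)) = KeptEdge A := by
  funext u v
  obtain ⟨p, q⟩ := v
  refine propext ⟨?_, ?_⟩
  · rintro ⟨j, h, hv⟩
    obtain ⟨rfl, rfl⟩ := Prod.mk.inj hv
    exact ⟨⟨j, rfl, rfl⟩, by tauto⟩
  · rintro ⟨⟨j, h₁, h₂⟩, h⟩
    dsimp only at h₁ h₂ h
    subst h₁ h₂
    exact ⟨j, by tauto, rfl⟩

theorem halts_visitedProg (hB : Bounds W S k n) (h : Tables A a) (hR : ReachTable A a)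
    (hT : TrimTable A a) : Halts W S visitedProg a (n * n * (k * 35 + 37) + 11)
      fun b => ∀ u, IsBit (Visited A u) (b.arr 3 (code u)) := by
  have hW := hB.le_word
  have hS := hB.sq_le
  have hk := hB.le_left
  have fill := halts_fillProg hB h.reg2 h.reg3 (c := 11) (B := sourceProg) (T := 14) (by decide)
    (by decide) (by decide) (fun u m =>
      ((¬ Acc (TrimEdge A) u ∧ StrictReach A u.1 u.2) ∧ m = 0) ∨
      (¬ (¬ Acc (TrimEdge A) u ∧ StrictReach A u.1 u.2) ∧ m = 1))
    fun b u hr ha h20 => halts_sourceProg hB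
      (h.of_eq (fun r _ => hr r (by omega)) fun i hi => ha i (by revert i; decide))
      (by rw [ReachTable, ha 1 (by decide)]; exact hR)
      (by rw [TrimTable, ha 10 (by decide)]; exact hT) h20
  refine (fill.seq (T' := n * n * (k * 35 + 19) + 8) ?_).mono (by linarith) fun _ _ h => h
  intro b hf hb
  have hb' : Tables A b := h.frame hf (by decide) (by decide)
  have hRb : ReachTable A b := hR.frame hf (by decide)
  have search := (edgeSpec_kept hB hb' hRb (X := {8, 11}) (by simp)).search (by decide) (by decide)
    hS (by omega) (by omega) hb'.reg1 hb'.reg2 hb'.reg3 hb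
  refine (search.seq (T' := n * n * 6 + 3) ?_).mono (by linarith) fun _ _ h => h
  intro d hf hd
  rw [edgeRel_kept] at hd
  have hd' : Tables A d := hb'.frame hf (by decide) (by decide)
  refine (halts_fillProg hB hd'.reg2 hd'.reg3 (c := 3) (B := complementProg 11) (T := 2) (by decide)
    (by decide) (by decide) (fun u m => IsBit (Visited A u) m) ?_).mono le_rfl fun _ _ h => h
  intro b u hr ha h20
  refine (halts_complementProg (c := 11) (by decide) ((code_lt u).trans_le hS)
    (by rw [hr 3 (by decide), hd'.reg3]) h20).mono le_rfl fun b' _ hb => hb.congr ?_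
  rw [ha 11 (by decide), hd, visited_iff_acc]
  simp only [and_assoc]

/-- Compute the table of marked pairs (array `2`). -/
def markedProg : ArrayProg := fillProg 2 (existsEdgeProg markEdgeProg)

theorem halts_markedProg (hB : Bounds W S k n) (h : Tables A a) (hR : ReachTable A a) :
    Halts W S markedProg a (n * n * (k * 29 + 8) + 3)
      fun b => ∀ u, IsBit (Marked A u) (b.arr 2 (code u)) := by
  refine halts_fillProg hB h.reg2 h.reg3 (c := 2) (B := existsEdgeProg markEdgeProg) (by decide)
    (by decide) (by decide) (fun u m => IsBit (Marked A u) m) fun b u hr ha h20 => ?_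
  exact (edgeSpec_mark hB h hR (X := {2}) (by simp)).halts_existsEdgeProg hB h.reg1 h.reg3 hr
    (fun i hi => ha i (by simpa using hi)) h20

/-- Put into register `26` whether the pair in register `20` is visited and marked. -/
def rejectProg : ArrayProg :=
  .load 24 3 20 ;; .load 25 2 20 ;; .const 26 0 ;; .ite 24 (.ite 25 (.const 26 1) .skip) .skip

/-- Put the verdict into register `5`. -/
def verdictProg : ArrayProg := .const 27 0 ;; .add 5 4 27 ;; refuteProg 5 rejectProg

theorem halts_verdictProg (hB : Bounds W S k n) (h : Tables A a)
    (h4 : IsBit (ConditionOne A) (a.reg 4)) (hV : ∀ u, IsBit (Visited A u) (a.arr 3 (code u)))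
    (hM : ∀ u, IsBit (Marked A u) (a.arr 2 (code u))) :
    Halts W S verdictProg a (n * n * 11 + 5) fun b => IsBit (TestAccepts A) (b.reg 5) := by
  have h₁ := hB.le_word
  have h₂ := hB.pos
  have h₃ := (isBit_iff.1 h4).1
  have pre : Halts W S (.const 27 0) a 1 fun b => b.reg 27 = 0 :=
    ⟨1, _, le_rfl, .const a 27 0 (Nat.zero_le _), by simp⟩
  refine (pre.seq (T' := n * n * 11 + 4) ?_).mono (by omega) fun _ _ h => h
  intro b hf h27
  have hb4 : b.reg 4 = a.reg 4 := hf.1 4 (by decide)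
  have hb' : Tables A b := h.frame hf (by decide) (by decide)
  have hba : b.arr = a.arr := funext fun i => hf.2 i (by simp [ArrayProg.arrs])
  have pre' : Halts W S (.add 5 4 27) b 1 fun b => b.reg 5 = a.reg 4 := by
    refine ⟨1, _, le_rfl, .add b 5 4 27 (by omega), ?_⟩
    simp [h27, hb4]
  refine (pre'.seq (T' := n * n * 11 + 3) ?_).mono (by omega) fun _ _ h => h
  intro c hf hc
  have hc' : Tables A c := hb'.frame hf (by decide) (by decide)
  have hca : c.arr = a.arr := funext fun i => by rw [hf.2 i (by simp [ArrayProg.arrs]), hba]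
  rw [← hc] at h4
  refine (halts_refuteProg hB hc'.reg2 hc'.reg3 (d := 5) (B := rejectProg) (T := 6) (by decide)
    (by decide) (by decide) (fun u => Visited A u ∧ Marked A u) h4 ?_).mono le_rfl
    fun d _ hd => hd.congr ?_
  · intro d u hr ha h20
    have hu := (code_lt u).trans_le hB.sq_le
    refine ArrayProg.Pre.halts (P := rejectProg) ?_
    rw [← (hV u).ne_zero_iff, ← (hM u).ne_zero_iff]
    simp only [rejectProg, ArrayProg.Pre, ArrayState.setReg_reg, ArrayState.setReg_arr,
      Nat.reduceEqDiff, if_true, if_false, h20, ha, hca, hu, true_and, Nat.reduceLT, Nat.zero_le]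
    omega
  · refine and_congr_right fun _ => forall_congr' fun u => ?_
    exact not_and

/-- The whole test. -/
def testProg : ArrayProg :=
  multiplesProg ;; coordinatesProg ;; reachTableProg ;; trimProg ;; conditionOneProg ;;
    visitedProg ;; markedProg ;; verdictProg

/-- Each intermediate bound is the budget left for the remaining phases; the linear cost of the
multiples is absorbed by n ≤ n * n. -/
theorem halts_testProg (hB : Bounds W S k n) (hBk : n * n * k ≤ S) (h0 : a.reg 0 = n)
    (h1 : a.reg 1 = k) (h2 : a.reg 2 = n * n) (h3 : a.reg 3 = 1)
    (hstep : ∀ (p : Fin n) (j : Fin k), a.arr 0 (p * k + j) = A.step p j)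
    (h10 : ∀ y < n * n, a.arr 10 y = 0) :
    Halts W S testProg a (n * n * (k * 157 + 161) + 60) fun b =>
      IsBit (TestAccepts A) (b.reg 5) ∧ IsBit (ConditionOne A) (b.reg 4) ∧ ReachTable A b ∧
      (∀ u, IsBit (Marked A u) (b.arr 2 (code u))) ∧
      ∀ u, IsBit (Visited A u) (b.arr 3 (code u)) := by
  have hn0 : 0 < n := Nat.pos_of_neZero n
  have hnn : n ≤ n * n := Nat.le_mul_of_pos_right n hn0
  refine ((halts_multiplesProg hB h0 h1 h3).seq
    (T' := n * n * (k * 157 + 154) + 55) ?_).mono (by linarith) fun _ _ h => h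
  rintro b₁ hf₁ ⟨hK, hN⟩
  have r₁ : ∀ r < 4, b₁.reg r = a.reg r := fun r hr => hf₁.1 r (by revert r; decide)
  refine ((halts_coordinatesProg hB hn0 (by rw [r₁ 0 (by decide), h0])
    (by rw [r₁ 2 (by decide), h2]) (by rw [r₁ 3 (by decide), h3])).seq
    (T' := n * n * (k * 157 + 144) + 50) ?_).mono (by linarith) fun _ _ h => h
  rintro b₂ hf₂ ⟨hfst, hsnd⟩
  have r₂ : ∀ r < 4, b₂.reg r = a.reg r := fun r hr => by
    rw [hf₂.1 r (by revert r; decide), r₁ r hr]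
  have t₂ : Tables A b₂ :=
    { reg0 := by rw [r₂ 0 (by decide), h0]
      reg1 := by rw [r₂ 1 (by decide), h1]
      reg2 := by rw [r₂ 2 (by decide), h2]
      reg3 := by rw [r₂ 3 (by decide), h3]
      step := by
        rw [hf₂.2 0 (by decide), hf₁.2 0 (by decide)]
        exact hstep
      mulK := fun p => by rw [hf₂.2 4 (by decide), hK p p.2]
      mulN := fun p => by rw [hf₂.2 5 (by decide), hN p p.2]
      fst := hfst
      snd := hsnd }
  refine ((halts_reachTableProg hB t₂).seq
    (T' := n * n * (k * 130 + 114) + 39) ?_).mono (by linarith) fun _ _ h => h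
  intro b₃ hf₃ hR₃
  have t₃ : Tables A b₃ := t₂.frame hf₃ (by decide) (by decide)
  refine ((halts_trimProg hB hBk t₃ hR₃ ?_).seq
    (T' := n * n * (k * 64 + 95) + 31) ?_).mono (by linarith) fun _ _ h => h
  · rw [hf₃.2 10 (by decide), hf₂.2 10 (by decide), hf₁.2 10 (by decide)]
    exact h10
  intro b₄ hf₄ hT₄
  have t₄ : Tables A b₄ := t₃.frame hf₄ (by decide) (by decide)
  have hR₄ : ReachTable A b₄ := hR₃.frame hf₄ (by decide)
  refine ((halts_conditionOneProg hB t₄ hR₄ hT₄).seq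
    (T' := n * n * (k * 64 + 76) + 27) ?_).mono (by linarith) fun _ _ h => h
  intro b₅ hf₅ h₅
  have t₅ : Tables A b₅ := t₄.frame hf₅ (by decide) (by decide)
  have hR₅ : ReachTable A b₅ := hR₄.frame hf₅ (by decide)
  have hT₅ : TrimTable A b₅ := by
    rw [TrimTable, hf₅.2 10 (by decide)]
    exact hT₄
  refine ((halts_visitedProg hB t₅ hR₅ hT₅).seq
    (T' := n * n * (k * 29 + 39) + 16) ?_).mono (by linarith) fun _ _ h => h
  intro b₆ hf₆ hV₆
  have t₆ : Tables A b₆ := t₅.frame hf₆ (by decide) (by decide)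
  have hR₆ : ReachTable A b₆ := hR₅.frame hf₆ (by decide)
  refine ((halts_markedProg hB t₆ hR₆).seq
    (T' := n * n * 11 + 5) ?_).mono (by linarith) fun _ _ h => h
  intro b₇ hf₇ hM₇
  have t₇ : Tables A b₇ := t₆.frame hf₇ (by decide) (by decide)
  have hR₇ : ReachTable A b₇ := hR₆.frame hf₇ (by decide)
  have h4₇ : IsBit (ConditionOne A) (b₇.reg 4) := by
    rwa [hf₇.1 4 (by decide), hf₆.1 4 (by decide)]
  have hV₇ : ∀ u, IsBit (Visited A u) (b₇.arr 3 (code u)) := by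
    rw [hf₇.2 3 (by decide)]
    exact hV₆
  refine (halts_verdictProg hB t₇ h4₇ hV₇ hM₇).mono le_rfl ?_
  intro b₈ hf₈ h5
  refine ⟨h5, ?_, hR₇.frame hf₈ (by decide), ?_, ?_⟩
  · rwa [hf₈.1 4 (by decide)]
  · rw [hf₈.2 2 (by decide)]
    exact hM₇
  · rw [hf₈.2 3 (by decide)]
    exact hV₇

end TestProgram

end LocalTestability

namespace LocalTestability

/-! ### The random access machine program -/

section Machine

variable {W : ℕ}

namespace Prog

/-- The number of steps of a program without loops and branches. -/
def cost : Prog → ℕ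
  | .seq c d => c.cost + d.cost
  | _ => 1

/-- A precondition for the postcondition `Q` of a sequence of arithmetic instructions. -/
def Pre (W : ℕ) : Prog → (MachineState → Prop) → MachineState → Prop
  | .const x c, Q, s => c ≤ W ∧ Q (s.setReg x c)
  | .add x y z, Q, s => s.reg y + s.reg z ≤ W ∧ Q (s.setReg x (s.reg y + s.reg z))
  | .seq c d, Q, s => c.Pre W (d.Pre W Q) s
  | _, _, _ => False

theorem Pre.runs {P : Prog} {s : MachineState} {Q : MachineState → Prop} (h : P.Pre W Q s) :
    ∃ s', Runs W P s P.cost s' ∧ Q s' := by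
  induction P generalizing s Q with
  | const x c => exact ⟨_, .const s x c h.1, h.2⟩
  | add x y z => exact ⟨_, .add s x y z h.1, h.2⟩
  | seq c d ihc ihd =>
    obtain ⟨s₁, h₁, h₂⟩ := ihc h
    obtain ⟨s₂, h₃, h₄⟩ := ihd h₂
    exact ⟨s₂, .seq h₁ h₃, h₄⟩
  | _ => exact h.elim

end Prog

theorem MachineState.setReg_apply (s : MachineState) (x m y : ℕ) :
    (s.setReg x m).reg y = if y = x then m else s.reg y := by
  simp [MachineState.setReg, Function.update_apply]

/-- Add register `b` to register `c` as often as register `19` says; register `23` is supposed to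
hold `1`. -/
def multiplyProg (c b : ℕ) : Prog := .loop 19 (.seq (.add c c b) (.sub 19 19 23))

theorem runs_multiplyProg {c b m : ℕ} {s : MachineState} (hcb : c ≠ b) (hc : c ≠ 19 ∧ c ≠ 23)
    (hb : b ≠ 19) (h19 : s.reg 19 = m) (h23 : s.reg 23 = 1) (hm : m ≤ W)
    (hW : s.reg c + m * s.reg b ≤ W) :
    ∃ s', Runs W (multiplyProg c b) s (m * 3 + 1) s' ∧ s'.mem = s.mem ∧
      ∀ x, s'.reg x = if x = c then s.reg c + m * s.reg b else if x = 19 then 0 else s.reg x := by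
  induction m generalizing s with
  | zero =>
    refine ⟨s, .loopDone h19, rfl, fun x => ?_⟩
    split_ifs with h₁ h₂
    · rw [h₁, zero_mul, add_zero]
    · rw [h₂, h19]
    · rfl
  | succ m ih =>
    rw [add_mul, one_mul] at hW
    have h₁ : Runs W (.add c c b) s 1 (s.setReg c (s.reg c + s.reg b)) :=
      .add s c c b (by omega)
    set s₁ := s.setReg c (s.reg c + s.reg b) with hs₁
    have e₁ : s₁.reg 19 = m + 1 := by
      rw [hs₁, MachineState.setReg_apply, if_neg hc.1.symm, h19]
    have e₂ : s₁.reg 23 = 1 := by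
      rw [hs₁, MachineState.setReg_apply, if_neg hc.2.symm, h23]
    have h₂ : Runs W (.sub 19 19 23) s₁ 1 (s₁.setReg 19 (s₁.reg 19 - s₁.reg 23)) :=
      .sub s₁ 19 19 23 (by omega)
    rw [e₁, e₂, Nat.add_sub_cancel] at h₂
    have e₃ : (s₁.setReg 19 m).reg c = s.reg c + s.reg b := by
      rw [MachineState.setReg_apply, if_neg hc.1, hs₁, MachineState.setReg_apply, if_pos rfl]
    have e₄ : (s₁.setReg 19 m).reg b = s.reg b := by
      rw [MachineState.setReg_apply, if_neg hb, hs₁, MachineState.setReg_apply, if_neg hcb.symm]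
    obtain ⟨s', hr, hmem, hreg⟩ := ih (s := s₁.setReg 19 m)
      (by rw [MachineState.setReg_apply, if_pos rfl])
      (by rw [MachineState.setReg_apply, if_neg (by decide), e₂]) (by omega)
      (by rw [e₃, e₄]; omega)
    refine ⟨s', ?_, by rw [hmem]; rfl, fun x => ?_⟩
    · have : (m + 1) * 3 + 1 = 1 + (1 + 1) + (m * 3 + 1) := by omega
      rw [this]
      exact .loopStep (by omega) (.seq h₁ h₂) hr
    · rw [hreg x, e₃, e₄, add_mul, one_mul]
      split_ifs with h₃ h₄
      · omega
      · rfl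
      · rw [MachineState.setReg_apply, if_neg h₄, hs₁, MachineState.setReg_apply, if_neg h₃]

/-- Copy the input and prepare the computation of the number of pairs of states. -/
def copyInputProg : Prog :=
  .seq (.const 23 1) (.seq (.add 20 0 18) (.seq (.add 21 1 18) (.add 19 0 18)))

/-- Compute the base addresses of the arrays from the first one. -/
def basesProg : Prog :=
  .seq (.const 2 0) <| .seq (.add 4 3 3) <| .seq (.add 5 4 3) <| .seq (.add 6 5 3) <|
  .seq (.add 7 6 3) <| .seq (.add 8 7 3) <| .seq (.add 9 8 3) <| .seq (.add 10 9 3) <|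
  .seq (.add 11 10 3) <| .seq (.add 12 11 3) <| .seq (.add 13 12 3) <| .seq (.add 14 13 3) <|
  .seq (.add 15 14 3) <| .seq (.add 16 15 3) <| .add 17 16 3

/-- Compute the number of pairs of states, the size of the arrays and their base addresses. -/
def setupProg : Prog :=
  .seq copyInputProg <| .seq (multiplyProg 22 20) <| .seq (.add 19 21 23) <|
    .seq (multiplyProg 3 22) basesProg

/-- Put the verdicts and the base addresses of the tables into the output registers. -/
def outputProg : Prog :=
  .seq (.const 18 0) <| .seq (.add 0 25 18) <| .seq (.add 1 24 18) <| .seq (.add 2 3 18) <|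
    .seq (.add 3 4 18) (.add 4 5 18)

/-- The array state that presents the automaton `A`. -/
def initialState {k n : ℕ} (A : DFA (Fin k) (Fin n)) : ArrayState where
  reg x := if x = 0 then n else if x = 1 then k else if x = 2 then n * n else if x = 3 then 1 else 0
  arr i j := if i = 0 then (inputState A).mem j else 0

variable {S k n : ℕ} {A : DFA (Fin k) (Fin n)}

theorem inputState_mem_lt (j : ℕ) (hn : 0 < n) : (inputState A).mem j < n := by
  simp only [inputState]
  split_ifs
  · exact Fin.is_lt _
  · exact hn

theorem inputState_mem_step (p : Fin n) (j : Fin k) :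
    (inputState A).mem (p * k + j) = A.step p j := by
  have hk : 0 < k := j.pos
  have h : (p : ℕ) * k + j < n * k := by
    have h₁ : (p + 1 : ℕ) * k ≤ n * k := Nat.mul_le_mul_right k p.2
    rw [add_mul, one_mul] at h₁
    have := j.2
    omega
  simp only [inputState, dif_pos h]
  congr 2
  · refine Fin.ext ?_
    simp only [Fin.coe_divNat]
    rw [mul_comm, Nat.mul_add_div hk, Nat.div_eq_of_lt j.2, add_zero]
  · refine Fin.ext ?_
    simp only [Fin.coe_modNat]
    rw [mul_comm, Nat.mul_add_mod, Nat.mod_eq_of_lt j.2]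

theorem runs_basesProg {s : MachineState} (h3 : s.reg 3 = S) (hW : 16 * S ≤ W) :
    ∃ s', Runs W basesProg s 15 s' ∧ s'.mem = s.mem ∧ (∀ x, s'.reg (x + 20) = s.reg (x + 20)) ∧
      ∀ i < 16, s'.reg (i + 2) = i * S := by
  refine Prog.Pre.runs (P := basesProg) ?_
  simp only [basesProg, Prog.Pre, MachineState.setReg_apply, Nat.reduceEqDiff, if_true, if_false, h3]
  refine ⟨by omega, by omega, by omega, by omega, by omega, by omega, by omega, by omega,
    by omega, by omega, by omega, by omega, by omega, by omega, by omega, rfl, ?_, ?_⟩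
  · intro x
    simp
  · intro i hi
    interval_cases i <;> simp only [Nat.reduceAdd, Nat.reduceEqDiff, if_true, if_false, h3] <;> omega

/-- Array 0 has base address 0, so the transition table is already in place, and only registers have
to be prepared. The products n * n and (k + 1) * (n * n) are formed by n and k + 1 additions. -/
theorem exists_runs_setupProg (hn : 0 < n) (hS : S = (k + 1) * (n * n)) (hW : 16 * S ≤ W) :
    ∃ t s, t ≤ n * 3 + k * 3 + 30 ∧ Runs W setupProg (inputState A) t s ∧
      Represents W S s (initialState A) := by
  have hnn : n ≤ n * n := Nat.le_mul_of_pos_right n hn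
  have hN : n * n ≤ S := by
    rw [hS]
    exact Nat.le_mul_of_pos_left _ (by omega)
  have hk : k + 1 ≤ S := by
    rw [hS]
    exact Nat.le_mul_of_pos_right _ (by omega)
  have hnk : n * k ≤ S := by
    rw [hS, add_mul, one_mul, mul_comm n k]
    exact (Nat.mul_le_mul_left k hnn).trans (Nat.le_add_right _ _)
  -- Register 18 still holds 0, so adding it copies. Registers 20 to 23 will represent the array
  -- machine's registers 0 to 3.
  obtain ⟨s₁, hr₁, hm₁, e19, e20, e21, e22, e23, e3, e24⟩ :=
    Prog.Pre.runs (W := W) (P := copyInputProg) (s := inputState A)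
    (Q := fun s => s.mem = (inputState A).mem ∧ s.reg 19 = n ∧ s.reg 20 = n ∧ s.reg 21 = k ∧
      s.reg 22 = 0 ∧ s.reg 23 = 1 ∧ s.reg 3 = 0 ∧ ∀ x, s.reg (x + 24) = 0) (by
      simp only [copyInputProg, Prog.Pre, MachineState.setReg_apply, inputState, Nat.reduceEqDiff,
        if_true, if_false, OfNat.ofNat_ne_zero, OfNat.ofNat_ne_one, OfNat.zero_ne_ofNat,
        OfNat.one_ne_ofNat, one_ne_zero, add_zero]
      exact ⟨by omega, by omega, by omega, by omega, rfl, trivial, trivial, trivial, trivial, trivial,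
        trivial, fun x => by simp⟩)
  obtain ⟨s₂, hr₂, hm₂, hs₂⟩ := runs_multiplyProg (W := W) (c := 22) (b := 20) (m := n) (s := s₁)
    (by decide) (by decide) (by decide) e19 e23 (by omega) (by rw [e20, e22]; omega)
  have g20 : s₂.reg 20 = n := by rw [hs₂, if_neg (by decide), if_neg (by decide), e20]
  have g21 : s₂.reg 21 = k := by rw [hs₂, if_neg (by decide), if_neg (by decide), e21]
  have g22 : s₂.reg 22 = n * n := by rw [hs₂, if_pos rfl, e20, e22, zero_add]
  have g23 : s₂.reg 23 = 1 := by rw [hs₂, if_neg (by decide), if_neg (by decide), e23]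
  have g3 : s₂.reg 3 = 0 := by rw [hs₂, if_neg (by decide), if_neg (by decide), e3]
  have g24 : ∀ x, s₂.reg (x + 24) = 0 := fun x => by
    rw [hs₂, if_neg (by omega), if_neg (by omega), e24]
  have h₃ : Runs W (.add 19 21 23) s₂ 1 (s₂.setReg 19 (s₂.reg 21 + s₂.reg 23)) :=
    .add s₂ 19 21 23 (by omega)
  rw [g21, g23] at h₃
  have hs₃ : ∀ x, (s₂.setReg 19 (k + 1)).reg x = if x = 19 then k + 1 else s₂.reg x :=
    MachineState.setReg_apply s₂ 19 (k + 1)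
  set s₃ := s₂.setReg 19 (k + 1) with hs₃'
  have f3 : s₃.reg 3 = 0 := by rw [hs₃, if_neg (by decide), g3]
  have f22 : s₃.reg 22 = n * n := by rw [hs₃, if_neg (by decide), g22]
  obtain ⟨s₄, hr₄, hm₄, hs₄⟩ := runs_multiplyProg (W := W) (c := 3) (b := 22) (m := k + 1) (s := s₃)
    (by decide) (by decide) (by decide) (by rw [hs₃, if_pos rfl])
    (by rw [hs₃, if_neg (by decide), g23]) (by omega) (by rw [f3, f22, ← hS]; omega)
  have hs₄' : ∀ x, x ≠ 3 → x ≠ 19 → s₄.reg x = s₂.reg x := fun x h h' => by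
    rw [hs₄, if_neg h, if_neg h', hs₃, if_neg h']
  have i3 : s₄.reg 3 = S := by rw [hs₄, if_pos rfl, f3, f22, ← hS, zero_add]
  obtain ⟨s₅, hr₅, hm₅, hs₅⟩ := runs_basesProg (s := s₄) i3 hW
  have hmem : s₅.mem = (inputState A).mem := by rw [hm₅, hm₄, hs₃', ← hm₁, ← hm₂]; rfl
  refine ⟨_, s₅, ?_, .seq hr₁ (.seq hr₂ (.seq h₃ (.seq hr₄ hr₅))), ?_, ?_, hs₅.2, ?_, ?_⟩
  · have : copyInputProg.cost = 4 := rfl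
    omega
  · intro x
    rw [hs₅.1, hs₄' _ (by omega) (by omega)]
    rcases x with _ | _ | _ | _ | x
    · exact g20
    · exact g21
    · exact g22
    · exact g23
    · exact g24 x
  · intro x
    simp only [initialState]
    split_ifs <;> omega
  · intro i hi j hj
    rw [hmem]
    simp only [initialState]
    split_ifs with h
    · rw [h, zero_mul, zero_add]
    -- The input occupies n * k ≤ S cells, so all arrays except the first begin as zeros.
    · have : S ≤ i * S := Nat.le_mul_of_pos_left _ (by omega)
      simp only [inputState]
      rw [dif_neg (by omega)]
  · intro i _ j _
    simp only [initialState]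
    split_ifs
    · exact (inputState_mem_lt j hn).le.trans (by omega)
    · omega

/-- The base addresses in registers 3, 4, 5 move down by one register in this order, so each is read
before it is overwritten. -/
theorem exists_runs_outputProg {s : MachineState} {a : ArrayState} (h : Represents W S s a)
    (hW : 16 * S ≤ W) :
    ∃ s', Runs W outputProg s 6 s' ∧ s'.mem = s.mem ∧ s'.reg 0 = a.reg 5 ∧ s'.reg 1 = a.reg 4 ∧
      s'.reg 2 = 1 * S ∧ s'.reg 3 = 2 * S ∧ s'.reg 4 = 3 * S := by
  have h25 := h.reg 5
  have h24 := h.reg 4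
  have h3 := h.base 1 (by decide)
  have h4 := h.base 2 (by decide)
  have h5 := h.base 3 (by decide)
  norm_num at h25 h24 h3 h4 h5
  have b5 := h.reg_le 5
  have b4 := h.reg_le 4
  refine Prog.Pre.runs (P := outputProg) ?_
  simp only [outputProg, Prog.Pre, MachineState.setReg_apply, Nat.reduceEqDiff, if_true, if_false,
    OfNat.ofNat_ne_zero, OfNat.ofNat_ne_one, OfNat.zero_ne_ofNat, OfNat.one_ne_ofNat, one_ne_zero,
    zero_ne_one, add_zero, h25, h24, h3, h4, h5, one_mul]
  refine ⟨by omega, b5, b4, by omega, by omega, by omega, rfl, ?_⟩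
  simp

end Machine

end LocalTestability

/-! ### Assembly -/

open LocalTestability
theorem mainTheorem5 :
    (∀ (α : Type*) (σ : Type*) [Finite α] [Finite σ] (A : DFA α σ),
      (LocallyTestableTransitions A ↔ TestAccepts A) ∧
      (IsReducedDFA A → (LocallyTestableLanguage A.accepts ↔ TestAccepts A))) ∧
    ∃ (P : Prog) (C : ℕ), ∀ (k n : ℕ) (A : DFA (Fin k) (Fin n)),
      ∃ (t : ℕ) (s : MachineState),
        t ≤ C * (k + 1) * n ^ 2 ∧
        Runs (C * (k + 1) * n ^ 2) P (inputState A) t s ∧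
        AlgorithmOutput A s ∧
        IsBit (LocallyTestableTransitions A) (s.reg 0) ∧
        (IsReducedDFA A → IsBit (LocallyTestableLanguage A.accepts) (s.reg 0)) := by
  refine ⟨fun α σ _ _ A => ⟨locallyTestableTransitions_iff, fun hA =>
    (locallyTestableLanguage_accepts_iff hA).trans locallyTestableTransitions_iff⟩,
    -- With S = (k + 1) * n ^ 2, the setup takes at most 3n + 3k + 30 steps, the compiled test at
    -- most 2 * (n ^ 2 * (157k + 161) + 60) and the output 6. The sum is below 1000 * S, which also
    -- exceeds the 16 * S cells in use.
    .seq setupProg (.seq testProg.compile outputProg), 1000, fun k n A => ?_⟩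
  -- The start state excludes n = 0, where the bound would be zero; k = 0 is possible, hence the
  -- factor k + 1.
  have hn : 0 < n := A.start.pos
  have : NeZero n := ⟨hn.ne'⟩
  obtain ⟨S, hS⟩ : ∃ S, S = (k + 1) * (n * n) := ⟨_, rfl⟩
  have hW : 1000 * (k + 1) * n ^ 2 = 1000 * S := by rw [hS]; ring
  rw [hW]
  have hnn : n ≤ n * n := Nat.le_mul_of_pos_right n hn
  have hS' : S = n * n * k + n * n := by rw [hS]; ring
  have hk : k ≤ n * n * k := Nat.le_mul_of_pos_left _ (by omega)
  have hnk : n * k ≤ n * n * k := Nat.mul_le_mul_right k hnn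
  have hB : Bounds (1000 * S) S k n :=
    ⟨by omega, by omega, by omega, by omega, by omega, by omega⟩
  obtain ⟨t₁, s₁, ht₁, hr₁, hs₁⟩ :=
    exists_runs_setupProg (A := A) (W := 1000 * S) hn hS (by omega)
  obtain ⟨t₂, b, ht₂, hr₂, hv, hc, hR, hM, hV⟩ := halts_testProg (a := initialState A) (A := A) hB
    (by omega) rfl rfl rfl rfl inputState_mem_step fun _ _ => rfl
  obtain ⟨t₃, s₂, ht₃, hr₃, hs₂⟩ := hr₂.compile (by omega) hs₁
  obtain ⟨s₃, hr₄, hm, h0, h1, h2, h3, h4⟩ := exists_runs_outputProg hs₂ (by omega)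
  have table : ∀ (i : ℕ) (R : Fin n × Fin n → Prop), i < 16 →
      (∀ u, IsBit (R u) (b.arr i (code u))) → IsTable s₃ (i * S) R := by
    intro i R hi h p q
    have := h (p, q)
    rw [← hs₂.mem i hi _ ((code_lt (p, q)).trans_le hB.sq_le), ← hm, code] at this
    rwa [add_assoc]
  have hv' : IsBit (TestAccepts A) (s₃.reg 0) := by rwa [h0]
  refine ⟨t₁ + (t₃ + 6), s₃, ?_, .seq hr₁ (.seq hr₃ hr₄), ⟨hv', by rwa [h1], ?_, fun _ => ⟨?_, ?_⟩⟩,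
    hv'.congr locallyTestableTransitions_iff.symm, fun hA => hv'.congr
      ((locallyTestableLanguage_accepts_iff hA).trans locallyTestableTransitions_iff).symm⟩
  · have : n * n * (k * 157 + 161) = 157 * (n * n * k) + 161 * (n * n) := by ring
    omega
  · rw [h2]
    exact table 1 _ (by decide) hR
  · rw [h3]
    exact table 2 _ (by decide) hM
  · rw [h4]
    exact table 3 _ (by decide) hV
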